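/- Let $(Z_t)_{t\in\mathbb Z}$ be independent standard normal variables and let $\{X_{t,T}\}_{t=1,\dots,T}$ ($T\in\mathbb N$) be a locally stationary long-memory process, that is, $X_{t,T}=\sum_{l\ge 0}\psi_{t,T,l}Z_{t-l}$ in $L^2$ with $\sup_{T}\sup_{1\le t\le T}\sum_{l}\psi_{t,T,l}^2<\infty$, such that the following holds, where $I(l)=|l|$ for $l\neq0$, $I(0)=1$, $d,a:[0,1]\to[0,\infty)$ are twice differentiable and $d_\infty=\sup_{[0,1]}d$. 1. There are twice continuously differentiable $\psi_l:[0,1]\to\mathbb R$ ($l\ge0$) and a constant $C$ with $|\psi_{t,T,l}-\psi_l(t/T)|\le C\,T^{-1}I(l)^{-(1-d_\infty)}$ for all $1\le t\le T$ and $l\ge 0$, and $\psi_l(u)=a(u)I(l)^{-(1-d(u))}+O(I(l)^{-(2-d_\infty)})$ uniformly in $u\in[0,1]$ as $l\to\infty$. 2. The time-varying spectral density $f(u,\lambda)=\frac1{2\pi}\bigl|\sum_{l=0}^\infty\psi_l(u)e^{-i\lambda l}\bigr|^2$ is twice continuously differentiable on $(0,1)\times(0,\pi)$, and $f$ and its partial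 derivatives up to order two are continuous on $[0,1]\times(0,\pi]$. 3. For a constant $C$, all $l\ge1$, $u\in(0,1)$ and $\lambda\in(0,\pi]$: $|\psi_l'(u)|\le C(1+\log l)\,l^{-(1-d_\infty)}$, $|\psi_l''(u)|\le C(1+\log l)^2\,l^{-(1-d_\infty)}$, $|\partial_u f(u,\lambda)|\le C(1+|\log\lambda|)\lambda^{-2d_\infty}$, $|\partial_u^2 f(u,\lambda)|\le C(1+|\log\lambda|)^2\lambda^{-2d_\infty}$. Assume $d_\infty<1/8$. For $T=NM$ with positive integers $N,M$, $N$ even, put $X_{t,T}=0$ for $t\notin\{1,\dots,T\}$, $u_j=(N(j-1)+N/2)/T$, $\lambda_{k,N}=2\pi k/N$, $$I_N(u,\lambda)=\frac1{2\pi N}\Bigl|\sum_{s=0}^{N-1}X_{\lfloor uT\rfloor-N/2+1+s,T}\,e^{-i\lambda s}\Bigr|^2,$$ $$\tilde F_{1,T}=\frac1{4\pi M}\sum_{j=1}^M\int_{-\pi}^{\pi}I_N(u_j,\lambda)^2\,d\lambda,\qquad \hat F_{1,T}=\frac1T\sum_{j=1}^M\sum_{k=1}^{N/2}I_N(u_j,\lambda_{k,N})^2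 .$$ (i) $f^4$ is integrable on $[0,1]\times[-\pi,\pi]$. If $T\to\infty$ along a sequence $T=NM$ as above with $N\to\infty$, $N/T\to0$ and $\sqrt T/N^{1-4d_\infty}\to0$, then $\tilde F_{1,T}$ and $\hat F_{1,T}$ are square integrable and $$T\,\mathrm{Var}(\tilde F_{1,T})\to\frac{14}{3\pi}\int_{-\pi}^{\pi}\int_0^1f^4(u,\lambda)\,du\,d\lambda,\qquad T\,\mathrm{Var}(\hat F_{1,T})\to\frac5\pi\int_{-\pi}^{\pi}\int_0^1f^4(u,\lambda)\,du\,d\lambda .$$ (ii) These two limits are different unless all the functions $\psi_l$ vanish identically (which is excluded if $a(u)>0$ for some $u$). (iii) In the stationary case, that is, if $\psi_{t,T,l}=\psi_l(u)$ for all $t,T,l,u$, and if the $\psi_l$ are not all zero, let $I_T(\lambda)=\frac1{2\pi T}\bigl|\sum_{s=0}^{T-1}X_{1+s,T}\,e^{-i\lambda s}\bigr|^2$. Then $\int_{-\pi}^{\pi}I_T(\lambda)^2d\lambda$ and $\frac{2\pi}T\sum_{k=1}^TI_T(\lambda_{k,T})^2$ are square integrable, and $T$ times the variance of the former and $T$ times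 the variance of the latter converge, as $T\to\infty$, to two different limits. -/

import Mathlib

open MeasureTheory ProbabilityTheory Filter Topology Set
open scoped Real

noncomputable section

namespace LongMemory

/-- `I(l) = |l|` for `l ≠ 0` and `I(0) = 1`. -/
def idx (l : ℕ) : ℝ := if l = 0 then 1 else (l : ℝ)

/-- `d_∞ = sup_{u ∈ [0,1]} d(u)`. -/
def dSup (d : ℝ → ℝ) : ℝ := sSup (d '' Icc 0 1)

/-- The time varying spectral density
`f(u, x) = (2π)⁻¹ |∑_{l=0}^∞ ψ_l(u) exp(-i x l)|²`.
The series is in general only conditionally convergent (for `x ∉ 2πℤ`), so it is the limit of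
its partial sums and not an unconditional `tsum`. -/
def specDensity (ψ : ℕ → ℝ → ℝ) (u x : ℝ) : ℝ :=
  1 / (2 * π) *
    ‖limUnder atTop (fun n : ℕ => ∑ l ∈ Finset.range n,
        (ψ l u : ℂ) * Complex.exp (-Complex.I * (x : ℂ) * (l : ℂ)))‖ ^ 2

/-- Locally stationary long-memory processes: the triangular array `X T t`, `1 ≤ t ≤ T`, with
innovations `Z`, time varying MA(∞) coefficients `ψT T t l`, limiting coefficient functions
`ψ l : [0,1] → ℝ`, memory function `d` and amplitude `a`.  Functions on `[0,1]` are represented by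
functions on `ℝ`, of which only the values on `[0,1]` matter. -/
structure IsLocallyStationary {Ω : Type*} [MeasurableSpace Ω] (P : Measure Ω)
    (X : ℕ → ℤ → Ω → ℝ) (Z : ℤ → Ω → ℝ) (ψT : ℕ → ℤ → ℕ → ℝ) (ψ : ℕ → ℝ → ℝ)
    (d a : ℝ → ℝ) : Prop where
  /-- the innovations are independent ... -/
  indep : iIndepFun Z P
  /-- ... and standard normal -/
  gauss : ∀ t : ℤ, HasLaw (Z t) (gaussianReal 0 1) P
  /-- the observations are random variables -/
  meas : ∀ T : ℕ, ∀ t : ℤ, 1 ≤ t → t ≤ T → AEMeasurable (X T t) P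
  /-- `X_{t,T} = ∑_{l ≥ 0} ψ_{t,T,l} Z_{t-l}`, with convergence in `L²` -/
  repr : ∀ T : ℕ, ∀ t : ℤ, 1 ≤ t → t ≤ T →
    Tendsto (fun n : ℕ =>
      eLpNorm (fun ω => X T t ω - ∑ l ∈ Finset.range n, ψT T t l * Z (t - l) ω) 2 P)
      atTop (𝓝 0)
  /-- `sup_T sup_t ∑_l ψ_{t,T,l}² < ∞` -/
  sq_summable : ∃ C : ℝ, ∀ T : ℕ, ∀ t : ℤ, 1 ≤ t → t ≤ T →
    Summable (fun l => ψT T t l ^ 2) ∧ ∑' l, ψT T t l ^ 2 ≤ C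
  /-- each `ψ_l` is twice continuously differentiable on `[0,1]` -/
  psi_smooth : ∀ l : ℕ, ContDiffOn ℝ 2 (ψ l) (Icc 0 1)
  /-- `ψ_{t,T,l}` is approximated by `ψ_l(t/T)` -/
  approx : ∃ C : ℝ, ∀ T : ℕ, ∀ t : ℤ, 1 ≤ t → t ≤ T → ∀ l : ℕ,
    |ψT T t l - ψ l ((t : ℝ) / T)| ≤ C / (T * idx l ^ (1 - dSup d))
  d_nonneg : ∀ u ∈ Icc (0 : ℝ) 1, 0 ≤ d u
  a_nonneg : ∀ u ∈ Icc (0 : ℝ) 1, 0 ≤ a u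
  /-- `d` and `a` are twice differentiable on `[0,1]` -/
  d_diff : DifferentiableOn ℝ d (Icc 0 1) ∧
    DifferentiableOn ℝ (derivWithin d (Icc 0 1)) (Icc 0 1)
  a_diff : DifferentiableOn ℝ a (Icc 0 1) ∧
    DifferentiableOn ℝ (derivWithin a (Icc 0 1)) (Icc 0 1)
  /-- `ψ_l(u) = a(u) / I(l)^{1-d(u)} + O(1 / I(l)^{2-d_∞})` uniformly in `u` as `l → ∞` -/
  psi_asymp : ∃ C : ℝ, ∀ᶠ l : ℕ in atTop, ∀ u ∈ Icc (0 : ℝ) 1,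
    |ψ l u - a u / idx l ^ (1 - d u)| ≤ C / idx l ^ (2 - dSup d)
  /-- `f` is `C²` up to the boundary of `[0,1] × (0,π]`: it is `C²` in the interior, and `f` and
  its partial derivatives of order at most two are continuous on `[0,1] × (0,π]` -/
  f_smooth : ContDiffOn ℝ 2 (fun p : ℝ × ℝ => specDensity ψ p.1 p.2) (Icc 0 1 ×ˢ Ioc 0 π)
  psi_deriv : ∃ C : ℝ, ∀ l : ℕ, l ≠ 0 → ∀ u ∈ Ioo (0 : ℝ) 1,
    |deriv (ψ l) u| ≤ C * (1 + Real.log l) / (l : ℝ) ^ (1 - dSup d)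
  psi_deriv2 : ∃ C : ℝ, ∀ l : ℕ, l ≠ 0 → ∀ u ∈ Ioo (0 : ℝ) 1,
    |iteratedDeriv 2 (ψ l) u| ≤ C * (1 + Real.log l) ^ 2 / (l : ℝ) ^ (1 - dSup d)
  f_deriv : ∃ C : ℝ, ∀ x ∈ Ioc (0 : ℝ) π, ∀ u ∈ Ioo (0 : ℝ) 1,
    |deriv (fun v => specDensity ψ v x) u| ≤ C * (1 + |Real.log x|) / x ^ (2 * dSup d)
  f_deriv2 : ∃ C : ℝ, ∀ x ∈ Ioc (0 : ℝ) π, ∀ u ∈ Ioo (0 : ℝ) 1,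
    |iteratedDeriv 2 (fun v => specDensity ψ v x) u| ≤
      C * (1 + |Real.log x|) ^ 2 / x ^ (2 * dSup d)

/-- The periodogram of the stretch `x m, …, x (m+N-1)` of the real sequence `x`. -/
def periodogram (x : ℤ → ℝ) (m : ℤ) (N : ℕ) (lam : ℝ) : ℝ :=
  1 / (2 * π * N) *
    ‖∑ s ∈ Finset.range N, (x (m + s) : ℂ) * Complex.exp (-Complex.I * (lam : ℂ) * (s : ℂ))‖ ^ 2

/-- The sample `X_{1,T}, …, X_{T,T}`, extended by `0`. -/
def zeroExt {Ω : Type*} (X : ℕ → ℤ → Ω → ℝ) (T : ℕ) (ω : Ω) (t : ℤ) : ℝ :=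
  if 1 ≤ t ∧ t ≤ T then X T t ω else 0

/-- The local periodogram `I_N(u, λ)`, computed from
`X_{⌊uT⌋ - N/2 + 1, T}, …, X_{⌊uT⌋ + N/2, T}` (`N` is even). -/
def localPeriodogram {Ω : Type*} (X : ℕ → ℤ → Ω → ℝ) (T N : ℕ) (u lam : ℝ) (ω : Ω) : ℝ :=
  periodogram (zeroExt X T ω) (⌊u * T⌋ - (N / 2 : ℕ) + 1) N lam

/-- The usual periodogram `I_T(λ)` of the whole sample. -/
def fullPeriodogram {Ω : Type*} (X : ℕ → ℤ → Ω → ℝ) (T : ℕ) (lam : ℝ) (ω : Ω) : ℝ :=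
  periodogram (zeroExt X T ω) 1 T lam

/-- The rescaled midpoint `u_j = (N(j-1) + N/2) / T` of the `j`-th block. -/
def midpoint (T N j : ℕ) : ℝ := ((N : ℝ) * ((j : ℝ) - 1) + (N : ℝ) / 2) / T

/-- The Fourier frequency `λ_{k,N} = 2πk/N`. -/
def fourierFreq (N k : ℕ) : ℝ := 2 * π * k / N

/-- Riemann sum statistic `T⁻¹ ∑_{j=1}^M ∑_{k=1}^{⌊N/2⌋} I_N(u_j, λ_{k,N})²`. -/
def FHat {Ω : Type*} (X : ℕ → ℤ → Ω → ℝ) (T N M : ℕ) (ω : Ω) : ℝ :=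
  1 / (T : ℝ) * ∑ j ∈ Finset.Icc 1 M, ∑ k ∈ Finset.Icc 1 (N / 2),
    localPeriodogram X T N (midpoint T N j) (fourierFreq N k) ω ^ 2

/-- Integrated statistic `(4πM)⁻¹ ∑_{j=1}^M ∫_{-π}^π I_N(u_j, λ)² dλ`. -/
def FTilde {Ω : Type*} (X : ℕ → ℤ → Ω → ℝ) (T N M : ℕ) (ω : Ω) : ℝ :=
  1 / (4 * π * M) * ∑ j ∈ Finset.Icc 1 M,
    ∫ x in (-π)..π, localPeriodogram X T N (midpoint T N j) x ω ^ 2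

/-- `∫_{-π}^π I_T(λ)² dλ`. -/
def GInt {Ω : Type*} (X : ℕ → ℤ → Ω → ℝ) (T : ℕ) (ω : Ω) : ℝ :=
  ∫ x in (-π)..π, fullPeriodogram X T x ω ^ 2

/-- `(2π/T) ∑_{k=1}^T I_T(λ_{k,T})²`. -/
def GSum {Ω : Type*} (X : ℕ → ℤ → Ω → ℝ) (T : ℕ) (ω : Ω) : ℝ :=
  2 * π / T * ∑ k ∈ Finset.Icc 1 T, fullPeriodogram X T (fourierFreq T k) ω ^ 2

/-- `∫_{-π}^π ∫_0^1 f⁴(u, λ) du dλ`. -/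
def intF4 (ψ : ℕ → ℝ → ℝ) : ℝ :=
  ∫ x in (-π)..π, ∫ u in (0 : ℝ)..1, specDensity ψ u x ^ 4

end LongMemory

end

/-! Since |z|⁴ = z z̄ z z̄, a squared periodogram is a quartic form: up to constants a block
contributes Σ_s χ(alt s) ∏ x(s_i), summed over quadruples s of the block with alt s = s₀ - s₁ + s₂ -
s₃. Integration over λ selects alt s = 0; summation over all Fourier frequencies selects N ∣ alt s.
Both selectors satisfy `IsSel` and are treated together. The half sum over k ≤ N/2 adds a bounded
weight `rhoW` with an extra factor 1/N, which is negligible.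

The sample is a Gaussian process, being an L² limit of finite sums, so the covariance of two quartic
products is the sum over the 105 - 9 = 96 pairings of eight indices that link the two quadruples.
The symmetries of alt reduce them to seven diagrams (`pairSum_wickCov`). Fix the four lags of a
diagram. In `diagA` (8 pairings) and `diagC` (32 pairings) the two constraints differ by the
alternating sum of the lags alone, so three coordinates stay free and the sum is of order N³. In the
other diagrams two independent congruences remain, and there are at most 2N² choices
(`card_fibre_le`).

The two limits separate at this point. In `diagA` the free coordinates run through the selected
quadruples; there are wN³ of them, with w → 2/3 for alt s = 0 and w = 1 for N ∣ alt s. In `diagC`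
the constraint ties s₃ to s₂ up to a short lag, so nonzero multiples of N occur only near the ends
of the block and the count is N³ for either selector. A block thus has variance about (8w + 32) N³
Q, where Q = Σ ∏ γ(h_i) over alt h = 0 and γ is the local autocovariance. By Parseval Q = 8π³ ∫ f⁴,
and 8w + 32 is 112/3 or 40, which gives the ratio 14 : 15. Moreover Q ≥ γ(0)⁴, so the limits differ
unless all coefficients vanish.

Pairs of different blocks contribute o(N³) per block (`exists_cross_bound`). Inside a block the
covariances are replaced by those of the stationary process at the midpoint, and a midpoint Riemann
sum gives the integral over u.

Long memory enters through the bound |cov| ≤ K(1+|h|)^(-(b+δ)) with b > 3/4 and δ > 0, available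
because d_∞ < 1/8. The inequality 4b > 3 makes the lag sums over alt h = 0 converge (`exists_quad`)
and the bad diagrams negligible; the spare δ pays for truncation and for cross-block terms. The same
threshold makes |λ|^(-8(1-e)) integrable, which bounds f⁴. -/

noncomputable section

namespace LongMemory

/-! ### Power-law kernels on the integers and their convolutions. -/

/-- The polynomially decaying kernel `(1 + |h|)^(-a)` on the integers. -/
def kf (a : ℝ) (h : ℤ) : ℝ := (1 + |(h : ℝ)|) ^ (-a)

lemma kf_pos (a : ℝ) (h : ℤ) : 0 < kf a h := Real.rpow_pos_of_pos (by positivity) _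

lemma kf_nonneg (a : ℝ) (h : ℤ) : 0 ≤ kf a h := (kf_pos a h).le

lemma kf_neg (a : ℝ) (h : ℤ) : kf a (-h) = kf a h := by simp [kf]

lemma kf_sub_comm (a : ℝ) (x y : ℤ) : kf a (x - y) = kf a (y - x) := by
  rw [← kf_neg, neg_sub]

lemma kf_anti {a : ℝ} (ha : 0 ≤ a) {h h' : ℤ} (hh : |h| ≤ |h'|) : kf a h' ≤ kf a h := by
  have : |(h : ℝ)| ≤ |(h' : ℝ)| := by exact_mod_cast hh
  exact Real.rpow_le_rpow_of_nonpos (by positivity) (by linarith) (by linarith)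

lemma kf_le_one {a : ℝ} (ha : 0 ≤ a) (h : ℤ) : kf a h ≤ 1 :=
  Real.rpow_le_one_of_one_le_of_nonpos (by linarith [abs_nonneg (h : ℝ)]) (by linarith)

lemma kf_exp_anti {a b : ℝ} (hab : a ≤ b) (h : ℤ) : kf b h ≤ kf a h :=
  Real.rpow_le_rpow_of_exponent_le (by linarith [abs_nonneg (h : ℝ)]) (by linarith)

lemma kf_mul (a b : ℝ) (h : ℤ) : kf a h * kf b h = kf (a + b) h := by
  rw [kf, kf, kf, ← Real.rpow_add (by positivity)]; ring_nf

lemma kf_zero (a : ℝ) : kf a 0 = 1 := by simp [kf]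

lemma kf_natCast (a : ℝ) (m : ℕ) : kf a m = (1 + (m : ℝ)) ^ (-a) := by simp [kf]

lemma kf_natAbs (a : ℝ) (h : ℤ) : kf a (h.natAbs : ℤ) = kf a h := by simp [kf]

/-- Induction in place of an integral comparison: Bernoulli's inequality with exponent 1 - a at
-1/(n+1) shows that n^(1-a) grows by at least (1 - a) `kf a n` in one step. -/
lemma sum_kf_range {a : ℝ} (ha : 0 < a) (ha1 : a < 1) (n : ℕ) :
    ∑ m ∈ Finset.range n, kf a m ≤ 1 / (1 - a) * (n : ℝ) ^ (1 - a) := by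
  have h1a : 0 < 1 - a := by linarith
  induction n with
  | zero => simp [Real.zero_rpow h1a.ne']
  | succ n ih =>
    rw [Finset.sum_range_succ]
    have hx : (0 : ℝ) < n + 1 := by positivity
    have hB := rpow_one_add_le_one_add_mul_self (s := -(1 / ((n : ℝ) + 1)))
      (by
        have : 1 / ((n : ℝ) + 1) ≤ 1 := by rw [div_le_one hx]; linarith [n.cast_nonneg (α := ℝ)]
        linarith) h1a.le (by linarith)
    have e1 : (1 + -(1 / ((n : ℝ) + 1))) = n / (n + 1) := by field_simp; ring
    rw [e1, Real.div_rpow (by positivity) hx.le, div_le_iff₀ (by positivity)] at hB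
    have e2 : (1 + (1 - a) * -(1 / ((n : ℝ) + 1))) * ((n : ℝ) + 1) ^ (1 - a) =
        ((n : ℝ) + 1) ^ (1 - a) - (1 - a) * kf a n := by
      have : kf a n = ((n : ℝ) + 1) ^ (1 - a) / (n + 1) := by
        rw [kf_natCast, add_comm, eq_div_iff hx.ne']
        nth_rewrite 2 [← Real.rpow_one ((n : ℝ) + 1)]
        rw [← Real.rpow_add hx]; ring_nf
      rw [this]; field_simp; ring
    rw [e2] at hB
    have : kf a n ≤ 1 / (1 - a) * (((n : ℝ) + 1) ^ (1 - a) - (n : ℝ) ^ (1 - a)) := by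
      rw [div_mul_eq_mul_div, le_div_iff₀ h1a]; linarith
    push_cast
    linarith [mul_sub (1 / (1 - a)) (((n : ℝ) + 1) ^ (1 - a)) ((n : ℝ) ^ (1 - a))]

/-- A telescoping majorant, so that tails can be summed exactly. It is Bernoulli's inequality with
exponent p - 1 at -1/(2+m); the factor 4 covers 2 + m ≤ 4(1 + m). -/
lemma kf_le_telescope {p : ℝ} (hp : 1 < p) (hp2 : p ≤ 2) (m : ℕ) :
    kf p m ≤ 4 / (p - 1) * (kf (p - 1) m - kf (p - 1) (m + 1 : ℕ)) := by
  set q := p - 1 with hq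
  have hq0 : 0 < q := by rw [hq]; linarith
  have hx : (0 : ℝ) < 1 + m := by positivity
  have hy : (0 : ℝ) < 2 + m := by positivity
  have hB := rpow_one_add_le_one_add_mul_self (s := -(1 / (2 + (m : ℝ))))
      (by
        have : 1 / (2 + (m : ℝ)) ≤ 1 := by rw [div_le_one hy]; linarith [m.cast_nonneg (α := ℝ)]
        linarith) hq0.le (by linarith)
  have e1 : (1 + -(1 / (2 + (m : ℝ)))) = (1 + m) / (2 + m) := by field_simp; ring
  rw [e1, Real.div_rpow hx.le hy.le] at hB
  have k1 : kf q m = ((1 + (m : ℝ)) ^ q)⁻¹ := by rw [kf_natCast, Real.rpow_neg hx.le]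
  have k2 : kf q (m + 1 : ℕ) = ((2 + (m : ℝ)) ^ q)⁻¹ := by
    rw [kf_natCast, Real.rpow_neg (by positivity)]; push_cast; ring_nf
  have k3 : kf p m = ((1 + (m : ℝ)) ^ q)⁻¹ / (1 + m) := by
    rw [kf_natCast, ← Real.rpow_neg hx.le, eq_div_iff hx.ne']
    nth_rewrite 2 [← Real.rpow_one (1 + (m : ℝ))]
    rw [← Real.rpow_add hx]; congr 1; rw [hq]; ring
  set X := (1 + (m : ℝ)) ^ q with hX
  set Y := (2 + (m : ℝ)) ^ q with hY
  have hX0 : 0 < X := Real.rpow_pos_of_pos hx _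
  have hY0 : 0 < Y := Real.rpow_pos_of_pos hy _
  rw [k1, k2, k3]
  have h1 : X⁻¹ - Y⁻¹ = X⁻¹ * (1 - X / Y) := by field_simp
  have h2 : q / (2 + m) ≤ 1 - X / Y := by
    have : q * -(1 / (2 + (m : ℝ))) = - (q / (2 + m)) := by ring
    linarith
  rw [h1, div_eq_mul_inv]
  have h3 : (1 + (m : ℝ))⁻¹ ≤ 4 / q * (1 - X / Y) := by
    calc (1 + (m : ℝ))⁻¹ ≤ 4 / q * (q / (2 + m)) := by
          rw [div_mul_div_cancel₀ hq0.ne', ← one_div, div_le_div_iff₀ hx hy]; linarith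
      _ ≤ _ := by gcongr
  calc X⁻¹ * (1 + (m : ℝ))⁻¹ ≤ X⁻¹ * (4 / q * (1 - X / Y)) := by gcongr
    _ = _ := by ring

lemma sum_kf_Ico {p : ℝ} (hp : 1 < p) (hp2 : p ≤ 2) (n L : ℕ) :
    ∑ m ∈ Finset.Ico n L, kf p m ≤ 4 / (p - 1) * kf (p - 1) n := by
  rcases le_total L n with h | h
  · rw [Finset.Ico_eq_empty_of_le h, Finset.sum_empty]
    have : 0 < p - 1 := by linarith
    have := kf_pos (p - 1) n
    positivity
  · calc _ ≤ ∑ m ∈ Finset.Ico n L, 4 / (p - 1) * (kf (p - 1) m - kf (p - 1) (m + 1 : ℕ)) :=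
        Finset.sum_le_sum fun m _ => kf_le_telescope hp hp2 m
      _ = 4 / (p - 1) * (kf (p - 1) n - kf (p - 1) L) := by
        rw [← Finset.mul_sum, Finset.sum_Ico_eq_sum_range]
        congr 1
        have := Finset.sum_range_sub' (fun i => kf (p - 1) ((n + i : ℕ) : ℤ)) (L - n)
        simp only [add_zero, Nat.add_sub_cancel' h] at this
        rw [← this]
        rfl
      _ ≤ _ := by
        have : 0 < p - 1 := by linarith
        gcongr
        linarith [kf_pos (p - 1) L]

/-- Each distance m from x is attained by at most the two points x ± m. -/
lemma sum_natAbs_le (φ : ℕ → ℝ) (hφ : ∀ m, 0 ≤ φ m) (A : Finset ℤ) (x : ℤ) (L : ℕ)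
    (hL : ∀ h ∈ A, (x - h).natAbs < L) :
    ∑ h ∈ A, φ (x - h).natAbs ≤ 2 * ∑ m ∈ Finset.range L, φ m := by
  rw [← Finset.sum_fiberwise_of_maps_to (t := Finset.range L) (g := fun h => (x - h).natAbs)
    (fun h hh => Finset.mem_range.2 (hL h hh)), Finset.mul_sum]
  refine Finset.sum_le_sum fun m _ => ?_
  rw [Finset.sum_congr rfl (g := fun _ => φ m)
    (fun h hh => by rw [(Finset.mem_filter.1 hh).2]), Finset.sum_const, nsmul_eq_mul]
  refine mul_le_mul_of_nonneg_right ?_ (hφ m)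
  have : (Finset.filter (fun h => (x - h).natAbs = m) A) ⊆ {x - m, x + m} := by
    intro h hh
    have := (Finset.mem_filter.1 hh).2
    simp only [Finset.mem_insert, Finset.mem_singleton]
    omega
  exact_mod_cast (Finset.card_le_card this).trans Finset.card_le_two

lemma exists_natAbs_bound (A : Finset ℤ) (x : ℤ) : ∃ L : ℕ, ∀ h ∈ A, (x - h).natAbs < L :=
  ⟨A.sup (fun h => (x - h).natAbs) + 1, fun _ hh =>
    Nat.lt_succ_of_le (Finset.le_sup (f := fun h : ℤ => (x - h).natAbs) hh)⟩

lemma kf_half {a : ℝ} (ha : 0 ≤ a) (ha1 : a ≤ 1) {h h' : ℤ} (hh : |h'| ≤ 2 * |h|) :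
    kf a h ≤ 2 * kf a h' := by
  have h1 : |(h' : ℝ)| ≤ 2 * |(h : ℝ)| := by exact_mod_cast hh
  calc kf a h ≤ ((1 + |(h' : ℝ)|) / 2) ^ (-a) :=
        Real.rpow_le_rpow_of_nonpos (by positivity) (by linarith) (by linarith)
    _ = 2 ^ a * kf a h' := by
        rw [Real.div_rpow (by positivity) (by norm_num), Real.rpow_neg (by norm_num : (0:ℝ) ≤ 2),
          div_inv_eq_mul, mul_comm, kf]
    _ ≤ 2 * kf a h' := by
        gcongr
        · exact kf_nonneg _ _
        · calc (2 : ℝ) ^ a ≤ 2 ^ (1 : ℝ) := Real.rpow_le_rpow_of_exponent_le (by norm_num) ha1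
            _ = 2 := by simp

/-- The half of the convolution in which h is closer to x than to y, hence |h - y| ≥ |x - y|/2. With
D = |x - y|: for |x - h| ≤ D the second factor is at most twice its value at x - y, and the first
sums to D^(1-a); beyond D the product is at most `kf (a + b)` of x - h, whose tail is of order
D^(1-a-b). -/
lemma conv_half {a b : ℝ} (ha : 0 < a) (ha1 : a < 1) (hb : 0 < b) (hb1 : b < 1)
    (hab : 1 < a + b) (A : Finset ℤ) (x y : ℤ) (hA : ∀ h ∈ A, |x - h| ≤ |h - y|) :
    ∑ h ∈ A, kf a (x - h) * kf b (h - y) ≤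
      (4 / (1 - a) + 8 / (a + b - 1)) * kf (a + b - 1) (x - y) := by
  set D := (x - y).natAbs with hD
  obtain ⟨L, hL⟩ := exists_natAbs_bound A x
  set φ : ℕ → ℝ := fun m => if m < D + 1 then 2 * kf b (x - y) * kf a m else kf (a + b) m with hφ
  have hφ0 : ∀ m, 0 ≤ φ m := fun m => by
    simp only [hφ]
    split_ifs
    · exact mul_nonneg (mul_nonneg zero_le_two (kf_nonneg _ _)) (kf_nonneg _ _)
    · exact kf_nonneg _ _
  have hφ1 : ∀ h ∈ A, kf a (x - h) * kf b (h - y) ≤ φ (x - h).natAbs := fun h hh => by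
    simp only [hφ]
    have h1 := hA h hh
    split_ifs
    · rw [kf_natAbs, mul_comm]
      refine mul_le_mul_of_nonneg_right (kf_half hb.le hb1.le ?_) (kf_nonneg _ _)
      have := abs_add_le (x - h) (h - y)
      rw [sub_add_sub_cancel] at this
      linarith
    · rw [kf_natAbs, ← kf_mul]
      exact mul_le_mul_of_nonneg_left (kf_anti hb.le h1) (kf_nonneg _ _)
  have hxy : kf (a + b - 1) D = kf (a + b - 1) (x - y) := kf_natAbs _ _
  have s1 : ∑ m ∈ Finset.range L with m < D + 1, φ m ≤ 2 / (1 - a) * kf (a + b - 1) (x - y) := by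
    calc _ ≤ ∑ m ∈ Finset.range (D + 1), φ m :=
          Finset.sum_le_sum_of_subset_of_nonneg (fun m hm => Finset.mem_range.2
            (Finset.mem_filter.1 hm).2) (fun m _ _ => hφ0 m)
      _ = 2 * kf b (x - y) * ∑ m ∈ Finset.range (D + 1), kf a m := by
          rw [Finset.mul_sum]
          exact Finset.sum_congr rfl fun m hm => if_pos (Finset.mem_range.1 hm)
      _ ≤ 2 * kf b (x - y) * (1 / (1 - a) * ((D + 1 : ℕ) : ℝ) ^ (1 - a)) := by
          refine mul_le_mul_of_nonneg_left (sum_kf_range ha ha1 _) ?_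
          exact mul_nonneg zero_le_two (kf_nonneg _ _)
      _ = 2 / (1 - a) * kf (a + b - 1) (x - y) := by
          have : ((D + 1 : ℕ) : ℝ) ^ (1 - a) = kf (a - 1) (x - y) := by
            rw [← kf_natAbs, kf_natCast, ← hD]; push_cast; ring_nf
          rw [this]
          have h2 : kf b (x - y) * kf (a - 1) (x - y) = kf (a + b - 1) (x - y) := by
            rw [kf_mul]; ring_nf
          rw [← h2]; ring
  have s2 : ∑ m ∈ Finset.range L with ¬ m < D + 1, φ m ≤
      4 / (a + b - 1) * kf (a + b - 1) (x - y) := by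
    calc _ = ∑ m ∈ Finset.range L with ¬ m < D + 1, kf (a + b) m :=
          Finset.sum_congr rfl fun m hm => if_neg (Finset.mem_filter.1 hm).2
      _ ≤ ∑ m ∈ Finset.Ico D L, kf (a + b) m :=
          Finset.sum_le_sum_of_subset_of_nonneg (fun m hm => by
            simp only [Finset.mem_filter, Finset.mem_range, Finset.mem_Ico] at hm ⊢; omega)
            (fun m _ _ => kf_nonneg _ _)
      _ ≤ _ := sum_kf_Ico hab (by linarith) D L
      _ = _ := by rw [hxy]
  calc _ ≤ ∑ h ∈ A, φ (x - h).natAbs := Finset.sum_le_sum hφ1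
    _ ≤ 2 * ∑ m ∈ Finset.range L, φ m := sum_natAbs_le φ hφ0 A x L hL
    _ ≤ _ := by
      rw [← Finset.sum_filter_add_sum_filter_not (Finset.range L) (fun m => m < D + 1)]
      have e : (4 / (1 - a) + 8 / (a + b - 1)) * kf (a + b - 1) (x - y) =
        2 * (2 / (1 - a) * kf (a + b - 1) (x - y) +
          4 / (a + b - 1) * kf (a + b - 1) (x - y)) := by ring
      rw [e]; gcongr

/-- Convolution bound for the kernels. -/
lemma exists_conv {a b : ℝ} (ha : 0 < a) (ha1 : a < 1) (hb : 0 < b) (hb1 : b < 1)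
    (hab : 1 < a + b) : ∃ C : ℝ, 0 ≤ C ∧ ∀ (A : Finset ℤ) (x y : ℤ),
      ∑ h ∈ A, kf a (x - h) * kf b (h - y) ≤ C * kf (a + b - 1) (x - y) := by
  have h1 : 0 < 1 - a := by linarith
  have h2 : 0 < 1 - b := by linarith
  have h3 : 0 < a + b - 1 := by linarith
  refine ⟨(4 / (1 - a) + 8 / (a + b - 1)) + (4 / (1 - b) + 8 / (a + b - 1)), by positivity,
    fun A x y => ?_⟩
  rw [← Finset.sum_filter_add_sum_filter_not A (fun h => |x - h| ≤ |h - y|), add_mul]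
  refine add_le_add (conv_half ha ha1 hb hb1 hab _ x y fun h hh => (Finset.mem_filter.1 hh).2) ?_
  have := conv_half hb hb1 ha ha1 (by linarith : 1 < b + a)
    (A.filter fun h => ¬ |x - h| ≤ |h - y|) y x (fun h hh => by
      have := (Finset.mem_filter.1 hh).2
      rw [abs_sub_comm y h, abs_sub_comm h x]; linarith)
  rw [add_comm b a, kf_sub_comm _ y x] at this
  refine le_trans (le_of_eq (Finset.sum_congr rfl fun h _ => ?_)) this
  rw [kf_sub_comm a, kf_sub_comm b, mul_comm]

/-- The alternating sum of a quadruple. -/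
def alt (s : Fin 4 → ℤ) : ℤ := s 0 - s 1 + s 2 - s 3

/-- The constraint determines the fourth lag from the other three. Summing these one at a time gives
the exponents 2b - 1, 3b - 2, 4b - 3, and the last is positive exactly when b > 3/4. -/
lemma exists_quad {b : ℝ} (hb : 3 / 4 < b) (hb1 : b < 1) : ∃ C : ℝ, 0 ≤ C ∧
    ∀ (Ω : Finset (Fin 4 → ℤ)) (c : ℤ), (∀ h ∈ Ω, alt h = c) →
      ∑ h ∈ Ω, ∏ i, kf b (h i) ≤ C := by
  obtain ⟨C1, h1, H1⟩ := exists_conv (by linarith) hb1 (by linarith : 0 < b) hb1 (by linarith)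
  obtain ⟨C2, h2, H2⟩ := exists_conv (a := b) (b := 2 * b - 1) (by linarith) hb1 (by linarith)
    (by linarith) (by linarith)
  obtain ⟨C3, h3, H3⟩ := exists_conv (a := b) (b := 3 * b - 2) (by linarith) hb1 (by linarith)
    (by linarith) (by linarith)
  refine ⟨C1 * C2 * C3, by positivity, fun Ω c hΩ => ?_⟩
  set A0 := Ω.image (fun h => h 0)
  set A1 := Ω.image (fun h => h 1)
  set A2 := Ω.image (fun h => h 2)
  have step1 : ∑ h ∈ Ω, ∏ i, kf b (h i) ≤ ∑ p ∈ A0 ×ˢ A1 ×ˢ A2,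
      kf b p.1 * kf b p.2.1 * kf b p.2.2 * kf b (p.1 - p.2.1 + p.2.2 - c) := by
    have inj : Set.InjOn (fun h : Fin 4 → ℤ => (h 0, h 1, h 2)) Ω := by
      intro h hh h' hh' e
      have e1 := hΩ h hh
      have e2 := hΩ h' hh'
      simp only [Prod.mk.injEq] at e
      obtain ⟨ea, eb, ec⟩ := e
      simp only [alt] at e1 e2
      funext i
      fin_cases i
      · exact ea
      · exact eb
      · exact ec
      · change h 3 = h' 3; omega
    have e : ∑ h ∈ Ω, ∏ i, kf b (h i) = ∑ p ∈ Ω.image (fun h : Fin 4 → ℤ => (h 0, h 1, h 2)),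
        kf b p.1 * kf b p.2.1 * kf b p.2.2 * kf b (p.1 - p.2.1 + p.2.2 - c) := by
      rw [Finset.sum_image inj]
      refine Finset.sum_congr rfl fun h hh => ?_
      rw [Fin.prod_univ_four]
      have e1 := hΩ h hh
      simp only [alt] at e1
      rw [show h 0 - h 1 + h 2 - c = h 3 by omega]
    rw [e]
    refine Finset.sum_le_sum_of_subset_of_nonneg ?_ fun p _ _ => ?_
    · intro p hp
      obtain ⟨h, hh, rfl⟩ := Finset.mem_image.1 hp
      simp only [Finset.mem_product]
      exact ⟨Finset.mem_image_of_mem _ hh, Finset.mem_image_of_mem _ hh,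
        Finset.mem_image_of_mem _ hh⟩
    · have := kf_nonneg b
      have := this p.1; have := kf_nonneg b p.2.1; have := kf_nonneg b p.2.2
      have := kf_nonneg b (p.1 - p.2.1 + p.2.2 - c)
      positivity
  refine step1.trans ?_
  rw [Finset.sum_product]
  simp only [Finset.sum_product]
  calc _ ≤ ∑ x ∈ A0, ∑ y ∈ A1, kf b x * kf b y * (C1 * kf (2 * b - 1) (y - (x - c))) := by
        refine Finset.sum_le_sum fun x _ => Finset.sum_le_sum fun y _ => ?_
        have := H1 A2 0 (c - x + y)
        simp only [mul_assoc, ← Finset.mul_sum]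
        refine mul_le_mul_of_nonneg_left (mul_le_mul_of_nonneg_left ?_ (kf_nonneg _ _))
          (kf_nonneg _ _)
        calc _ = ∑ h ∈ A2, kf b (0 - h) * kf b (h - (c - x + y)) := by
              refine Finset.sum_congr rfl fun h _ => ?_
              rw [zero_sub, kf_neg]; congr 2; ring
          _ ≤ _ := this
          _ = _ := by
              rw [← kf_neg]; congr 2 <;> ring
    _ ≤ ∑ x ∈ A0, kf b x * (C1 * (C2 * kf (3 * b - 2) (x - c))) := by
        refine Finset.sum_le_sum fun x _ => ?_
        have := H2 A1 0 (x - c)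
        calc _ = kf b x * (C1 * ∑ y ∈ A1, kf b (0 - y) * kf (2 * b - 1) (y - (x - c))) := by
              simp only [Finset.mul_sum]
              refine Finset.sum_congr rfl fun y _ => ?_
              rw [zero_sub, kf_neg]; ring
          _ ≤ _ := by
              refine mul_le_mul_of_nonneg_left (mul_le_mul_of_nonneg_left (this.trans (le_of_eq ?_))
                h1) (kf_nonneg _ _)
              rw [← kf_neg]; congr 2 <;> ring
    _ = C1 * C2 * ∑ x ∈ A0, kf b (0 - x) * kf (3 * b - 2) (x - c) := by
        rw [Finset.mul_sum]
        refine Finset.sum_congr rfl fun y _ => ?_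
        rw [zero_sub, kf_neg]; ring
    _ ≤ C1 * C2 * (C3 * 1) := by
        refine mul_le_mul_of_nonneg_left ((H3 A0 0 c).trans ?_) (by positivity)
        exact mul_le_mul_of_nonneg_left (kf_le_one (by linarith) _) h3
    _ = _ := by ring

/-- For |r| ≤ 1 the window lies in |h| < 2N and the plain sum bound applies. For |r| ≥ 2 it stays at
distance comparable to |r|N from the origin, and fewer than 2N terms of that size are added. -/
lemma exists_window {b : ℝ} (hb : 0 < b) (hb1 : b < 1) : ∃ C : ℝ, 0 ≤ C ∧
    ∀ (N : ℕ) (r : ℤ), 0 < N → ∑ h ∈ Finset.Ioo (r * N - N) (r * N + N), kf b h ≤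
      C * (N : ℝ) ^ (1 - b) * kf b r := by
  have h1b : 0 < 1 - b := by linarith
  refine ⟨16 / (1 - b) + 6, by positivity, fun N r hN => ?_⟩
  have hNr : (0 : ℝ) < N := by exact_mod_cast hN
  have hNp : 0 < (N : ℝ) ^ (1 - b) := Real.rpow_pos_of_pos hNr _
  have hk := kf_pos b r
  by_cases hr : |r| ≤ 1
  · have hs := sum_natAbs_le (fun m => kf b m) (fun m => kf_nonneg _ _)
      (Finset.Ioo (r * N - N) (r * N + N)) 0 (2 * N) (fun h hh => by
        rw [Finset.mem_Ioo] at hh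
        rw [abs_le] at hr
        have : r * N ≤ 1 * N := by gcongr; exact hr.2
        have : (-1) * (N : ℤ) ≤ r * N := by gcongr; exact hr.1
        omega)
    simp only [kf_natAbs, zero_sub, kf_neg] at hs
    have h2 := sum_kf_range hb hb1 (2 * N)
    have h3 : ((2 * N : ℕ) : ℝ) ^ (1 - b) ≤ 2 * (N : ℝ) ^ (1 - b) := by
      push_cast
      rw [Real.mul_rpow (by norm_num) hNr.le]
      gcongr
      calc (2 : ℝ) ^ (1 - b) ≤ 2 ^ (1 : ℝ) :=
            Real.rpow_le_rpow_of_exponent_le (by norm_num) (by linarith)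
        _ = 2 := by simp
    have h4 : 1 ≤ 2 * kf b r := by
      calc (1 : ℝ) = (1 : ℝ) ^ (-b) := by simp
        _ = kf b 0 := by simp [kf]
        _ ≤ 2 * kf b r := ?_
      have h5 : kf b 1 ≤ kf b r := kf_anti hb.le (by simpa using hr)
      have h6 : (2 : ℝ) ^ (-b) = kf b 1 := by simp [kf]; norm_num
      have h7 : (2 : ℝ) ^ (-1 : ℝ) ≤ 2 ^ (-b) :=
        Real.rpow_le_rpow_of_exponent_le (by norm_num) (by linarith)
      rw [Real.rpow_neg_one] at h7
      rw [kf_zero]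
      linarith
    calc _ ≤ 2 * (1 / (1 - b) * (2 * (N : ℝ) ^ (1 - b))) := by
          refine hs.trans ?_
          gcongr
          exact h2.trans (by gcongr)
      _ = 4 / (1 - b) * (N : ℝ) ^ (1 - b) * 1 := by ring
      _ ≤ 4 / (1 - b) * (N : ℝ) ^ (1 - b) * (2 * kf b r) := by gcongr
      _ = 8 / (1 - b) * (N : ℝ) ^ (1 - b) * kf b r := by ring
      _ ≤ _ := by
          gcongr
          have : 8 / (1 - b) ≤ 16 / (1 - b) := by gcongr; norm_num
          linarith
  · push Not at hr
    have hterm : ∀ h ∈ Finset.Ioo (r * N - N) (r * N + N), kf b h ≤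
        3 * (N : ℝ) ^ (-b) * kf b r := fun h hh => by
      rw [Finset.mem_Ioo] at hh
      have hd : |h - r * N| < N := by rw [abs_lt]; constructor <;> linarith
      have habs : |r| * N ≤ |h| + N := by
        have h1 : |r * N| ≤ |h| + |h - r * N| := by
          have := abs_sub_abs_le_abs_sub (r * N) h
          rw [abs_sub_comm] at this
          linarith
        rw [abs_mul, Nat.abs_cast] at h1
        linarith
      have h2 : (2 : ℝ) ≤ |(r : ℝ)| := by exact_mod_cast hr
      have h3 : |(r : ℝ)| * N ≤ |(h : ℝ)| + N := by exact_mod_cast habs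
      -- Here |h| ≥ (|r| - 1)N, and |r| - 1 ≥ (1 + |r|)/3 because |r| ≥ 2.
      have h4 : (1 + |(r : ℝ)|) / 3 * N ≤ 1 + |(h : ℝ)| := by nlinarith
      calc kf b h ≤ ((1 + |(r : ℝ)|) / 3 * N) ^ (-b) :=
            Real.rpow_le_rpow_of_nonpos (by positivity) h4 (by linarith)
        _ = 3 ^ b * (N : ℝ) ^ (-b) * kf b r := by
            rw [Real.mul_rpow (by positivity) hNr.le, Real.div_rpow (by positivity) (by norm_num),
              Real.rpow_neg (by norm_num : (0:ℝ) ≤ 3), div_inv_eq_mul, kf]; ring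
        _ ≤ _ := by
            gcongr
            calc (3 : ℝ) ^ b ≤ 3 ^ (1 : ℝ) :=
                  Real.rpow_le_rpow_of_exponent_le (by norm_num) hb1.le
              _ = 3 := by simp
    calc _ ≤ ∑ h ∈ Finset.Ioo (r * N - N) (r * N + N), 3 * (N : ℝ) ^ (-b) * kf b r :=
          Finset.sum_le_sum hterm
      _ = ((Finset.Ioo (r * N - N) (r * N + N)).card : ℝ) * (3 * (N : ℝ) ^ (-b) * kf b r) := by
          rw [Finset.sum_const, nsmul_eq_mul]
      _ ≤ (2 * N : ℝ) * (3 * (N : ℝ) ^ (-b) * kf b r) := by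
          gcongr
          rw [Int.card_Ioo]
          have : (r * N + N - (r * N - N) - 1).toNat ≤ 2 * N := by omega
          exact_mod_cast this
      _ = 6 * (N : ℝ) ^ (1 - b) * kf b r := by
          have : (N : ℝ) ^ (1 - b) = N * (N : ℝ) ^ (-b) := by
            rw [sub_eq_add_neg, Real.rpow_add hNr, Real.rpow_one]
          rw [this]; ring
      _ ≤ _ := by
          gcongr
          have : 0 < 16 / (1 - b) := by positivity
          linarith

/-- Square sums of the kernel over finite sets are bounded. -/
lemma exists_sum_kf {p : ℝ} (hp : 1 < p) (hp2 : p ≤ 2) : ∃ C : ℝ, 0 ≤ C ∧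
    ∀ (A : Finset ℤ) (x : ℤ), ∑ h ∈ A, kf p (x - h) ≤ C := by
  have h1 : 0 < p - 1 := by linarith
  refine ⟨2 * (4 / (p - 1)), by positivity, fun A x => ?_⟩
  obtain ⟨L, hL⟩ := exists_natAbs_bound A x
  have hs := sum_natAbs_le (fun m => kf p m) (fun m => kf_nonneg _ _) A x L hL
  simp only [kf_natAbs] at hs
  refine hs.trans (mul_le_mul_of_nonneg_left ?_ zero_le_two)
  have := sum_kf_Ico hp hp2 0 L
  simpa [kf_zero] using this

/-! ### Wick pairings of two quadruples and their reduction by symmetry. -/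

/-- The block `{m, …, m + N - 1}`. -/
def blk (m : ℤ) (N : ℕ) : Finset ℤ := Finset.Ico m (m + N)

/-- Quadruples of elements of a block. -/
def box (m : ℤ) (N : ℕ) : Finset (Fin 4 → ℤ) := Fintype.piFinset fun _ => blk m N

/-- Gaussian fourth moment in terms of covariances. -/
def wick4 {α : Type*} (c : α → α → ℝ) (x₁ x₂ x₃ x₄ : α) : ℝ :=
  c x₁ x₂ * c x₃ x₄ + c x₁ x₃ * c x₂ x₄ + c x₁ x₄ * c x₂ x₃

/-- Gaussian sixth moment in terms of covariances. -/
def wick6 {α : Type*} (c : α → α → ℝ) (x₁ x₂ x₃ x₄ x₅ x₆ : α) : ℝ :=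
  c x₁ x₂ * wick4 c x₃ x₄ x₅ x₆ + c x₁ x₃ * wick4 c x₂ x₄ x₅ x₆ + c x₁ x₄ * wick4 c x₂ x₃ x₅ x₆ +
    c x₁ x₅ * wick4 c x₂ x₃ x₄ x₆ + c x₁ x₆ * wick4 c x₂ x₃ x₄ x₅

/-- Gaussian eighth moment in terms of covariances. -/
def wick8 {α : Type*} (c : α → α → ℝ) (x₁ x₂ x₃ x₄ x₅ x₆ x₇ x₈ : α) : ℝ :=
  c x₁ x₂ * wick6 c x₃ x₄ x₅ x₆ x₇ x₈ + c x₁ x₃ * wick6 c x₂ x₄ x₅ x₆ x₇ x₈ +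
    c x₁ x₄ * wick6 c x₂ x₃ x₅ x₆ x₇ x₈ + c x₁ x₅ * wick6 c x₂ x₃ x₄ x₆ x₇ x₈ +
    c x₁ x₆ * wick6 c x₂ x₃ x₄ x₅ x₇ x₈ + c x₁ x₇ * wick6 c x₂ x₃ x₄ x₅ x₆ x₈ +
    c x₁ x₈ * wick6 c x₂ x₃ x₄ x₅ x₆ x₇

/-- Covariance of two products of four jointly Gaussian variables. -/
def wickCov (c : ℤ → ℤ → ℝ) (s t : Fin 4 → ℤ) : ℝ :=
  wick8 c (s 0) (s 1) (s 2) (s 3) (t 0) (t 1) (t 2) (t 3) -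
    wick4 c (s 0) (s 1) (s 2) (s 3) * wick4 c (t 0) (t 1) (t 2) (t 3)

/-- The eight index permutations which preserve `alt` up to sign. -/
def dih : Fin 8 → Fin 4 → Fin 4 :=
  ![![0, 1, 2, 3], ![2, 1, 0, 3], ![0, 3, 2, 1], ![2, 3, 0, 1],
    ![1, 0, 3, 2], ![1, 2, 3, 0], ![3, 0, 1, 2], ![3, 2, 1, 0]]

/-- The diagrams that contribute to the limit. -/
def diagA (c : ℤ → ℤ → ℝ) (s t : Fin 4 → ℤ) : ℝ :=
  c (s 0) (t 0) * c (s 1) (t 1) * c (s 2) (t 2) * c (s 3) (t 3)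

def diagC (c : ℤ → ℤ → ℝ) (s t : Fin 4 → ℤ) : ℝ :=
  c (s 0) (s 1) * c (t 0) (t 1) * c (s 2) (t 2) * c (s 3) (t 3)

/-- The diagrams that are negligible. -/
def diagB₁ (c : ℤ → ℤ → ℝ) (s t : Fin 4 → ℤ) : ℝ :=
  c (s 0) (t 0) * c (s 1) (t 2) * c (s 2) (t 1) * c (s 3) (t 3)

def diagB₂ (c : ℤ → ℤ → ℝ) (s t : Fin 4 → ℤ) : ℝ :=
  c (s 0) (t 0) * c (s 1) (t 1) * c (s 2) (t 3) * c (s 3) (t 2)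

def diagD₁ (c : ℤ → ℤ → ℝ) (s t : Fin 4 → ℤ) : ℝ :=
  c (s 0) (s 1) * c (t 0) (t 2) * c (s 2) (t 1) * c (s 3) (t 3)

def diagD₂ (c : ℤ → ℤ → ℝ) (s t : Fin 4 → ℤ) : ℝ :=
  c (s 0) (s 2) * c (t 0) (t 1) * c (s 1) (t 2) * c (s 3) (t 3)

def diagD₃ (c : ℤ → ℤ → ℝ) (s t : Fin 4 → ℤ) : ℝ :=
  c (s 0) (s 2) * c (t 0) (t 2) * c (s 1) (t 1) * c (s 3) (t 3)

def diagErr (c : ℤ → ℤ → ℝ) (s t : Fin 4 → ℤ) : ℝ :=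
  8 * diagB₁ c s t + 8 * diagB₂ c s t + 16 * diagD₁ c s t + 16 * diagD₂ c s t + 8 * diagD₃ c s t

lemma dih_bijective (g : Fin 8) : Function.Bijective (dih g) := by
  revert g; decide

lemma sum_box_dih (m : ℤ) (N : ℕ) (g : Fin 8) (F : (Fin 4 → ℤ) → ℝ) :
    ∑ s ∈ box m N, F (s ∘ dih g) = ∑ s ∈ box m N, F s := by
  set e : Equiv.Perm (Fin 4) := Equiv.ofBijective _ (dih_bijective g) with he
  have h1 : ∀ s : Fin 4 → ℤ, s ∘ dih g = (Equiv.arrowCongr e.symm (Equiv.refl ℤ)) s := by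
    intro s; ext i; simp [he]
  refine Finset.sum_equiv (Equiv.arrowCongr e.symm (Equiv.refl ℤ)) (fun s => ?_)
    (fun s _ => by rw [h1])
  rw [← h1]
  simp only [box, Fintype.mem_piFinset, Function.comp]
  exact ⟨fun h i => h _, fun h i => by
    obtain ⟨k, rfl⟩ := (dih_bijective g).2 i
    exact h k⟩

lemma alt_dih (s : Fin 4 → ℤ) (g : Fin 8) :
    alt (s ∘ dih g) = alt s ∨ alt (s ∘ dih g) = -alt s := by
  fin_cases g <;> simp [dih, alt] <;> omega

/-- The 96 linking pairings sorted into orbits. The 24 with four links split into types A, B₁, B₂ (8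
each); the 72 with two links into C (32), D₁ (16), D₂ (16), D₃ (8). The factors 1/2 correct for
pairings of types D₁ and D₃ that are reached twice. -/
lemma sum_dih_right (c : ℤ → ℤ → ℝ) (hc : ∀ x y, c x y = c y x) (s t : Fin 4 → ℤ) :
    wickCov c s t = ∑ g, (diagA c s (t ∘ dih g) + diagB₁ c s (t ∘ dih g) +
      diagB₂ c s (t ∘ dih g) + ∑ p : Fin 4, (diagC c (s ∘ dih (Fin.castLE (by norm_num) p))
        (t ∘ dih g) + 1 / 2 * diagD₁ c (s ∘ dih (Fin.castLE (by norm_num) p)) (t ∘ dih g)) +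
      (diagD₂ c s (t ∘ dih g) + diagD₂ c (s ∘ dih 4) (t ∘ dih g) +
        1 / 2 * diagD₃ c s (t ∘ dih g) + 1 / 2 * diagD₃ c (s ∘ dih 4) (t ∘ dih g))) := by
  simp only [Fin.sum_univ_succ, Finset.univ_eq_empty, Finset.sum_empty, dih, diagA, diagB₁, diagB₂,
    diagC, diagD₁, diagD₂, diagD₃, Function.comp, wickCov, wick8, wick6, wick4]
  simp
  simp only [hc (s 2) (s 1), hc (t 1) (t 0), hc (t 2) (t 0), hc (t 3) (t 0), hc (t 2) (t 1), hc (t 3) (t 1),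
    hc (t 3) (t 2)]
  ring

/-- Weighted sum over pairs of quadruples. -/
def pairSum (χ : ℤ → ℝ) (m m' : ℤ) (N : ℕ) :
    ((Fin 4 → ℤ) → (Fin 4 → ℤ) → ℝ) →ₗ[ℝ] ℝ where
  toFun F := ∑ s ∈ box m N, ∑ t ∈ box m' N, χ (alt s) * χ (alt t) * F s t
  map_add' F G := by
    simp only [← Finset.sum_add_distrib, Pi.add_apply, mul_add]
  map_smul' r F := by
    simp only [Finset.mul_sum, Pi.smul_apply, smul_eq_mul, RingHom.id_apply]
    refine Finset.sum_congr rfl fun s _ => Finset.sum_congr rfl fun t _ => by ring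

lemma pairSum_apply (χ : ℤ → ℝ) (m m' : ℤ) (N : ℕ) (F : (Fin 4 → ℤ) → (Fin 4 → ℤ) → ℝ) :
    pairSum χ m m' N F = ∑ s ∈ box m N, ∑ t ∈ box m' N, χ (alt s) * χ (alt t) * F s t := rfl

lemma pairSum_dih (χ : ℤ → ℝ) (hχ : ∀ x, χ (-x) = χ x) (m m' : ℤ) (N : ℕ)
    (F : (Fin 4 → ℤ) → (Fin 4 → ℤ) → ℝ) (g g' : Fin 8) :
    pairSum χ m m' N (fun s t => F (s ∘ dih g) (t ∘ dih g')) = pairSum χ m m' N F := by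
  have hχ' : ∀ s g, χ (alt s) = χ (alt (s ∘ dih g)) := fun s g => by
    rcases alt_dih s g with h | h <;> simp [h, hχ]
  simp only [pairSum_apply]
  refine Eq.trans (Finset.sum_congr rfl fun s _ => ?_)
    (sum_box_dih m N g fun s => ∑ t ∈ box m' N, χ (alt s) * χ (alt t) * F s t)
  refine Eq.trans (Finset.sum_congr rfl fun t _ => ?_)
    (sum_box_dih m' N g' fun t => χ (alt (s ∘ dih g)) * χ (alt t) * F (s ∘ dih g) t)
  rw [hχ' s g, hχ' t g']

/-- The weight χ(alt s) χ(alt t) with even χ is invariant under the eight permutations, so each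
orbit collapses to its size times one representative. -/
lemma pairSum_wickCov (χ : ℤ → ℝ) (hχ : ∀ x, χ (-x) = χ x) (m m' : ℤ) (N : ℕ)
    (c : ℤ → ℤ → ℝ) (hc : ∀ x y, c x y = c y x) :
    pairSum χ m m' N (wickCov c) = 8 * pairSum χ m m' N (diagA c) +
      32 * pairSum χ m m' N (diagC c) + pairSum χ m m' N (diagErr c) := by
  have dih_zero : ∀ s : Fin 4 → ℤ, s ∘ dih 0 = s := fun s => by ext i; fin_cases i <;> rfl
  have inv1 : ∀ F g, pairSum χ m m' N (fun s t => F s (t ∘ dih g)) = pairSum χ m m' N F :=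
    fun F g => by simpa only [dih_zero] using pairSum_dih χ hχ m m' N F 0 g
  have inv2 : ∀ F g, pairSum χ m m' N (fun s => F (s ∘ dih g)) = pairSum χ m m' N F :=
    fun F g => by simpa only [dih_zero] using pairSum_dih χ hχ m m' N F g 0
  have e : wickCov c = ∑ g, ((fun s t => diagA c s (t ∘ dih g)) +
      (fun s t => diagB₁ c s (t ∘ dih g)) + (fun s t => diagB₂ c s (t ∘ dih g)) +
      ∑ p : Fin 4, ((fun s t => diagC c (s ∘ dih (Fin.castLE (by norm_num) p)) (t ∘ dih g)) +
        (1 / 2 : ℝ) • (fun s t => diagD₁ c (s ∘ dih (Fin.castLE (by norm_num) p)) (t ∘ dih g))) +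
      ((fun s t => diagD₂ c s (t ∘ dih g)) + (fun s t => diagD₂ c (s ∘ dih 4) (t ∘ dih g)) +
        (1 / 2 : ℝ) • (fun s t => diagD₃ c s (t ∘ dih g)) +
        (1 / 2 : ℝ) • (fun s t => diagD₃ c (s ∘ dih 4) (t ∘ dih g)))) := by
    ext s t
    rw [sum_dih_right c hc]
    simp only [Finset.sum_apply, Pi.add_apply, Pi.smul_apply, smul_eq_mul]
  have e' : diagErr c = (8 : ℝ) • diagB₁ c + (8 : ℝ) • diagB₂ c + (16 : ℝ) • diagD₁ c +
      (16 : ℝ) • diagD₂ c + (8 : ℝ) • diagD₃ c := by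
    ext s t; simp [diagErr]
  rw [e, e']
  simp only [map_sum, map_add, map_smul, inv1, inv2, Finset.sum_const, Finset.card_univ,
    Fintype.card_fin, smul_eq_mul, nsmul_eq_mul]
  push_cast
  ring

/-! ### Counting pairs of quadruples with prescribed lags. -/

lemma mem_blk {m x : ℤ} {N : ℕ} : x ∈ blk m N ↔ m ≤ x ∧ x < m + N := Finset.mem_Ico

lemma mem_box {m : ℤ} {N : ℕ} {s : Fin 4 → ℤ} : s ∈ box m N ↔ ∀ i, s i ∈ blk m N :=
  Fintype.mem_piFinset

lemma card_blk (m : ℤ) (N : ℕ) : (blk m N).card = N := by simp [blk]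

lemma eq_of_mem_blk {m x y : ℤ} {N : ℕ} (hx : x ∈ blk m N) (hy : y ∈ blk m N)
    (h : (N : ℤ) ∣ x - y) : x = y := by
  rw [mem_blk] at hx hy
  have := Int.eq_zero_of_abs_lt_dvd h (by rw [abs_lt]; constructor <;> linarith)
  linarith

lemma blk_index_unique {j j' x : ℤ} {N : ℕ} (hx : x ∈ blk (j * N) N) (hy : x ∈ blk (j' * N) N) :
    j = j' := by
  rw [mem_blk] at hx hy
  have hN : (0 : ℤ) < N := by linarith
  have h1 : j < j' + 1 := by
    by_contra h
    have : (j' + 1) * (N : ℤ) ≤ j * N := by gcongr; linarith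
    linarith
  have h2 : j' < j + 1 := by
    by_contra h
    have : (j + 1) * (N : ℤ) ≤ j' * N := by gcongr; linarith
    linarith
  linarith

/-- The counting device behind all diagram bounds: a sum over pairs of quadruples is at most the
(weighted) number of pairs with given lags times a sum over lag vectors. -/
lemma sum_lag_le {α : Type*} (Ω : Finset α) (lag : α → Fin 4 → ℤ) (ρ : α → ℝ) (k : ℤ → ℝ)
    (hk : ∀ h, 0 ≤ k h) (Λ : Finset (Fin 4 → ℤ)) (hmap : ∀ x ∈ Ω, lag x ∈ Λ) (B : ℝ)
    (hB : ∀ h ∈ Λ, ∑ x ∈ Ω with lag x = h, ρ x ≤ B) :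
    ∑ x ∈ Ω, ρ x * ∏ i, k (lag x i) ≤ B * ∑ h ∈ Λ, ∏ i, k (h i) := by
  rw [← Finset.sum_fiberwise_of_maps_to hmap, Finset.mul_sum]
  refine Finset.sum_le_sum fun h hh => ?_
  calc ∑ x ∈ Ω with lag x = h, ρ x * ∏ i, k (lag x i)
      = (∑ x ∈ Ω with lag x = h, ρ x) * ∏ i, k (h i) := by
        rw [Finset.sum_mul]
        exact Finset.sum_congr rfl fun x hx => by rw [(Finset.mem_filter.1 hx).2]
    _ ≤ _ := mul_le_mul_of_nonneg_right (hB h hh) (Finset.prod_nonneg fun i _ => hk _)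

/-- A congruence 2y ≡ c mod N has at most two solutions in a block: the least one y₀ and possibly y₀
+ N/2. -/
lemma card_two_mul_le (m c : ℤ) (N : ℕ) :
    ((blk m N).filter fun y => (N : ℤ) ∣ 2 * y - c).card ≤ 2 := by
  set S := (blk m N).filter fun y => (N : ℤ) ∣ 2 * y - c
  rcases S.eq_empty_or_nonempty with h | h
  · simp [h]
  · set y₀ := S.min' h
    have h0 := Finset.mem_filter.1 (S.min'_mem h)
    refine (Finset.card_le_card (t := {y₀, y₀ + (N : ℤ) / 2}) fun y hy => ?_).trans
      Finset.card_le_two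
    have h1 := Finset.mem_filter.1 hy
    have hle : y₀ ≤ y := S.min'_le y hy
    obtain ⟨k, hk⟩ := dvd_sub h1.2 h0.2
    have b1 := mem_blk.1 h1.1
    have b0 := mem_blk.1 h0.1
    have e : 2 * (y - y₀) = N * k := by rw [← hk]; ring
    have hN : (0 : ℤ) < N := by linarith
    have k0 : 0 ≤ k := by
      by_contra hc
      push Not at hc
      have : (N : ℤ) * k < 0 := mul_neg_of_pos_of_neg hN hc
      linarith
    have k1 : k < 2 := by
      by_contra hc
      push Not at hc
      have : (N : ℤ) * 2 ≤ N * k := by gcongr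
      linarith
    simp only [Finset.mem_insert, Finset.mem_singleton]
    interval_cases k <;> omega

lemma card_triples_le (m₁ m₂ m₃ : ℤ) (N : ℕ) (c : ℤ → ℤ → ℤ) :
    ((blk m₁ N ×ˢ blk m₂ N ×ˢ blk m₃ N).filter
      fun p => (N : ℤ) ∣ 2 * p.2.2 - c p.1 p.2.1).card ≤ 2 * N ^ 2 := by
  rw [Finset.card_filter, Finset.sum_product]
  calc _ ≤ ∑ _x ∈ blk m₁ N, ∑ _y ∈ blk m₂ N, 2 := by
        refine Finset.sum_le_sum fun x _ => ?_
        rw [Finset.sum_product]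
        refine Finset.sum_le_sum fun y _ => ?_
        rw [← Finset.card_filter]
        exact card_two_mul_le m₃ (c x y) N
    _ = 2 * N ^ 2 := by simp only [Finset.sum_const, card_blk, smul_eq_mul]; ring

/-- Pairs of quadruples in two blocks with alternating sums divisible by `N`. -/
def pairs (m m' : ℤ) (N : ℕ) : Finset ((Fin 4 → ℤ) × (Fin 4 → ℤ)) :=
  (box m N ×ˢ box m' N).filter fun x => (N : ℤ) ∣ alt x.1 ∧ (N : ℤ) ∣ alt x.2

/-- The reason the B and D diagrams are negligible. Given the lags, four coordinates are left. One
of the two divisibility conditions removes a coordinate (this is the injectivity of φ); a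
combination of both reads 2y ≡ c, which leaves at most two values for another. So O(N²) pairs remain
instead of O(N³). -/
lemma card_fibre_le (m m' : ℤ) (N : ℕ) (lag : (Fin 4 → ℤ) × (Fin 4 → ℤ) → Fin 4 → ℤ)
    (h : Fin 4 → ℤ) (m₁ m₂ m₃ : ℤ) (φ : (Fin 4 → ℤ) × (Fin 4 → ℤ) → ℤ × ℤ × ℤ) (c : ℤ → ℤ → ℤ)
    (hφ : ∀ x ∈ pairs m m' N, lag x = h → (φ x).1 ∈ blk m₁ N ∧ (φ x).2.1 ∈ blk m₂ N ∧
      (φ x).2.2 ∈ blk m₃ N ∧ (N : ℤ) ∣ 2 * (φ x).2.2 - c (φ x).1 (φ x).2.1)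
    (inj : ∀ x ∈ pairs m m' N, ∀ y ∈ pairs m m' N, lag x = h → lag y = h → φ x = φ y → x = y) :
    ∑ x ∈ pairs m m' N with lag x = h, (1 : ℝ) ≤ 2 * (N : ℝ) ^ 2 := by
  rw [Finset.sum_const, nsmul_eq_mul, mul_one]
  have := Finset.card_le_card_of_injOn (s := (pairs m m' N).filter fun x => lag x = h)
    (t := (blk m₁ N ×ˢ blk m₂ N ×ˢ blk m₃ N).filter
      fun p => (N : ℤ) ∣ 2 * p.2.2 - c p.1 p.2.1) φ (fun x hx => by
      have hx := Finset.mem_filter.1 hx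
      have := hφ x hx.1 hx.2
      simp only [Finset.coe_filter, Finset.mem_product, Set.mem_ofPred_eq]
      tauto) (fun x hx y hy e => by
      have hx := Finset.mem_filter.1 hx
      have hy := Finset.mem_filter.1 hy
      exact inj x hx.1 y hy.1 hx.2 hy.2 e)
  exact_mod_cast this.trans (card_triples_le m₁ m₂ m₃ N c)

lemma mem_pairs {m m' : ℤ} {N : ℕ} {x : (Fin 4 → ℤ) × (Fin 4 → ℤ)} : x ∈ pairs m m' N ↔
    (∀ i, x.1 i ∈ blk m N) ∧ (∀ i, x.2 i ∈ blk m' N) ∧ (N : ℤ) ∣ alt x.1 ∧ (N : ℤ) ∣ alt x.2 := by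
  simp [pairs, mem_box, and_assoc]

/-- The lag vectors of the diagrams. -/
def lagA (x : (Fin 4 → ℤ) × (Fin 4 → ℤ)) : Fin 4 → ℤ :=
  ![x.2 0 - x.1 0, x.2 1 - x.1 1, x.2 2 - x.1 2, x.2 3 - x.1 3]
def lagC (x : (Fin 4 → ℤ) × (Fin 4 → ℤ)) : Fin 4 → ℤ :=
  ![x.1 1 - x.1 0, x.2 1 - x.2 0, x.2 2 - x.1 2, x.2 3 - x.1 3]
def lagB₁ (x : (Fin 4 → ℤ) × (Fin 4 → ℤ)) : Fin 4 → ℤ :=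
  ![x.2 0 - x.1 0, x.2 2 - x.1 1, x.2 1 - x.1 2, x.2 3 - x.1 3]
def lagB₂ (x : (Fin 4 → ℤ) × (Fin 4 → ℤ)) : Fin 4 → ℤ :=
  ![x.2 0 - x.1 0, x.2 1 - x.1 1, x.2 3 - x.1 2, x.2 2 - x.1 3]
def lagD₁ (x : (Fin 4 → ℤ) × (Fin 4 → ℤ)) : Fin 4 → ℤ :=
  ![x.1 1 - x.1 0, x.2 2 - x.2 0, x.2 1 - x.1 2, x.2 3 - x.1 3]
def lagD₂ (x : (Fin 4 → ℤ) × (Fin 4 → ℤ)) : Fin 4 → ℤ :=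
  ![x.1 2 - x.1 0, x.2 1 - x.2 0, x.2 2 - x.1 1, x.2 3 - x.1 3]
def lagD₃ (x : (Fin 4 → ℤ) × (Fin 4 → ℤ)) : Fin 4 → ℤ :=
  ![x.1 2 - x.1 0, x.2 2 - x.2 0, x.2 1 - x.1 1, x.2 3 - x.1 3]

lemma vec4_eq {a b c d : ℤ} {h : Fin 4 → ℤ} :
    ![a, b, c, d] = h ↔ a = h 0 ∧ b = h 1 ∧ c = h 2 ∧ d = h 3 := by
  constructor
  · rintro rfl; simp
  · rintro ⟨rfl, rfl, rfl, rfl⟩; ext i; fin_cases i <;> rfl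

lemma fun4_ext {f g : Fin 4 → ℤ} (h0 : f 0 = g 0) (h1 : f 1 = g 1) (h2 : f 2 = g 2)
    (h3 : f 3 = g 3) : f = g := by
  ext i; fin_cases i <;> assumption

/-- The sum of the two alternating sums is 2(s₀ - s₃) plus lags, since the crossed coordinates s₁,
s₂ cancel. The other four diagrams use the sum or difference that likewise leaves twice a
coordinate. -/
lemma card_fibre_B₁ (m m' : ℤ) (N : ℕ) (h : Fin 4 → ℤ) :
    ∑ x ∈ pairs m m' N with lagB₁ x = h, (1 : ℝ) ≤ 2 * (N : ℝ) ^ 2 := by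
  refine card_fibre_le m m' N lagB₁ h m m m (fun x => (x.1 3, x.1 1, x.1 0))
    (fun u _ => 2 * u - (h 0 - h 2 + h 1 - h 3)) (fun x hx hl => ?_) (fun x hx y hy hl hl' e => ?_)
  · obtain ⟨a, b, c, d⟩ := mem_pairs.1 hx
    obtain ⟨e0, e1, e2, e3⟩ := vec4_eq.1 hl
    refine ⟨a _, a _, a _, ?_⟩
    exact (dvd_add c d).trans (dvd_of_eq (by simp only [alt]; linarith))
  · obtain ⟨a, b, c, d⟩ := mem_pairs.1 hx
    obtain ⟨a', b', c', d'⟩ := mem_pairs.1 hy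
    obtain ⟨e0, e1, e2, e3⟩ := vec4_eq.1 hl
    obtain ⟨f0, f1, f2, f3⟩ := vec4_eq.1 hl'
    simp only [Prod.mk.injEq] at e
    obtain ⟨g1, g2, g3⟩ := e
    have k : x.1 2 = y.1 2 := eq_of_mem_blk (a _) (a' _) (by
      exact (dvd_sub c c').trans (dvd_of_eq (by simp only [alt]; linarith)))
    exact Prod.ext (fun4_ext (by linarith) (by linarith) (by linarith) (by linarith))
      (fun4_ext (by linarith) (by linarith) (by linarith) (by linarith))

lemma card_fibre_B₂ (m m' : ℤ) (N : ℕ) (h : Fin 4 → ℤ) :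
    ∑ x ∈ pairs m m' N with lagB₂ x = h, (1 : ℝ) ≤ 2 * (N : ℝ) ^ 2 := by
  refine card_fibre_le m m' N lagB₂ h m m m (fun x => (x.1 1, x.1 2, x.1 0))
    (fun u _ => 2 * u - (h 0 - h 1 + h 3 - h 2)) (fun x hx hl => ?_) (fun x hx y hy hl hl' e => ?_)
  · obtain ⟨a, b, c, d⟩ := mem_pairs.1 hx
    obtain ⟨e0, e1, e2, e3⟩ := vec4_eq.1 hl
    refine ⟨a _, a _, a _, ?_⟩
    exact (dvd_add c d).trans (dvd_of_eq (by simp only [alt]; linarith))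
  · obtain ⟨a, b, c, d⟩ := mem_pairs.1 hx
    obtain ⟨a', b', c', d'⟩ := mem_pairs.1 hy
    obtain ⟨e0, e1, e2, e3⟩ := vec4_eq.1 hl
    obtain ⟨f0, f1, f2, f3⟩ := vec4_eq.1 hl'
    simp only [Prod.mk.injEq] at e
    obtain ⟨g1, g2, g3⟩ := e
    have k : x.1 3 = y.1 3 := eq_of_mem_blk (a _) (a' _) (by
      exact (dvd_sub c' c).trans (dvd_of_eq (by simp only [alt]; linarith)))
    exact Prod.ext (fun4_ext (by linarith) (by linarith) (by linarith) (by linarith))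
      (fun4_ext (by linarith) (by linarith) (by linarith) (by linarith))

lemma card_fibre_D₁ (m m' : ℤ) (N : ℕ) (h : Fin 4 → ℤ) :
    ∑ x ∈ pairs m m' N with lagD₁ x = h, (1 : ℝ) ≤ 2 * (N : ℝ) ^ 2 := by
  refine card_fibre_le m m' N lagD₁ h m m m' (fun x => (x.1 0, x.1 2, x.2 0))
    (fun _ v => 2 * v - h 0 - h 1 + h 2 + h 3) (fun x hx hl => ?_) (fun x hx y hy hl hl' e => ?_)
  · obtain ⟨a, b, c, d⟩ := mem_pairs.1 hx
    obtain ⟨e0, e1, e2, e3⟩ := vec4_eq.1 hl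
    refine ⟨a _, a _, b _, ?_⟩
    exact (dvd_sub d c).trans (dvd_of_eq (by simp only [alt]; linarith))
  · obtain ⟨a, b, c, d⟩ := mem_pairs.1 hx
    obtain ⟨a', b', c', d'⟩ := mem_pairs.1 hy
    obtain ⟨e0, e1, e2, e3⟩ := vec4_eq.1 hl
    obtain ⟨f0, f1, f2, f3⟩ := vec4_eq.1 hl'
    simp only [Prod.mk.injEq] at e
    obtain ⟨g1, g2, g3⟩ := e
    have k : x.1 3 = y.1 3 := eq_of_mem_blk (a _) (a' _) (by
      exact (dvd_sub c' c).trans (dvd_of_eq (by simp only [alt]; linarith)))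
    exact Prod.ext (fun4_ext (by linarith) (by linarith) (by linarith) (by linarith))
      (fun4_ext (by linarith) (by linarith) (by linarith) (by linarith))

lemma card_fibre_D₂ (m m' : ℤ) (N : ℕ) (h : Fin 4 → ℤ) :
    ∑ x ∈ pairs m m' N with lagD₂ x = h, (1 : ℝ) ≤ 2 * (N : ℝ) ^ 2 := by
  refine card_fibre_le m m' N lagD₂ h m' m m (fun x => (x.2 0, x.1 1, x.1 0))
    (fun _ v => 2 * v - h 0 - h 1 + h 2 - h 3) (fun x hx hl => ?_) (fun x hx y hy hl hl' e => ?_)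
  · obtain ⟨a, b, c, d⟩ := mem_pairs.1 hx
    obtain ⟨e0, e1, e2, e3⟩ := vec4_eq.1 hl
    refine ⟨b _, a _, a _, ?_⟩
    exact (dvd_sub c d).trans (dvd_of_eq (by simp only [alt]; linarith))
  · obtain ⟨a, b, c, d⟩ := mem_pairs.1 hx
    obtain ⟨a', b', c', d'⟩ := mem_pairs.1 hy
    obtain ⟨e0, e1, e2, e3⟩ := vec4_eq.1 hl
    obtain ⟨f0, f1, f2, f3⟩ := vec4_eq.1 hl'
    simp only [Prod.mk.injEq] at e
    obtain ⟨g1, g2, g3⟩ := e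
    have k : x.1 3 = y.1 3 := eq_of_mem_blk (a _) (a' _) (by
      exact (dvd_sub c' c).trans (dvd_of_eq (by simp only [alt]; linarith)))
    exact Prod.ext (fun4_ext (by linarith) (by linarith) (by linarith) (by linarith))
      (fun4_ext (by linarith) (by linarith) (by linarith) (by linarith))

lemma card_fibre_D₃ (m m' : ℤ) (N : ℕ) (h : Fin 4 → ℤ) :
    ∑ x ∈ pairs m m' N with lagD₃ x = h, (1 : ℝ) ≤ 2 * (N : ℝ) ^ 2 := by
  refine card_fibre_le m m' N lagD₃ h m m m' (fun x => (x.1 0, x.1 1, x.2 0))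
    (fun u _ => 2 * u + h 0 - h 1 + h 2 + h 3) (fun x hx hl => ?_) (fun x hx y hy hl hl' e => ?_)
  · obtain ⟨a, b, c, d⟩ := mem_pairs.1 hx
    obtain ⟨e0, e1, e2, e3⟩ := vec4_eq.1 hl
    refine ⟨a _, a _, b _, ?_⟩
    exact (dvd_sub d c).trans (dvd_of_eq (by simp only [alt]; linarith))
  · obtain ⟨a, b, c, d⟩ := mem_pairs.1 hx
    obtain ⟨a', b', c', d'⟩ := mem_pairs.1 hy
    obtain ⟨e0, e1, e2, e3⟩ := vec4_eq.1 hl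
    obtain ⟨f0, f1, f2, f3⟩ := vec4_eq.1 hl'
    simp only [Prod.mk.injEq] at e
    obtain ⟨g1, g2, g3⟩ := e
    have k : x.1 3 = y.1 3 := eq_of_mem_blk (a _) (a' _) (by
      exact (dvd_sub c' c).trans (dvd_of_eq (by simp only [alt]; linarith)))
    exact Prod.ext (fun4_ext (by linarith) (by linarith) (by linarith) (by linarith))
      (fun4_ext (by linarith) (by linarith) (by linarith) (by linarith))

/-! ### Bounds for the negligible diagrams and for weights without divisibility. -/

/-- The window of differences between two blocks at distance `r`. -/
def window (N : ℕ) (r : ℤ) : Finset ℤ := Finset.Ioo (r * N - N) (r * N + N)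

lemma sub_mem_window {j j' x y : ℤ} {N : ℕ} (hx : x ∈ blk (j * N) N) (hy : y ∈ blk (j' * N) N) :
    y - x ∈ window N (j' - j) := by
  rw [mem_blk] at hx hy
  rw [window, Finset.mem_Ioo, sub_mul]
  constructor <;> linarith

/-- Summing kernels over quadruples of lags confined to windows. -/
lemma exists_err_bound {b : ℝ} (hb : 0 < b) (hb1 : b < 1) : ∃ C : ℝ, 0 ≤ C ∧
    ∀ (N : ℕ) (r : ℤ) {α : Type} (Ω : Finset α) (lag : α → Fin 4 → ℤ) (B : ℝ), 0 < N →
    (∀ x ∈ Ω, (lag x 0 ∈ window N 0 ∨ lag x 0 ∈ window N r) ∧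
      (lag x 1 ∈ window N 0 ∨ lag x 1 ∈ window N r) ∧ lag x 2 ∈ window N r ∧
      lag x 3 ∈ window N r) →
    (∀ h, ∑ x ∈ Ω with lag x = h, (1 : ℝ) ≤ B) → 0 ≤ B →
    ∑ x ∈ Ω, ∏ i, kf b (lag x i) ≤ C * B * ((N : ℝ) ^ (1 - b)) ^ 4 * kf b r ^ 2 := by
  obtain ⟨C, hC, H⟩ := exists_window hb hb1
  refine ⟨(2 * C) ^ 2 * C ^ 2, by positivity, fun N r α Ω lag B hN hΩ hB hB0 => ?_⟩
  -- The first two lags may stay within a block or cross between blocks; the last two always cross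
  -- and supply the factor `kf b r ^ 2`.
  set w := window N 0 ∪ window N r with hw
  set Λ : Finset (Fin 4 → ℤ) := Fintype.piFinset ![w, w, window N r, window N r] with hΛ
  have hmap : ∀ x ∈ Ω, lag x ∈ Λ := fun x hx => by
    obtain ⟨h0, h1, h2, h3⟩ := hΩ x hx
    rw [hΛ, Fintype.mem_piFinset]
    intro i
    fin_cases i
    · simpa [hw] using h0
    · simpa [hw] using h1
    · exact h2
    · exact h3
  have key := sum_lag_le Ω lag (fun _ => 1) (kf b) (fun h => kf_nonneg _ _) Λ hmap B
    (fun h _ => hB h)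
  simp only [one_mul] at key
  refine key.trans ?_
  have e : ∑ h ∈ Λ, ∏ i, kf b (h i) = (∑ h ∈ w, kf b h) * (∑ h ∈ w, kf b h) *
      (∑ h ∈ window N r, kf b h) * (∑ h ∈ window N r, kf b h) := by
    rw [hΛ, ← Finset.prod_univ_sum, Fin.prod_univ_four]; rfl
  rw [e]
  have hr := H N r hN
  have h0 := H N 0 hN
  rw [kf_zero, mul_one] at h0
  set y := (N : ℝ) ^ (1 - b) with hy
  have hy0 : 0 ≤ y := Real.rpow_nonneg (Nat.cast_nonneg _) _
  have hk1 : kf b r ≤ 1 := kf_le_one hb.le r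
  have hk0 := kf_nonneg b r
  have hw' : ∑ h ∈ w, kf b h ≤ 2 * C * y := by
    have h1 : ∑ h ∈ w, kf b h ≤ ∑ h ∈ window N 0, kf b h + ∑ h ∈ window N r, kf b h := by
      rw [hw, ← Finset.sum_union_inter]
      have := Finset.sum_nonneg (s := window N 0 ∩ window N r) fun h _ => kf_nonneg b h
      linarith
    have h2 : C * y * kf b r ≤ C * y * 1 := by gcongr
    simp only [window] at h1 ⊢
    linarith
  have hw0 : 0 ≤ ∑ h ∈ w, kf b h := Finset.sum_nonneg fun h _ => kf_nonneg _ _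
  have hr0 : 0 ≤ ∑ h ∈ window N r, kf b h := Finset.sum_nonneg fun h _ => kf_nonneg _ _
  have hr' : ∑ h ∈ window N r, kf b h ≤ C * y * kf b r := hr
  calc _ ≤ B * ((2 * C * y) * (2 * C * y) * (C * y * kf b r) * (C * y * kf b r)) := by gcongr
    _ = _ := by ring

/-- Indicator functions which select `0` among the integers of modulus less than `N`. -/
structure IsSel (N : ℕ) (χ : ℤ → ℝ) : Prop where
  zero_one : ∀ x, χ x = 0 ∨ χ x = 1
  dvd : ∀ x, χ x ≠ 0 → (N : ℤ) ∣ x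
  neg : ∀ x, χ (-x) = χ x
  zero : χ 0 = 1

lemma IsSel.nonneg {N : ℕ} {χ : ℤ → ℝ} (h : IsSel N χ) (x : ℤ) : 0 ≤ χ x := by
  rcases h.zero_one x with h | h <;> simp [h]

lemma IsSel.le_one {N : ℕ} {χ : ℤ → ℝ} (h : IsSel N χ) (x : ℤ) : χ x ≤ 1 := by
  rcases h.zero_one x with h | h <;> simp [h]

lemma abs_pairSum_le {N : ℕ} {χ : ℤ → ℝ} (h : IsSel N χ) (m m' : ℤ)
    (F : (Fin 4 → ℤ) → (Fin 4 → ℤ) → ℝ) :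
    |pairSum χ m m' N F| ≤ ∑ x ∈ pairs m m' N, |F x.1 x.2| := by
  rw [pairSum_apply, ← Finset.sum_product', pairs, Finset.sum_filter]
  refine (Finset.abs_sum_le_sum_abs _ _).trans (Finset.sum_le_sum fun x _ => ?_)
  rw [abs_mul, abs_of_nonneg (mul_nonneg (h.nonneg _) (h.nonneg _))]
  split_ifs with hx
  · exact mul_le_of_le_one_left (abs_nonneg _) (mul_le_one₀ (h.le_one _) (h.nonneg _) (h.le_one _))
  · rw [not_and_or] at hx
    rcases hx with hx | hx
    · rw [not_not.1 (mt (h.dvd _) hx)]; simp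
    · rw [not_not.1 (mt (h.dvd _) hx)]; simp

lemma abs_mul4_le {a b c d K p q r s : ℝ} (ha : |a| ≤ K * p) (hb : |b| ≤ K * q)
    (hc : |c| ≤ K * r) (hd : |d| ≤ K * s) : |a * b * c * d| ≤ K ^ 4 * (p * q * r * s) := by
  rw [abs_mul, abs_mul, abs_mul]
  calc _ ≤ (K * p) * (K * q) * (K * r) * (K * s) := by
        have := (abs_nonneg a).trans ha
        have := (abs_nonneg b).trans hb
        have := (abs_nonneg c).trans hc
        gcongr
    _ = _ := by ring

section DiagBounds

variable {K : ℝ} {k : ℤ → ℝ} {c : ℤ → ℤ → ℝ} (hc : ∀ x y, |c x y| ≤ K * k (y - x))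
  (s t : Fin 4 → ℤ)
include hc

lemma abs_diagA_le : |diagA c s t| ≤ K ^ 4 * ∏ i, k (lagA (s, t) i) := by
  rw [Fin.prod_univ_four]; exact abs_mul4_le (hc _ _) (hc _ _) (hc _ _) (hc _ _)
lemma abs_diagC_le : |diagC c s t| ≤ K ^ 4 * ∏ i, k (lagC (s, t) i) := by
  rw [Fin.prod_univ_four]; exact abs_mul4_le (hc _ _) (hc _ _) (hc _ _) (hc _ _)
lemma abs_diagB₁_le : |diagB₁ c s t| ≤ K ^ 4 * ∏ i, k (lagB₁ (s, t) i) := by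
  rw [Fin.prod_univ_four]; exact abs_mul4_le (hc _ _) (hc _ _) (hc _ _) (hc _ _)
lemma abs_diagB₂_le : |diagB₂ c s t| ≤ K ^ 4 * ∏ i, k (lagB₂ (s, t) i) := by
  rw [Fin.prod_univ_four]; exact abs_mul4_le (hc _ _) (hc _ _) (hc _ _) (hc _ _)
lemma abs_diagD₁_le : |diagD₁ c s t| ≤ K ^ 4 * ∏ i, k (lagD₁ (s, t) i) := by
  rw [Fin.prod_univ_four]; exact abs_mul4_le (hc _ _) (hc _ _) (hc _ _) (hc _ _)
lemma abs_diagD₂_le : |diagD₂ c s t| ≤ K ^ 4 * ∏ i, k (lagD₂ (s, t) i) := by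
  rw [Fin.prod_univ_four]; exact abs_mul4_le (hc _ _) (hc _ _) (hc _ _) (hc _ _)
lemma abs_diagD₃_le : |diagD₃ c s t| ≤ K ^ 4 * ∏ i, k (lagD₃ (s, t) i) := by
  rw [Fin.prod_univ_four]; exact abs_mul4_le (hc _ _) (hc _ _) (hc _ _) (hc _ _)

end DiagBounds

lemma window_zero_of_mem {j x y : ℤ} {N : ℕ} (hx : x ∈ blk (j * N) N) (hy : y ∈ blk (j * N) N) :
    y - x ∈ window N 0 := by simpa using sub_mem_window hx hy

section Lags

variable {j j' : ℤ} {N : ℕ} {x : (Fin 4 → ℤ) × (Fin 4 → ℤ)}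
  (h1 : ∀ i, x.1 i ∈ blk (j * N) N) (h2 : ∀ i, x.2 i ∈ blk (j' * N) N)

/-- The first two lags lie in the window at `0` or `r`, the last two in the window at `r`. -/
def LagIn (N : ℕ) (r : ℤ) (l : Fin 4 → ℤ) : Prop :=
  (l 0 ∈ window N 0 ∨ l 0 ∈ window N r) ∧ (l 1 ∈ window N 0 ∨ l 1 ∈ window N r) ∧
    l 2 ∈ window N r ∧ l 3 ∈ window N r

include h1 h2

lemma lagA_in : LagIn N (j' - j) (lagA x) := ⟨.inr (sub_mem_window (h1 _) (h2 _)),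
  .inr (sub_mem_window (h1 _) (h2 _)), sub_mem_window (h1 _) (h2 _), sub_mem_window (h1 _) (h2 _)⟩
lemma lagB₁_in : LagIn N (j' - j) (lagB₁ x) := ⟨.inr (sub_mem_window (h1 _) (h2 _)),
  .inr (sub_mem_window (h1 _) (h2 _)), sub_mem_window (h1 _) (h2 _), sub_mem_window (h1 _) (h2 _)⟩
lemma lagB₂_in : LagIn N (j' - j) (lagB₂ x) := ⟨.inr (sub_mem_window (h1 _) (h2 _)),
  .inr (sub_mem_window (h1 _) (h2 _)), sub_mem_window (h1 _) (h2 _), sub_mem_window (h1 _) (h2 _)⟩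
lemma lagC_in : LagIn N (j' - j) (lagC x) := ⟨.inl (window_zero_of_mem (h1 _) (h1 _)),
  .inl (window_zero_of_mem (h2 _) (h2 _)), sub_mem_window (h1 _) (h2 _),
  sub_mem_window (h1 _) (h2 _)⟩
lemma lagD₁_in : LagIn N (j' - j) (lagD₁ x) := ⟨.inl (window_zero_of_mem (h1 _) (h1 _)),
  .inl (window_zero_of_mem (h2 _) (h2 _)), sub_mem_window (h1 _) (h2 _),
  sub_mem_window (h1 _) (h2 _)⟩
lemma lagD₂_in : LagIn N (j' - j) (lagD₂ x) := ⟨.inl (window_zero_of_mem (h1 _) (h1 _)),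
  .inl (window_zero_of_mem (h2 _) (h2 _)), sub_mem_window (h1 _) (h2 _),
  sub_mem_window (h1 _) (h2 _)⟩
lemma lagD₃_in : LagIn N (j' - j) (lagD₃ x) := ⟨.inl (window_zero_of_mem (h1 _) (h1 _)),
  .inl (window_zero_of_mem (h2 _) (h2 _)), sub_mem_window (h1 _) (h2 _),
  sub_mem_window (h1 _) (h2 _)⟩

end Lags

/-- N² times N^(4(1-b)) equals N³ times N^(-(4b-3)), so this is o(N³); the square `kf b (j' - j) ^
2` makes it summable over the second block because 2b > 1. -/
lemma exists_diagErr_bound {b : ℝ} (hb : 0 < b) (hb1 : b < 1) : ∃ C : ℝ, 0 ≤ C ∧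
    ∀ (N : ℕ) (χ : ℤ → ℝ) (j j' : ℤ) (K : ℝ) (c : ℤ → ℤ → ℝ), 0 < N → IsSel N χ →
      (∀ x y, |c x y| ≤ K * kf b (y - x)) →
      |pairSum χ (j * N) (j' * N) N (diagErr c)| ≤
        C * K ^ 4 * ((N : ℝ) ^ 2 * ((N : ℝ) ^ (1 - b)) ^ 4) * kf b (j' - j) ^ 2 := by
  obtain ⟨C, hC, H⟩ := exists_err_bound hb hb1
  -- 112 = 2 · (8 + 8 + 16 + 16 + 8): the fibre bound 2N² times the multiplicities in `diagErr`.
  refine ⟨112 * C, by positivity, fun N χ j j' K c hN hχ hc => ?_⟩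
  refine (abs_pairSum_le hχ _ _ _).trans ?_
  set P := pairs (j * N) (j' * N) N
  have hB : (0 : ℝ) ≤ 2 * (N : ℝ) ^ 2 := by positivity
  have hP : ∀ x ∈ P, (∀ i, x.1 i ∈ blk (j * N) N) ∧ (∀ i, x.2 i ∈ blk (j' * N) N) :=
    fun x hx => ⟨(mem_pairs.1 hx).1, (mem_pairs.1 hx).2.1⟩
  have q1 := H N (j' - j) P lagB₁ _ hN (fun x hx => lagB₁_in (hP x hx).1 (hP x hx).2)
    (card_fibre_B₁ _ _ N) hB
  have q2 := H N (j' - j) P lagB₂ _ hN (fun x hx => lagB₂_in (hP x hx).1 (hP x hx).2)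
    (card_fibre_B₂ _ _ N) hB
  have q3 := H N (j' - j) P lagD₁ _ hN (fun x hx => lagD₁_in (hP x hx).1 (hP x hx).2)
    (card_fibre_D₁ _ _ N) hB
  have q4 := H N (j' - j) P lagD₂ _ hN (fun x hx => lagD₂_in (hP x hx).1 (hP x hx).2)
    (card_fibre_D₂ _ _ N) hB
  have q5 := H N (j' - j) P lagD₃ _ hN (fun x hx => lagD₃_in (hP x hx).1 (hP x hx).2)
    (card_fibre_D₃ _ _ N) hB
  have hK : 0 ≤ K ^ 4 := by positivity
  calc ∑ x ∈ P, |diagErr c x.1 x.2| ≤ ∑ x ∈ P, K ^ 4 * (8 * ∏ i, kf b (lagB₁ x i) +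
        8 * ∏ i, kf b (lagB₂ x i) + 16 * ∏ i, kf b (lagD₁ x i) + 16 * ∏ i, kf b (lagD₂ x i) +
        8 * ∏ i, kf b (lagD₃ x i)) := by
        refine Finset.sum_le_sum fun x _ => ?_
        have a1 := abs_diagB₁_le hc x.1 x.2
        have a2 := abs_diagB₂_le hc x.1 x.2
        have a3 := abs_diagD₁_le hc x.1 x.2
        have a4 := abs_diagD₂_le hc x.1 x.2
        have a5 := abs_diagD₃_le hc x.1 x.2
        rw [abs_le] at a1 a2 a3 a4 a5 ⊢
        simp only [diagErr]
        constructor <;> nlinarith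
    _ = K ^ 4 * (8 * ∑ x ∈ P, ∏ i, kf b (lagB₁ x i) + 8 * ∑ x ∈ P, ∏ i, kf b (lagB₂ x i) +
        16 * ∑ x ∈ P, ∏ i, kf b (lagD₁ x i) + 16 * ∑ x ∈ P, ∏ i, kf b (lagD₂ x i) +
        8 * ∑ x ∈ P, ∏ i, kf b (lagD₃ x i)) := by
        simp only [Finset.mul_sum, Finset.sum_add_distrib, mul_add]
    _ ≤ K ^ 4 * (56 * (C * (2 * (N : ℝ) ^ 2) * ((N : ℝ) ^ (1 - b)) ^ 4 * kf b (j' - j) ^ 2)) := by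
        gcongr
        linarith
    _ = _ := by ring

/-- Without a divisibility condition fixed lags leave all four remaining coordinates free. -/
lemma card_fibre_full {m m' : ℤ} {N : ℕ} {lag : (Fin 4 → ℤ) × (Fin 4 → ℤ) → Fin 4 → ℤ}
    (h : Fin 4 → ℤ) (m₁ m₂ m₃ m₄ : ℤ) (φ : (Fin 4 → ℤ) × (Fin 4 → ℤ) → ℤ × ℤ × ℤ × ℤ)
    (hφ : ∀ x ∈ box m N ×ˢ box m' N, (φ x).1 ∈ blk m₁ N ∧ (φ x).2.1 ∈ blk m₂ N ∧
      (φ x).2.2.1 ∈ blk m₃ N ∧ (φ x).2.2.2 ∈ blk m₄ N)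
    (inj : ∀ x y, lag x = h → lag y = h → φ x = φ y → x = y) :
    ∑ x ∈ box m N ×ˢ box m' N with lag x = h, (1 : ℝ) ≤ (N : ℝ) ^ 4 := by
  rw [Finset.sum_const, nsmul_eq_mul, mul_one]
  have := Finset.card_le_card_of_injOn (s := (box m N ×ˢ box m' N).filter fun x => lag x = h)
    (t := blk m₁ N ×ˢ blk m₂ N ×ˢ blk m₃ N ×ˢ blk m₄ N) φ (fun x hx => by
      have hx := Finset.mem_filter.1 hx
      have := hφ x hx.1
      simp only [Finset.coe_product, Set.mem_prod, Finset.mem_coe]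
      tauto) (fun x hx y hy e => by
      have hx := Finset.mem_filter.1 hx
      have hy := Finset.mem_filter.1 hy
      exact inj x y hx.2 hy.2 e)
  simp only [Finset.card_product, card_blk] at this
  have e : N * (N * (N * N)) = N ^ 4 := by ring
  rw [e] at this
  exact_mod_cast this

/-- A cruder bound, with N⁴ choices in every diagram, meant for the weight `rhoW`; the extra factor
1/N in front of that term compensates for it. The constant 96 is the total number of linking
pairings. -/
lemma exists_full_bound {b : ℝ} (hb : 0 < b) (hb1 : b < 1) : ∃ C : ℝ, 0 ≤ C ∧
    ∀ (N : ℕ) (χ : ℤ → ℝ) (j j' : ℤ) (K R : ℝ) (c : ℤ → ℤ → ℝ), 0 < N →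
      (∀ x, χ (-x) = χ x) → (∀ x, |χ x| ≤ R) → (∀ x y, c x y = c y x) →
      (∀ x y, |c x y| ≤ K * kf b (y - x)) →
      |pairSum χ (j * N) (j' * N) N (wickCov c)| ≤
        C * R ^ 2 * K ^ 4 * ((N : ℝ) ^ 4 * ((N : ℝ) ^ (1 - b)) ^ 4) * kf b (j' - j) ^ 2 := by
  obtain ⟨C, hC, H⟩ := exists_err_bound hb hb1
  refine ⟨96 * C, by positivity, fun N χ j j' K R c hN hχ hR hsym hc => ?_⟩
  set P := box (j * N) N ×ˢ box (j' * N) N with hPdef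
  have hB : (0 : ℝ) ≤ (N : ℝ) ^ 4 := by positivity
  have hP : ∀ x ∈ P, (∀ i, x.1 i ∈ blk (j * N) N) ∧ (∀ i, x.2 i ∈ blk (j' * N) N) :=
    fun x hx => ⟨mem_box.1 (Finset.mem_product.1 hx).1, mem_box.1 (Finset.mem_product.1 hx).2⟩
  have q1 := H N (j' - j) P lagB₁ _ hN (fun x hx => lagB₁_in (hP x hx).1 (hP x hx).2)
    (fun h => card_fibre_full h (j * N) (j * N) (j * N) (j * N)
      (fun x => (x.1 0, x.1 1, x.1 2, x.1 3)) (fun x hx => by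
        obtain ⟨u, v⟩ := hP x hx; exact ⟨u _, u _, u _, u _⟩) fun x y hx hy e => by
        simp only [lagB₁, vec4_eq] at hx hy; simp only [Prod.mk.injEq] at e
        refine Prod.ext (fun4_ext ?_ ?_ ?_ ?_) (fun4_ext ?_ ?_ ?_ ?_) <;> omega) hB
  have q2 := H N (j' - j) P lagB₂ _ hN (fun x hx => lagB₂_in (hP x hx).1 (hP x hx).2)
    (fun h => card_fibre_full h (j * N) (j * N) (j * N) (j * N)
      (fun x => (x.1 0, x.1 1, x.1 2, x.1 3)) (fun x hx => by
        obtain ⟨u, v⟩ := hP x hx; exact ⟨u _, u _, u _, u _⟩) fun x y hx hy e => by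
        simp only [lagB₂, vec4_eq] at hx hy; simp only [Prod.mk.injEq] at e
        refine Prod.ext (fun4_ext ?_ ?_ ?_ ?_) (fun4_ext ?_ ?_ ?_ ?_) <;> omega) hB
  have q3 := H N (j' - j) P lagD₁ _ hN (fun x hx => lagD₁_in (hP x hx).1 (hP x hx).2)
    (fun h => card_fibre_full h (j * N) (j' * N) (j * N) (j * N)
      (fun x => (x.1 0, x.2 0, x.1 2, x.1 3)) (fun x hx => by
        obtain ⟨u, v⟩ := hP x hx; exact ⟨u _, v _, u _, u _⟩) fun x y hx hy e => by
        simp only [lagD₁, vec4_eq] at hx hy; simp only [Prod.mk.injEq] at e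
        refine Prod.ext (fun4_ext ?_ ?_ ?_ ?_) (fun4_ext ?_ ?_ ?_ ?_) <;> omega) hB
  have q4 := H N (j' - j) P lagD₂ _ hN (fun x hx => lagD₂_in (hP x hx).1 (hP x hx).2)
    (fun h => card_fibre_full h (j * N) (j' * N) (j * N) (j * N)
      (fun x => (x.1 0, x.2 0, x.1 1, x.1 3)) (fun x hx => by
        obtain ⟨u, v⟩ := hP x hx; exact ⟨u _, v _, u _, u _⟩) fun x y hx hy e => by
        simp only [lagD₂, vec4_eq] at hx hy; simp only [Prod.mk.injEq] at e
        refine Prod.ext (fun4_ext ?_ ?_ ?_ ?_) (fun4_ext ?_ ?_ ?_ ?_) <;> omega) hB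
  have q5 := H N (j' - j) P lagD₃ _ hN (fun x hx => lagD₃_in (hP x hx).1 (hP x hx).2)
    (fun h => card_fibre_full h (j * N) (j' * N) (j * N) (j * N)
      (fun x => (x.1 0, x.2 0, x.1 1, x.1 3)) (fun x hx => by
        obtain ⟨u, v⟩ := hP x hx; exact ⟨u _, v _, u _, u _⟩) fun x y hx hy e => by
        simp only [lagD₃, vec4_eq] at hx hy; simp only [Prod.mk.injEq] at e
        refine Prod.ext (fun4_ext ?_ ?_ ?_ ?_) (fun4_ext ?_ ?_ ?_ ?_) <;> omega) hB
  have q6 := H N (j' - j) P lagA _ hN (fun x hx => lagA_in (hP x hx).1 (hP x hx).2)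
    (fun h => card_fibre_full h (j * N) (j * N) (j * N) (j * N)
      (fun x => (x.1 0, x.1 1, x.1 2, x.1 3)) (fun x hx => by
        obtain ⟨u, v⟩ := hP x hx; exact ⟨u _, u _, u _, u _⟩) fun x y hx hy e => by
        simp only [lagA, vec4_eq] at hx hy; simp only [Prod.mk.injEq] at e
        refine Prod.ext (fun4_ext ?_ ?_ ?_ ?_) (fun4_ext ?_ ?_ ?_ ?_) <;> omega) hB
  have q7 := H N (j' - j) P lagC _ hN (fun x hx => lagC_in (hP x hx).1 (hP x hx).2)
    (fun h => card_fibre_full h (j * N) (j' * N) (j * N) (j * N)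
      (fun x => (x.1 0, x.2 0, x.1 2, x.1 3)) (fun x hx => by
        obtain ⟨u, v⟩ := hP x hx; exact ⟨u _, v _, u _, u _⟩) fun x y hx hy e => by
        simp only [lagC, vec4_eq] at hx hy; simp only [Prod.mk.injEq] at e
        refine Prod.ext (fun4_ext ?_ ?_ ?_ ?_) (fun4_ext ?_ ?_ ?_ ?_) <;> omega) hB
  have hK : 0 ≤ K ^ 4 := by positivity
  have e : pairSum χ (j * N) (j' * N) N (wickCov c) = ∑ x ∈ P, χ (alt x.1) * χ (alt x.2) *
      (8 * diagA c x.1 x.2 + 32 * diagC c x.1 x.2 + diagErr c x.1 x.2) := by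
    rw [pairSum_wickCov χ hχ _ _ _ _ hsym]
    simp only [pairSum_apply, ← Finset.sum_product', Finset.mul_sum, ← Finset.sum_add_distrib]
    exact Finset.sum_congr rfl fun x _ => by ring
  rw [e]
  calc _ ≤ ∑ x ∈ P, R ^ 2 * (K ^ 4 * (8 * ∏ i, kf b (lagA x i) + 32 * ∏ i, kf b (lagC x i) +
        8 * ∏ i, kf b (lagB₁ x i) +
        8 * ∏ i, kf b (lagB₂ x i) + 16 * ∏ i, kf b (lagD₁ x i) + 16 * ∏ i, kf b (lagD₂ x i) +
        8 * ∏ i, kf b (lagD₃ x i))) := by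
        refine (Finset.abs_sum_le_sum_abs _ _).trans (Finset.sum_le_sum fun x _ => ?_)
        rw [abs_mul]
        refine mul_le_mul ?_ ?_ (abs_nonneg _) (sq_nonneg _)
        · rw [abs_mul, sq]
          exact mul_le_mul (hR _) (hR _) (abs_nonneg _) ((abs_nonneg _).trans (hR 0))
        have a1 := abs_diagB₁_le hc x.1 x.2
        have a2 := abs_diagB₂_le hc x.1 x.2
        have a3 := abs_diagD₁_le hc x.1 x.2
        have a4 := abs_diagD₂_le hc x.1 x.2
        have a5 := abs_diagD₃_le hc x.1 x.2
        have a6 := abs_diagA_le hc x.1 x.2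
        have a7 := abs_diagC_le hc x.1 x.2
        rw [abs_le] at a1 a2 a3 a4 a5 a6 a7 ⊢
        simp only [diagErr]
        constructor <;> nlinarith
    _ = R ^ 2 * (K ^ 4 * (8 * ∑ x ∈ P, ∏ i, kf b (lagA x i) + 32 * ∑ x ∈ P, ∏ i, kf b (lagC x i) +
        8 * ∑ x ∈ P, ∏ i, kf b (lagB₁ x i) + 8 * ∑ x ∈ P, ∏ i, kf b (lagB₂ x i) +
        16 * ∑ x ∈ P, ∏ i, kf b (lagD₁ x i) + 16 * ∑ x ∈ P, ∏ i, kf b (lagD₂ x i) +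
        8 * ∑ x ∈ P, ∏ i, kf b (lagD₃ x i))) := by
        simp only [Finset.mul_sum, Finset.sum_add_distrib, mul_add]
    _ ≤ R ^ 2 * (K ^ 4 * (96 * (C * (N : ℝ) ^ 4 * ((N : ℝ) ^ (1 - b)) ^ 4 *
          kf b (j' - j) ^ 2))) := by
        gcongr
        linarith
    _ = _ := by ring

/-! ### The two leading diagrams: cross-block terms and replacement of covariances. -/

lemma abs_alt_lt {m : ℤ} {N : ℕ} {s : Fin 4 → ℤ} (hs : ∀ i, s i ∈ blk m N) :
    |alt s| < 2 * N := by
  have h0 := mem_blk.1 (hs 0); have h1 := mem_blk.1 (hs 1)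
  have h2 := mem_blk.1 (hs 2); have h3 := mem_blk.1 (hs 3)
  rw [abs_lt, alt]; constructor <;> linarith

/-- Only boundedly many multiples of N are possible values of alt h; `exists_quad` bounds each of
them uniformly. -/
lemma exists_lag_sum_bound {b : ℝ} (hb : 3 / 4 < b) (hb1 : b < 1) : ∃ C : ℝ, 0 ≤ C ∧
    ∀ (N : ℕ) (Λ : Finset (Fin 4 → ℤ)), 0 < N →
      (∀ h ∈ Λ, (N : ℤ) ∣ alt h ∧ |alt h| < 4 * N) → ∑ h ∈ Λ, ∏ i, kf b (h i) ≤ C := by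
  obtain ⟨C, hC, H⟩ := exists_quad hb hb1
  refine ⟨9 * C, by positivity, fun N Λ hN hΛ => ?_⟩
  have hN' : (0 : ℤ) < N := by exact_mod_cast hN
  rw [← Finset.sum_fiberwise_of_maps_to (t := Finset.Icc (-4 : ℤ) 4) (g := fun h => alt h / N)
    (fun h hh => by
      obtain ⟨⟨e, he⟩, h2⟩ := hΛ h hh
      rw [he, Int.mul_ediv_cancel_left _ hN'.ne', Finset.mem_Icc]
      rw [he, abs_mul, Nat.abs_cast, mul_comm] at h2
      have := lt_of_mul_lt_mul_right h2 hN'.le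
      rw [abs_lt] at this
      omega)]
  calc _ ≤ ∑ _e ∈ Finset.Icc (-4 : ℤ) 4, C := by
        refine Finset.sum_le_sum fun e _ => H _ (N * e) fun h hh => ?_
        obtain ⟨h1, h2⟩ := Finset.mem_filter.1 hh
        rw [← h2, Int.mul_ediv_cancel' (hΛ h h1).1]
    _ = 9 * C := by simp

/-- All second blocks are summed together, so the lags are not confined to windows and `exists_quad`
gives a bound without loss in N. Fixed lags leave three free coordinates. One of them is s₂, which
carries the weight ρ used later for the distance to the block ends. -/
lemma exists_main_bound {b : ℝ} (hb : 3 / 4 < b) (hb1 : b < 1) : ∃ C : ℝ, 0 ≤ C ∧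
    ∀ (N : ℕ) (j : ℤ) (J : Finset ℤ) (ρ : ℤ → ℝ), 0 < N → (∀ y, 0 ≤ ρ y) →
      ∑ j' ∈ J, ∑ x ∈ pairs (j * N) (j' * N) N, ρ (x.1 2) * ∏ i, kf b (lagA x i) ≤
        C * (N : ℝ) ^ 2 * ∑ y ∈ blk (j * N) N, ρ y ∧
      ∑ j' ∈ J, ∑ x ∈ pairs (j * N) (j' * N) N, ρ (x.1 2) * ∏ i, kf b (lagC x i) ≤
        C * (N : ℝ) ^ 2 * ∑ y ∈ blk (j * N) N, ρ y := by
  obtain ⟨C, hC, H⟩ := exists_lag_sum_bound hb hb1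
  refine ⟨C, hC, fun N j J ρ hN hρ => ?_⟩
  have hN' : (0 : ℤ) < N := by exact_mod_cast hN
  set Ω : Finset (Σ _ : ℤ, (Fin 4 → ℤ) × (Fin 4 → ℤ)) :=
    J.sigma fun j' => pairs (j * N) (j' * N) N with hΩ
  have hmem : ∀ x ∈ Ω, (∀ i, x.2.1 i ∈ blk (j * N) N) ∧ (∀ i, x.2.2 i ∈ blk (x.1 * N) N) ∧
      (N : ℤ) ∣ alt x.2.1 ∧ (N : ℤ) ∣ alt x.2.2 := fun x hx =>
    mem_pairs.1 (Finset.mem_sigma.1 hx).2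
  have gen : ∀ (lag : (Fin 4 → ℤ) × (Fin 4 → ℤ) → Fin 4 → ℤ)
      (φ : (Σ _ : ℤ, (Fin 4 → ℤ) × (Fin 4 → ℤ)) → ℤ × ℤ × ℤ) (m₁ m₂ : ℤ),
      (∀ x, alt (lag x) = alt x.2 - alt x.1) →
      (∀ x ∈ Ω, (φ x).1 ∈ blk m₁ N ∧ (φ x).2.1 ∈ blk m₂ N ∧ (φ x).2.2 = x.2.1 2) →
      (∀ x ∈ Ω, ∀ y ∈ Ω, lag x.2 = lag y.2 → φ x = φ y → x = y) →
      ∑ j' ∈ J, ∑ x ∈ pairs (j * N) (j' * N) N, ρ (x.1 2) * ∏ i, kf b (lag x i) ≤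
        C * (N : ℝ) ^ 2 * ∑ y ∈ blk (j * N) N, ρ y := by
    intro lag φ m₁ m₂ hlag hφ inj
    have e : ∑ j' ∈ J, ∑ x ∈ pairs (j * N) (j' * N) N, ρ (x.1 2) * ∏ i, kf b (lag x i) =
        ∑ x ∈ Ω, ρ (x.2.1 2) * ∏ i, kf b (lag x.2 i) := by
      rw [hΩ, Finset.sum_sigma]
    rw [e]
    have key := sum_lag_le Ω (fun x => lag x.2) (fun x => ρ (x.2.1 2)) (kf b)
      (fun h => kf_nonneg b h) (Ω.image fun x => lag x.2)
      (fun x hx => Finset.mem_image_of_mem _ hx) ((N : ℝ) ^ 2 * ∑ y ∈ blk (j * N) N, ρ y)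
      (fun h _ => by
        have e1 : ∑ x ∈ Ω with lag x.2 = h, ρ (x.2.1 2) =
            ∑ x ∈ Ω with lag x.2 = h, (fun p : ℤ × ℤ × ℤ => ρ p.2.2) (φ x) :=
          Finset.sum_congr rfl fun x hx => by
            simp only [(hφ x (Finset.mem_filter.1 hx).1).2.2]
        rw [e1, ← Finset.sum_image (f := fun p : ℤ × ℤ × ℤ => ρ p.2.2) (g := φ)]
        · calc _ ≤ ∑ p ∈ blk m₁ N ×ˢ blk m₂ N ×ˢ blk (j * N) N, ρ p.2.2 := by
                refine Finset.sum_le_sum_of_subset_of_nonneg (fun p hp => ?_) fun p _ _ => hρ _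
                obtain ⟨x, hx, rfl⟩ := Finset.mem_image.1 hp
                have hx := (Finset.mem_filter.1 hx).1
                obtain ⟨a1, a2, a3⟩ := hφ x hx
                simp only [Finset.mem_product, a1, a2, a3, (hmem x hx).1 2, and_self]
            _ = _ := by
                rw [Finset.sum_product]
                simp only [Finset.sum_product, Finset.sum_const, card_blk, nsmul_eq_mul]
                ring
        · intro x hx y hy e2
          have hx := Finset.mem_filter.1 hx
          have hy := Finset.mem_filter.1 hy
          exact inj x hx.1 y hy.1 (hx.2.trans hy.2.symm) e2)
    refine key.trans ?_
    have := H N (Ω.image fun x => lag x.2) hN (fun h hh => by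
      obtain ⟨x, hx, rfl⟩ := Finset.mem_image.1 hh
      obtain ⟨a1, a2, a3, a4⟩ := hmem x hx
      rw [hlag]
      refine ⟨dvd_sub a4 a3, ?_⟩
      have b1 := abs_alt_lt a1
      have b2 := abs_alt_lt a2
      rw [abs_lt] at b1 b2 ⊢
      constructor <;> linarith)
    have h0 : 0 ≤ (N : ℝ) ^ 2 * ∑ y ∈ blk (j * N) N, ρ y :=
      mul_nonneg (sq_nonneg _) (Finset.sum_nonneg fun y _ => hρ y)
    calc _ ≤ ((N : ℝ) ^ 2 * ∑ y ∈ blk (j * N) N, ρ y) * C := mul_le_mul_of_nonneg_left this h0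
      _ = _ := by ring
  constructor
  · refine gen lagA (fun x => (x.2.1 0, x.2.1 1, x.2.1 2)) (j * N) (j * N)
      (fun x => by simp [lagA, alt]; ring) (fun x hx => ⟨(hmem x hx).1 _, (hmem x hx).1 _, rfl⟩)
      fun x hx y hy hl e => ?_
    obtain ⟨a1, a2, a3, a4⟩ := hmem x hx
    obtain ⟨b1, b2, b3, b4⟩ := hmem y hy
    simp only [Prod.mk.injEq] at e
    obtain ⟨e0, e1, e2⟩ := e
    have hl := vec4_eq.1 hl
    simp only [lagA, Matrix.cons_val_zero, Matrix.cons_val_one, Matrix.cons_val] at hl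
    obtain ⟨l0, l1, l2, l3⟩ := hl
    have k : x.2.1 3 = y.2.1 3 := eq_of_mem_blk (a1 _) (b1 _)
      ((dvd_sub b3 a3).trans (dvd_of_eq (by simp only [alt]; linarith)))
    have e3 : x.2 = y.2 := Prod.ext
      (fun4_ext (by linarith) (by linarith) (by linarith) (by linarith))
      (fun4_ext (by linarith) (by linarith) (by linarith) (by linarith))
    have e4 : x.1 = y.1 := blk_index_unique (a2 0) (by rw [e3]; exact b2 0)
    obtain ⟨x1, x2⟩ := x
    obtain ⟨y1, y2⟩ := y
    simp only at e3 e4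
    rw [e3, e4]
  -- The block of t varies, so only the residue of t₀ mod N is recorded; t₂ = s₂ + h₂ identifies the
  -- block, and then the residue identifies t₀.
  · refine gen lagC (fun x => (x.2.1 0, x.2.2 0 % N, x.2.1 2)) (j * N) 0
      (fun x => by simp [lagC, alt]; ring) (fun x hx => ⟨(hmem x hx).1 _, ?_, rfl⟩)
      fun x hx y hy hl e => ?_
    · rw [mem_blk, zero_add]
      exact ⟨Int.emod_nonneg _ hN'.ne', Int.emod_lt_of_pos _ hN'⟩
    obtain ⟨a1, a2, a3, a4⟩ := hmem x hx
    obtain ⟨b1, b2, b3, b4⟩ := hmem y hy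
    simp only [Prod.mk.injEq] at e
    obtain ⟨e0, e1, e2⟩ := e
    have hl := vec4_eq.1 hl
    simp only [lagC, Matrix.cons_val_zero, Matrix.cons_val_one, Matrix.cons_val] at hl
    obtain ⟨l0, l1, l2, l3⟩ := hl
    have e5 : x.2.2 2 = y.2.2 2 := by linarith
    have e4 : x.1 = y.1 := blk_index_unique (a2 2) (by rw [e5]; exact b2 2)
    have e6 : x.2.2 0 = y.2.2 0 := eq_of_mem_blk (a2 0) (by rw [e4]; exact b2 0)
      (Int.ModEq.dvd (show y.2.2 0 ≡ x.2.2 0 [ZMOD N] from e1.symm))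
    have k : x.2.1 3 = y.2.1 3 := eq_of_mem_blk (a1 _) (b1 _)
      ((dvd_sub b3 a3).trans (dvd_of_eq (by simp only [alt]; linarith)))
    have e3 : x.2 = y.2 := Prod.ext
      (fun4_ext (by linarith) (by linarith) (by linarith) (by linarith))
      (fun4_ext (by linarith) (by linarith) (by linarith) (by linarith))
    obtain ⟨x1, x2⟩ := x
    obtain ⟨y1, y2⟩ := y
    simp only at e3 e4
    rw [e3, e4]

lemma sum_kf_blk_le {δ : ℝ} (hδ : 0 < δ) (hδ1 : δ < 1) (m : ℤ) (N : ℕ) :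
    ∑ y ∈ blk m N, (kf δ (y - m) + kf δ (m + N - 1 - y)) ≤
      2 / (1 - δ) * (N : ℝ) ^ (1 - δ) := by
  have h := sum_kf_range hδ hδ1 N
  have e1 : ∑ y ∈ blk m N, kf δ (y - m) = ∑ n ∈ Finset.range N, kf δ n := by
    refine Finset.sum_nbij' (fun y => (y - m).toNat) (fun n => m + n) ?_ ?_ ?_ ?_ ?_
    · intro y hy; rw [mem_blk] at hy; rw [Finset.mem_range]; omega
    · intro n hn; rw [Finset.mem_range] at hn; rw [mem_blk]; omega
    · intro y hy; rw [mem_blk] at hy; omega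
    · intro n hn; omega
    · intro y hy; rw [mem_blk] at hy; rw [Int.toNat_of_nonneg (by omega)]
  have e2 : ∑ y ∈ blk m N, kf δ (m + N - 1 - y) = ∑ n ∈ Finset.range N, kf δ n := by
    refine Finset.sum_nbij' (fun y => (m + N - 1 - y).toNat) (fun n => m + N - 1 - n) ?_ ?_ ?_ ?_ ?_
    · intro y hy; rw [mem_blk] at hy; rw [Finset.mem_range]; omega
    · intro n hn; rw [Finset.mem_range] at hn; rw [mem_blk]; omega
    · intro y hy; rw [mem_blk] at hy; omega
    · intro n hn; rw [Finset.mem_range] at hn; omega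
    · intro y hy; rw [mem_blk] at hy; rw [Int.toNat_of_nonneg (by omega)]
  rw [Finset.sum_add_distrib, e1, e2]
  calc _ ≤ 1 / (1 - δ) * (N : ℝ) ^ (1 - δ) + 1 / (1 - δ) * (N : ℝ) ^ (1 - δ) := add_le_add h h
    _ = _ := by ring

/-- A point y of another block lies beyond one end of the block of x, so |y - x| exceeds the
distance from x to that end. -/
lemma kf_cross_le {δ : ℝ} (hδ : 0 < δ) {j j' x y : ℤ} {N : ℕ} (hx : x ∈ blk (j * N) N)
    (hy : y ∈ blk (j' * N) N) (hj : j' ≠ j) :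
    kf δ (y - x) ≤ kf δ (x - j * N) + kf δ (j * N + N - 1 - x) := by
  rw [mem_blk] at hx hy
  rcases lt_or_gt_of_ne hj with h | h
  · have : (j' + 1) * (N : ℤ) ≤ j * N := by gcongr; linarith
    have h1 : kf δ (y - x) ≤ kf δ (x - j * N) := kf_anti hδ.le (by
      rw [abs_of_nonneg (by linarith), abs_of_nonpos (by linarith)]; linarith)
    linarith [kf_nonneg δ (j * N + N - 1 - x)]
  · have : (j + 1) * (N : ℤ) ≤ j' * N := by gcongr; linarith
    have h1 : kf δ (y - x) ≤ kf δ (j * N + N - 1 - x) := kf_anti hδ.le (by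
      rw [abs_of_nonneg (by linarith), abs_of_nonneg (by linarith)]; linarith)
    linarith [kf_nonneg δ (x - j * N)]

/-- The spare exponent δ is kept at lag 2 only, a lag that joins s to t in both leading diagrams. -/
lemma prod_kf_le {b δ : ℝ} (hδ : 0 < δ) (l : Fin 4 → ℤ) :
    ∏ i, kf (b + δ) (l i) ≤ kf δ (l 2) * ∏ i, kf b (l i) := by
  rw [Fin.prod_univ_four, Fin.prod_univ_four, ← kf_mul b δ (l 2)]
  have h := fun i => kf_exp_anti (by linarith : b ≤ b + δ) (l i)
  have h0 := fun i => kf_nonneg (b + δ) (l i)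
  have h1 := fun i => kf_nonneg b (l i)
  have h2 := kf_nonneg δ (l 2)
  calc _ ≤ kf b (l 0) * kf b (l 1) * (kf b (l 2) * kf δ (l 2)) * kf b (l 3) := by
        have := h 0; have := h 1; have := h 3
        have := h0 0; have := h0 1; have := h0 3
        have := h1 0; have := h1 1; have := h1 2
        gcongr
    _ = _ := by ring

/-- For different blocks the factor `kf δ` at lag 2 is at most a weight concentrated near the ends
of the block of s₂. Its sum over the block is O(N^(1-δ)) instead of N, so all other blocks together
contribute o(N³). -/
lemma exists_cross_bound {b δ : ℝ} (hb : 3 / 4 < b) (hδ : 0 < δ) (hbδ : b + δ < 1) :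
    ∃ C : ℝ, 0 ≤ C ∧ ∀ (N : ℕ) (χ : ℤ → ℝ) (j : ℤ) (J : Finset ℤ) (K : ℝ) (c : ℤ → ℤ → ℝ),
      0 < N → IsSel N χ → (∀ x y, |c x y| ≤ K * kf (b + δ) (y - x)) → j ∉ J →
      ∑ j' ∈ J, |pairSum χ (j * N) (j' * N) N (diagA c)| ≤
        C * K ^ 4 * ((N : ℝ) ^ 2 * (N : ℝ) ^ (1 - δ)) ∧
      ∑ j' ∈ J, |pairSum χ (j * N) (j' * N) N (diagC c)| ≤
        C * K ^ 4 * ((N : ℝ) ^ 2 * (N : ℝ) ^ (1 - δ)) := by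
  obtain ⟨C, hC, H⟩ := exists_main_bound hb (by linarith : b < 1)
  have h1δ : 0 < 1 - δ := by linarith
  refine ⟨C * (2 / (1 - δ)), by positivity, fun N χ j J K c hN hχ hc hj => ?_⟩
  set ρ : ℤ → ℝ := fun x => kf δ (x - j * N) + kf δ (j * N + N - 1 - x) with hρ
  obtain ⟨HA, HC⟩ := H N j J ρ hN (fun y => add_nonneg (kf_nonneg _ _) (kf_nonneg _ _))
  have hK : 0 ≤ K ^ 4 := by positivity
  have hsum : C * (N : ℝ) ^ 2 * ∑ y ∈ blk (j * N) N, ρ y ≤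
      C * (N : ℝ) ^ 2 * (2 / (1 - δ) * (N : ℝ) ^ (1 - δ)) := by
    gcongr
    exact sum_kf_blk_le hδ (by linarith) _ _
  have gen : ∀ (lag : (Fin 4 → ℤ) × (Fin 4 → ℤ) → Fin 4 → ℤ) (F : (Fin 4 → ℤ) → (Fin 4 → ℤ) → ℝ),
      (∀ x, lag x 2 = x.2 2 - x.1 2) →
      (∀ s t, |F s t| ≤ K ^ 4 * ∏ i, kf (b + δ) (lag (s, t) i)) →
      (∑ j' ∈ J, ∑ x ∈ pairs (j * N) (j' * N) N, ρ (x.1 2) * ∏ i, kf b (lag x i) ≤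
        C * (N : ℝ) ^ 2 * ∑ y ∈ blk (j * N) N, ρ y) →
      ∑ j' ∈ J, |pairSum χ (j * N) (j' * N) N F| ≤
        C * (2 / (1 - δ)) * K ^ 4 * ((N : ℝ) ^ 2 * (N : ℝ) ^ (1 - δ)) := by
    intro lag F hlag hF HH
    calc _ ≤ ∑ j' ∈ J, ∑ x ∈ pairs (j * N) (j' * N) N, K ^ 4 * (ρ (x.1 2) *
          ∏ i, kf b (lag x i)) := by
          refine Finset.sum_le_sum fun j' hj' => (abs_pairSum_le hχ _ _ _).trans
            (Finset.sum_le_sum fun x hx => (hF _ _).trans ?_)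
          obtain ⟨a1, a2, -, -⟩ := mem_pairs.1 hx
          refine mul_le_mul_of_nonneg_left ((prod_kf_le hδ _).trans ?_) hK
          refine mul_le_mul_of_nonneg_right ?_ (Finset.prod_nonneg fun i _ => kf_nonneg _ _)
          rw [hlag]
          exact kf_cross_le hδ (a1 _) (a2 _) (by rintro rfl; exact hj hj')
      _ = K ^ 4 * ∑ j' ∈ J, ∑ x ∈ pairs (j * N) (j' * N) N, (ρ (x.1 2) *
          ∏ i, kf b (lag x i)) := by simp only [Finset.mul_sum]
      _ ≤ K ^ 4 * (C * (N : ℝ) ^ 2 * (2 / (1 - δ) * (N : ℝ) ^ (1 - δ))) :=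
          mul_le_mul_of_nonneg_left (HH.trans hsum) hK
      _ = _ := by ring
  exact ⟨gen lagA _ (fun x => rfl) (abs_diagA_le hc) HA,
    gen lagC _ (fun x => rfl) (abs_diagC_le hc) HC⟩

lemma abs_mul4_sub_le {a b c d a' b' c' d' K η p q r s : ℝ} (ha : |a| ≤ K * p) (hb : |b| ≤ K * q)
    (hc : |c| ≤ K * r) (hb' : |b'| ≤ K * q) (hc' : |c'| ≤ K * r)
    (hd' : |d'| ≤ K * s) (ea : |a - a'| ≤ η * (K * p)) (eb : |b - b'| ≤ η * (K * q))
    (ec : |c - c'| ≤ η * (K * r)) (ed : |d - d'| ≤ η * (K * s)) :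
    |a * b * c * d - a' * b' * c' * d'| ≤ 4 * η * (K ^ 4 * (p * q * r * s)) := by
  have e : a * b * c * d - a' * b' * c' * d' = a * b * c * (d - d') + a * b * (c - c') * d' +
      a * (b - b') * c' * d' + (a - a') * b' * c' * d' := by ring
  have hp := (abs_nonneg a).trans ha
  have hq := (abs_nonneg b).trans hb
  have hr := (abs_nonneg c).trans hc
  have hs := (abs_nonneg d').trans hd'
  have hη := (abs_nonneg _).trans eb
  have hη' := (abs_nonneg _).trans ea
  have hη'' := (abs_nonneg _).trans ec
  have h1 : |a * b * c * (d - d')| ≤ (K * p) * (K * q) * (K * r) * (η * (K * s)) := by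
    rw [abs_mul, abs_mul, abs_mul]; gcongr
  have h2 : |a * b * (c - c') * d'| ≤ (K * p) * (K * q) * (η * (K * r)) * (K * s) := by
    rw [abs_mul, abs_mul, abs_mul]; gcongr
  have h3 : |a * (b - b') * c' * d'| ≤ (K * p) * (η * (K * q)) * (K * r) * (K * s) := by
    rw [abs_mul, abs_mul, abs_mul]; gcongr
  have h4 : |(a - a') * b' * c' * d'| ≤ (η * (K * p)) * (K * q) * (K * r) * (K * s) := by
    rw [abs_mul, abs_mul, abs_mul]; gcongr
  rw [e]
  calc _ ≤ _ := abs_add_le _ _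
    _ ≤ _ := add_le_add (abs_add_three _ _ _) h4
    _ ≤ _ := add_le_add (add_le_add (add_le_add h1 h2) h3) le_rfl
    _ = _ := by ring

/-- Used to pass from the true covariances to truncated stationary ones: the product of four factors
is telescoped, and a relative error η costs only ηN³ by `exists_main_bound`. -/
lemma exists_replace_bound {b : ℝ} (hb : 3 / 4 < b) (hb1 : b < 1) :
    ∃ C : ℝ, 0 ≤ C ∧ ∀ (N : ℕ) (χ : ℤ → ℝ) (j : ℤ) (K η : ℝ) (c c' : ℤ → ℤ → ℝ),
      0 < N → IsSel N χ → 0 ≤ η → (∀ x y, |c x y| ≤ K * kf b (y - x)) →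
      (∀ x y, |c' x y| ≤ K * kf b (y - x)) →
      (∀ x ∈ blk (j * N) N, ∀ y ∈ blk (j * N) N, |c x y - c' x y| ≤ η * (K * kf b (y - x))) →
      |pairSum χ (j * N) (j * N) N (diagA c) - pairSum χ (j * N) (j * N) N (diagA c')| ≤
        C * K ^ 4 * η * (N : ℝ) ^ 3 ∧
      |pairSum χ (j * N) (j * N) N (diagC c) - pairSum χ (j * N) (j * N) N (diagC c')| ≤
        C * K ^ 4 * η * (N : ℝ) ^ 3 := by
  obtain ⟨C, hC, H⟩ := exists_main_bound hb hb1
  refine ⟨4 * C, by positivity, fun N χ j K η c c' hN hχ hη hc hc' hcc => ?_⟩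
  obtain ⟨HA, HC⟩ := H N j {j} (fun _ => 1) hN (fun y => zero_le_one)
  have hK : 0 ≤ 4 * η * K ^ 4 := by positivity
  have gen : ∀ (lag : (Fin 4 → ℤ) × (Fin 4 → ℤ) → Fin 4 → ℤ)
      (F F' : (Fin 4 → ℤ) → (Fin 4 → ℤ) → ℝ),
      (∀ x ∈ pairs (j * N) (j * N) N, |F x.1 x.2 - F' x.1 x.2| ≤
        4 * η * (K ^ 4 * ∏ i, kf b (lag x i))) →
      (∑ j' ∈ {j}, ∑ x ∈ pairs (j * N) (j' * N) N, (1 : ℝ) * ∏ i, kf b (lag x i) ≤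
        C * (N : ℝ) ^ 2 * ∑ y ∈ blk (j * N) N, (1 : ℝ)) →
      |pairSum χ (j * N) (j * N) N F - pairSum χ (j * N) (j * N) N F'| ≤
        4 * C * K ^ 4 * η * (N : ℝ) ^ 3 := by
    intro lag F F' hF HH
    rw [← map_sub]
    simp only [Finset.sum_singleton, one_mul, Finset.sum_const, card_blk, nsmul_eq_mul,
      mul_one] at HH
    calc _ ≤ ∑ x ∈ pairs (j * N) (j * N) N, 4 * η * (K ^ 4 * ∏ i, kf b (lag x i)) :=
          (abs_pairSum_le hχ _ _ _).trans (Finset.sum_le_sum fun x hx => hF x hx)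
      _ = 4 * η * K ^ 4 * ∑ x ∈ pairs (j * N) (j * N) N, ∏ i, kf b (lag x i) := by
          rw [Finset.mul_sum]; exact Finset.sum_congr rfl fun x _ => by ring
      _ ≤ 4 * η * K ^ 4 * (C * (N : ℝ) ^ 2 * N) := mul_le_mul_of_nonneg_left HH hK
      _ = _ := by ring
  constructor
  · refine gen lagA _ _ (fun x hx => ?_) HA
    obtain ⟨a1, a2, -, -⟩ := mem_pairs.1 hx
    rw [Fin.prod_univ_four]
    exact abs_mul4_sub_le (hc _ _) (hc _ _) (hc _ _) (hc' _ _) (hc' _ _) (hc' _ _)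
      (hcc _ (a1 _) _ (a2 _)) (hcc _ (a1 _) _ (a2 _)) (hcc _ (a1 _) _ (a2 _))
      (hcc _ (a1 _) _ (a2 _))
  · refine gen lagC _ _ (fun x hx => ?_) HC
    obtain ⟨a1, a2, -, -⟩ := mem_pairs.1 hx
    rw [Fin.prod_univ_four]
    exact abs_mul4_sub_le (hc _ _) (hc _ _) (hc _ _) (hc' _ _) (hc' _ _) (hc' _ _)
      (hcc _ (a1 _) _ (a1 _)) (hcc _ (a2 _) _ (a2 _)) (hcc _ (a1 _) _ (a2 _))
      (hcc _ (a1 _) _ (a2 _))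

/-! ### Evaluation of the leading diagrams with truncated lags. -/

/-- Quadruples of lags of modulus at most `H`. -/
def lagBox (H : ℕ) : Finset (Fin 4 → ℤ) := Fintype.piFinset fun _ => Finset.Icc (-(H : ℤ)) H

lemma mem_lagBox {H : ℕ} {h : Fin 4 → ℤ} : h ∈ lagBox H ↔ ∀ i, |h i| ≤ H := by
  simp [lagBox, abs_le]

/-- The truncated version of `∑_{h₀ - h₁ + h₂ - h₃ = 0} g(h₀) g(h₁) g(h₂) g(h₃)`. -/
def quadSum (g : ℤ → ℝ) (H : ℕ) : ℝ := ∑ h ∈ lagBox H with alt h = 0, ∏ i, g (h i)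

/-- Truncation of `g` at lag `H`. -/
def trunc (g : ℤ → ℝ) (H : ℕ) (h : ℤ) : ℝ := if |h| ≤ H then g h else 0

lemma card_lagBox (H : ℕ) : (lagBox H).card = (2 * H + 1) ^ 4 := by
  simp only [lagBox, Fintype.card_piFinset, Int.card_Icc, Finset.prod_const, Finset.card_univ,
    Fintype.card_fin]
  congr 1; omega

lemma sum_lagBox_le {g : ℤ → ℝ} {K : ℝ} (hg : ∀ h, |g h| ≤ K) (H : ℕ) (w : (Fin 4 → ℤ) → ℝ)
    (hw : ∀ h, |w h| ≤ 1) :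
    |∑ h ∈ lagBox H, w h * ∏ i, g (h i)| ≤ (2 * H + 1) ^ 4 * K ^ 4 := by
  calc _ ≤ ∑ _h ∈ lagBox H, K ^ 4 := by
        refine (Finset.abs_sum_le_sum_abs _ _).trans (Finset.sum_le_sum fun h _ => ?_)
        rw [abs_mul, Finset.abs_prod, Fin.prod_univ_four]
        have h0 := (abs_nonneg _).trans (hg 0)
        calc _ ≤ 1 * (K * K * K * K) := by gcongr <;> first | exact hw _ | exact hg _
          _ = _ := by ring
    _ = _ := by rw [Finset.sum_const, card_lagBox, nsmul_eq_mul]; push_cast; ring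

lemma quadSum_eq (g : ℤ → ℝ) (H : ℕ) :
    quadSum g H = ∑ h ∈ lagBox H, (if alt h = 0 then 1 else 0) * ∏ i, g (h i) := by
  rw [quadSum, Finset.sum_filter]
  exact Finset.sum_congr rfl fun h _ => by split_ifs <;> simp

/-- Next to a selected point every selector acts as the indicator of 0, even though it may select
several multiples of N. -/
lemma IsSel.add_eq {N : ℕ} {χ : ℤ → ℝ} (h : IsSel N χ) {x y : ℤ} (hx : χ x = 1) (hy : |y| < N) :
    χ (x + y) = if y = 0 then 1 else 0 := by
  split_ifs with h0
  · rw [h0, add_zero, hx]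
  · by_contra hne
    have h1 := h.dvd _ hne
    have h2 := h.dvd x (by rw [hx]; norm_num)
    exact h0 (Int.eq_zero_of_abs_lt_dvd ((Int.dvd_add_right h2).1 h1) hy)

lemma abs_alt_le {H : ℕ} {h : Fin 4 → ℤ} (hh : h ∈ lagBox H) : |alt h| ≤ 4 * H := by
  rw [mem_lagBox] at hh
  have h0 := abs_le.1 (hh 0); have h1 := abs_le.1 (hh 1)
  have h2 := abs_le.1 (hh 2); have h3 := abs_le.1 (hh 3)
  rw [abs_le, alt]; constructor <;> linarith

lemma alt_add (s h : Fin 4 → ℤ) : alt (s + h) = alt s + alt h := by simp [alt]; ring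

/-- Points of the block within distance `H` of its boundary. -/
def edge (m : ℤ) (N H : ℕ) : Finset ℤ := (blk m N).filter fun x => x < m + H ∨ m + N - H ≤ x

lemma card_edge_le (m : ℤ) (N H : ℕ) : (edge m N H).card ≤ 2 * H := by
  have : edge m N H ⊆ Finset.Ico m (m + H) ∪ Finset.Ico (m + N - H) (m + N) := by
    intro x hx
    rw [edge, Finset.mem_filter, mem_blk] at hx
    rw [Finset.mem_union, Finset.mem_Ico, Finset.mem_Ico]
    omega
  refine (Finset.card_le_card this).trans ((Finset.card_union_le _ _).trans ?_)
  simp only [Int.card_Ico]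
  omega

lemma add_mem_blk_of_notMem_edge {m x h : ℤ} {N H : ℕ} (hx : x ∈ blk m N) (he : x ∉ edge m N H)
    (hh : |h| ≤ H) : x + h ∈ blk m N := by
  rw [edge, Finset.mem_filter, not_and, not_or] at he
  have := he hx
  rw [abs_le] at hh
  rw [mem_blk]
  omega

lemma sum_blk_sel_le {N : ℕ} {χ : ℤ → ℝ} (hχ : IsSel N χ) (m a : ℤ) :
    ∑ x ∈ blk m N, χ (a - x) ≤ 1 := by
  by_cases h : ∃ x ∈ blk m N, χ (a - x) ≠ 0
  · obtain ⟨x, hx, hx0⟩ := h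
    rw [Finset.sum_eq_single_of_mem x hx]
    · exact hχ.le_one _
    · intro y hy hne
      by_contra hy0
      refine hne (eq_of_mem_blk hy hx ?_)
      exact (dvd_sub (hχ.dvd _ hx0) (hχ.dvd _ hy0)).trans (dvd_of_eq (by ring))
  · push Not at h
    rw [Finset.sum_eq_zero h]; exact zero_le_one

/-- One coordinate has 2H values, two have N each, and the last is determined mod N by the selector.
-/
lemma sum_sel_edge_le {N : ℕ} {χ : ℤ → ℝ} (hχ : IsSel N χ) (m : ℤ) (H : ℕ) (i : Fin 4) :
    ∑ s ∈ box m N with s i ∈ edge m N H, χ (alt s) ≤ 2 * H * (N : ℝ) ^ 2 := by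
  set S := ((box m N).filter fun s => s i ∈ edge m N H).filter fun s => (N : ℤ) ∣ alt s with hS
  have h1 : ∑ s ∈ box m N with s i ∈ edge m N H, χ (alt s) ≤ (S.card : ℝ) := by
    rw [hS, Finset.card_filter, Nat.cast_sum]
    refine Finset.sum_le_sum fun s _ => ?_
    split_ifs with h
    · simpa using hχ.le_one _
    · rw [not_not.1 (mt (hχ.dvd _) h)]; simp
  refine h1.trans ?_
  have h2 := Finset.card_le_card_of_injOn (s := S) (t := edge m N H ×ˢ blk m N ×ˢ blk m N)
    (fun s => (s i, s (i + 1), s (i + 2))) (fun s hs => by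
      have h := Finset.mem_filter.1 (Finset.mem_filter.1 hs).1
      have hb := mem_box.1 h.1
      simp only [Finset.coe_product, Set.mem_prod, Finset.mem_coe]
      exact ⟨h.2, hb _, hb _⟩) (fun s hs t ht e => by
      have h := Finset.mem_filter.1 hs
      have h' := Finset.mem_filter.1 ht
      have b := mem_box.1 (Finset.mem_filter.1 h.1).1
      have b' := mem_box.1 (Finset.mem_filter.1 h'.1).1
      have d := dvd_sub h.2 h'.2
      have d' := dvd_sub h'.2 h.2
      simp only [Prod.mk.injEq] at e
      obtain ⟨e1, e2, e3⟩ := e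
      simp only [alt] at d d'
      fin_cases i
      · simp only [Fin.zero_eta, Fin.isValue, zero_add] at e1 e2 e3
        refine fun4_ext e1 e2 e3 (eq_of_mem_blk (b _) (b' _) (d'.trans (dvd_of_eq ?_)))
        linarith
      · simp only [Fin.mk_one, Fin.isValue, Fin.reduceAdd] at e1 e2 e3
        refine fun4_ext (eq_of_mem_blk (b _) (b' _) (d.trans (dvd_of_eq ?_))) e1 e2 e3
        linarith
      · simp only [Fin.reduceFinMk, Fin.isValue, Fin.reduceAdd] at e1 e2 e3
        refine fun4_ext e3 (eq_of_mem_blk (b _) (b' _) (d'.trans (dvd_of_eq ?_))) e1 e2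
        linarith
      · simp only [Fin.reduceFinMk, Fin.isValue, Fin.reduceAdd] at e1 e2 e3
        refine fun4_ext e2 e3 (eq_of_mem_blk (b _) (b' _) (d.trans (dvd_of_eq ?_))) e1
        linarith)
  simp only [Finset.card_product, card_blk] at h2
  calc (S.card : ℝ) ≤ (((edge m N H).card * (N * N) : ℕ) : ℝ) := by exact_mod_cast h2
    _ ≤ ((2 * H * (N * N) : ℕ) : ℝ) := by
        exact_mod_cast Nat.mul_le_mul_right _ (card_edge_le m N H)
    _ = _ := by push_cast; ring

lemma prod_trunc_eq_zero {g : ℤ → ℝ} {H : ℕ} {l : Fin 4 → ℤ} (hl : l ∉ lagBox H) :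
    ∏ i, trunc g H (l i) = 0 := by
  rw [mem_lagBox, not_forall] at hl
  obtain ⟨i, hi⟩ := hl
  exact Finset.prod_eq_zero (Finset.mem_univ i) (if_neg hi)

lemma prod_trunc_eq {g : ℤ → ℝ} {H : ℕ} {l : Fin 4 → ℤ} (hl : l ∈ lagBox H) :
    ∏ i, trunc g H (l i) = ∏ i, g (l i) :=
  Finset.prod_congr rfl fun i _ => if_pos (mem_lagBox.1 hl i)

lemma inner_diagA (χ : ℤ → ℝ) (m : ℤ) (N H : ℕ) (g : ℤ → ℝ) (s : Fin 4 → ℤ) :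
    ∑ t ∈ box m N, χ (alt t) * ∏ i, trunc g H ((t - s) i) =
      ∑ h ∈ lagBox H, (if s + h ∈ box m N then χ (alt (s + h)) else 0) * ∏ i, g (h i) := by
  have e1 : ∑ t ∈ box m N, χ (alt t) * ∏ i, trunc g H ((t - s) i) =
      ∑ t ∈ box m N with t - s ∈ lagBox H, χ (alt t) * ∏ i, g ((t - s) i) := by
    rw [Finset.sum_filter]
    refine Finset.sum_congr rfl fun t _ => ?_
    split_ifs with h
    · rw [prod_trunc_eq h]
    · rw [prod_trunc_eq_zero h, mul_zero]
  have e2 : ∑ h ∈ lagBox H, (if s + h ∈ box m N then χ (alt (s + h)) else 0) * ∏ i, g (h i) =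
      ∑ h ∈ lagBox H with s + h ∈ box m N, χ (alt (s + h)) * ∏ i, g (h i) := by
    rw [Finset.sum_filter]
    exact Finset.sum_congr rfl fun h _ => by split_ifs <;> simp
  rw [e1, e2]
  refine Finset.sum_nbij' (fun t => t - s) (fun h => s + h) ?_ ?_ ?_ ?_ ?_ <;>
    simp +contextual

/-- Put t = s + h. Away from the ends of the block every such t is admissible, and χ(alt s) χ(alt s
+ alt h) is χ(alt s) if alt h = 0 and 0 otherwise. So the sum factors into the number of selected s
and `quadSum`; only quadruples with a coordinate near an end cause an error. -/
lemma abs_pairSum_diagA_trunc_sub_le {N : ℕ} {χ : ℤ → ℝ} (hχ : IsSel N χ) (m : ℤ) (H : ℕ)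
    (hH : 4 * H < N) (g : ℤ → ℝ) {K : ℝ} (hg : ∀ h, |g h| ≤ K) :
    |pairSum χ m m N (diagA fun x y => trunc g H (y - x)) -
      (∑ s ∈ box m N, χ (alt s)) * quadSum g H| ≤
      2 * ((2 * H + 1) ^ 4 * K ^ 4) * (4 * (2 * H * (N : ℝ) ^ 2)) := by
  set Q := quadSum g H with hQ
  set B := (2 * (H : ℝ) + 1) ^ 4 * K ^ 4 with hB
  have hB0 : 0 ≤ B := by positivity
  set I : (Fin 4 → ℤ) → ℝ := fun s => ∑ t ∈ box m N, χ (alt t) * ∏ i, trunc g H ((t - s) i) with hI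
  have e : pairSum χ m m N (diagA fun x y => trunc g H (y - x)) = ∑ s ∈ box m N, χ (alt s) * I s := by
    rw [pairSum_apply]
    refine Finset.sum_congr rfl fun s _ => ?_
    rw [hI, Finset.mul_sum]
    refine Finset.sum_congr rfl fun t _ => ?_
    rw [Fin.prod_univ_four, diagA]; simp only [Pi.sub_apply]; ring
  have hIB : ∀ s, |I s| ≤ B := fun s => by
    simp only [hI]
    rw [inner_diagA]
    refine sum_lagBox_le hg H _ fun h => ?_
    split_ifs
    · rw [abs_of_nonneg (hχ.nonneg _)]; exact hχ.le_one _
    · simp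
  have hQB : |Q| ≤ B := by
    rw [hQ, quadSum_eq]
    refine sum_lagBox_le hg H _ fun h => ?_
    split_ifs <;> simp
  have hdeep : ∀ s ∈ box m N, (∀ i, s i ∉ edge m N H) → χ (alt s) * (I s - Q) = 0 := by
    intro s hs hd
    rcases hχ.zero_one (alt s) with h0 | h1
    · rw [h0, zero_mul]
    · simp only [hI]
      rw [inner_diagA, hQ, quadSum_eq, sub_eq_zero.2, mul_zero]
      refine Finset.sum_congr rfl fun h hh => ?_
      have hb : s + h ∈ box m N := mem_box.2 fun i =>
        add_mem_blk_of_notMem_edge (mem_box.1 hs i) (hd i) (mem_lagBox.1 hh i)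
      rw [if_pos hb, alt_add, hχ.add_eq h1]
      have := abs_alt_le hh
      omega
  rw [e, Finset.sum_mul, ← Finset.sum_sub_distrib]
  calc |∑ s ∈ box m N, (χ (alt s) * I s - χ (alt s) * Q)|
      ≤ ∑ s ∈ box m N, ∑ i, if s i ∈ edge m N H then 2 * B * χ (alt s) else 0 := by
        refine (Finset.abs_sum_le_sum_abs _ _).trans (Finset.sum_le_sum fun s hs => ?_)
        have h2B : 0 ≤ 2 * B * χ (alt s) := mul_nonneg (by positivity) (hχ.nonneg _)
        rw [← mul_sub]
        by_cases hd : ∀ i, s i ∉ edge m N H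
        · rw [hdeep s hs hd, abs_zero]
          exact Finset.sum_nonneg fun i _ => by split_ifs <;> [exact h2B; exact le_rfl]
        · push Not at hd
          obtain ⟨i, hi⟩ := hd
          calc |χ (alt s) * (I s - Q)| ≤ χ (alt s) * (B + B) := by
                rw [abs_mul, abs_of_nonneg (hχ.nonneg _)]
                refine mul_le_mul_of_nonneg_left ?_ (hχ.nonneg _)
                exact (abs_sub _ _).trans (add_le_add (hIB s) hQB)
            _ = if s i ∈ edge m N H then 2 * B * χ (alt s) else 0 := by rw [if_pos hi]; ring
            _ ≤ _ := Finset.single_le_sum (f := fun i => if s i ∈ edge m N H then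
                  2 * B * χ (alt s) else 0) (fun i _ => by
                    split_ifs <;> [exact h2B; exact le_rfl]) (Finset.mem_univ i)
    _ = ∑ i : Fin 4, 2 * B * ∑ s ∈ box m N with s i ∈ edge m N H, χ (alt s) := by
        rw [Finset.sum_comm]
        refine Finset.sum_congr rfl fun i _ => ?_
        rw [Finset.sum_filter, Finset.mul_sum]
        exact Finset.sum_congr rfl fun s _ => by split_ifs <;> simp
    _ ≤ ∑ _i : Fin 4, 2 * B * (2 * H * (N : ℝ) ^ 2) := by
        refine Finset.sum_le_sum fun i _ => ?_
        exact mul_le_mul_of_nonneg_left (sum_sel_edge_le hχ m H i) (by positivity)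
    _ = _ := by simp; ring

lemma sum_triple {α β γ : Type*} (A : Finset α) (B : Finset β) (C : Finset γ)
    (F : α × β × γ → ℝ) :
    ∑ p ∈ A ×ˢ B ×ˢ C, F p = ∑ a ∈ A, ∑ b ∈ B, ∑ c ∈ C, F (a, b, c) := by
  rw [Finset.sum_product]
  exact Finset.sum_congr rfl fun _ _ => Finset.sum_product _ _ _

/-- The sum over the pairs of quadruples with prescribed base points in the diagram `C`. -/
def innerC (χ : ℤ → ℝ) (m : ℤ) (N : ℕ) (p : ℤ × ℤ × ℤ) (h : Fin 4 → ℤ) : ℝ :=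
  ∑ d ∈ blk m N, if p.1 + h 0 ∈ blk m N ∧ p.2.1 + h 1 ∈ blk m N ∧ p.2.2 + h 2 ∈ blk m N ∧
    d + h 3 ∈ blk m N then χ (p.2.2 - h 0 - d) * χ (p.2.2 - h 0 - d + alt h) else 0

/-- Change of variables: the base point is p = (s₀, t₀, s₂), d stands for s₃, and the rest is
recovered from the lags. Then alt s = s₂ - h₀ - d and alt t = alt s + alt h. -/
lemma pairSum_diagC_trunc (χ : ℤ → ℝ) (m : ℤ) (N H : ℕ) (g : ℤ → ℝ) :
    pairSum χ m m N (diagC fun x y => trunc g H (y - x)) =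
      ∑ p ∈ blk m N ×ˢ blk m N ×ˢ blk m N, ∑ h ∈ lagBox H, innerC χ m N p h * ∏ i, g (h i) := by
  have e1 : pairSum χ m m N (diagC fun x y => trunc g H (y - x)) =
      ∑ x ∈ box m N ×ˢ box m N with lagC x ∈ lagBox H,
        χ (alt x.1) * χ (alt x.2) * ∏ i, g (lagC x i) := by
    rw [pairSum_apply, ← Finset.sum_product', Finset.sum_filter]
    refine Finset.sum_congr rfl fun x _ => ?_
    have : diagC (fun x y => trunc g H (y - x)) x.1 x.2 = ∏ i, trunc g H (lagC x i) := by
      rw [Fin.prod_univ_four]; rfl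
    rw [this]
    split_ifs with h
    · rw [prod_trunc_eq h]
    · rw [prod_trunc_eq_zero h, mul_zero]
  have e2 : ∑ p ∈ blk m N ×ˢ blk m N ×ˢ blk m N, ∑ h ∈ lagBox H,
      innerC χ m N p h * ∏ i, g (h i) =
      ∑ q ∈ ((blk m N ×ˢ blk m N ×ˢ blk m N) ×ˢ lagBox H) ×ˢ blk m N with
        q.1.1.1 + q.1.2 0 ∈ blk m N ∧ q.1.1.2.1 + q.1.2 1 ∈ blk m N ∧
        q.1.1.2.2 + q.1.2 2 ∈ blk m N ∧ q.2 + q.1.2 3 ∈ blk m N,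
        χ (q.1.1.2.2 - q.1.2 0 - q.2) * χ (q.1.1.2.2 - q.1.2 0 - q.2 + alt q.1.2) *
          ∏ i, g (q.1.2 i) := by
    rw [Finset.sum_filter]
    refine Eq.symm ((Finset.sum_product _ _ _).trans ((Finset.sum_product _ _ _).trans ?_))
    refine Finset.sum_congr rfl fun p _ => Finset.sum_congr rfl fun h _ => ?_
    rw [innerC, Finset.sum_mul]
    exact Finset.sum_congr rfl fun d _ => by split_ifs <;> simp
  rw [e1, e2]
  refine Finset.sum_nbij' (fun x => (((x.1 0, x.2 0, x.1 2), lagC x), x.1 3))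
    (fun q => (![q.1.1.1, q.1.1.1 + q.1.2 0, q.1.1.2.2, q.2],
      ![q.1.1.2.1, q.1.1.2.1 + q.1.2 1, q.1.1.2.2 + q.1.2 2, q.2 + q.1.2 3])) ?_ ?_ ?_ ?_ ?_
  · intro x hx
    obtain ⟨hx, hl⟩ := Finset.mem_filter.1 hx
    have a := mem_box.1 (Finset.mem_product.1 hx).1
    have b := mem_box.1 (Finset.mem_product.1 hx).2
    simp only [Finset.mem_filter, Finset.mem_product, hl, a, b, true_and]
    simp [lagC, a, b]
  · intro q hq
    obtain ⟨hq, c0, c1, c2, c3⟩ := Finset.mem_filter.1 hq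
    simp only [Finset.mem_product] at hq
    obtain ⟨⟨⟨a1, a2, a3⟩, hl⟩, a4⟩ := hq
    refine Finset.mem_filter.2 ⟨Finset.mem_product.2 ⟨mem_box.2 fun i => ?_, mem_box.2 fun i => ?_⟩,
      ?_⟩
    · fin_cases i <;> assumption
    · fin_cases i <;> assumption
    · convert hl using 1
      exact vec4_eq.2 (by simp)
  · intro x hx
    exact Prod.ext (fun4_ext (by simp) (by simp [lagC]) (by simp) (by simp))
      (fun4_ext (by simp) (by simp [lagC]) (by simp [lagC]) (by simp [lagC]))
  · intro q hq
    refine Prod.ext (Prod.ext (by simp) ?_) (by simp)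
    exact vec4_eq.2 (by simp)
  · intro x hx
    have e3 : x.1 2 - lagC x 0 - x.1 3 = alt x.1 := by simp [lagC, alt]; ring
    have e4 : alt x.1 + alt (lagC x) = alt x.2 := by simp [lagC, alt]; ring
    simp only [e3, e4]

/-- For p away from the ends the only d in the block with a selected value is d = s₂ - h₀. The count
is therefore N³ whatever the selector, unlike in diagram A. -/
lemma abs_pairSum_diagC_trunc_sub_le {N : ℕ} {χ : ℤ → ℝ} (hχ : IsSel N χ) (m : ℤ) (H : ℕ)
    (hH : 4 * H < N) (g : ℤ → ℝ) {K : ℝ} (hg : ∀ h, |g h| ≤ K) :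
    |pairSum χ m m N (diagC fun x y => trunc g H (y - x)) - (N : ℝ) ^ 3 * quadSum g H| ≤
      2 * ((2 * H + 1) ^ 4 * K ^ 4) * (3 * (4 * H * (N : ℝ) ^ 2)) := by
  set Q := quadSum g H with hQ
  set B := (2 * (H : ℝ) + 1) ^ 4 * K ^ 4 with hB
  have hB0 : 0 ≤ B := by positivity
  set I : ℤ × ℤ × ℤ → ℝ := fun p => ∑ h ∈ lagBox H, innerC χ m N p h * ∏ i, g (h i) with hI
  set P := blk m N ×ˢ blk m N ×ˢ blk m N with hP
  have hIB : ∀ p, |I p| ≤ B := fun p => by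
    refine sum_lagBox_le hg H _ fun h => ?_
    have h0 : ∀ d ∈ blk m N, (0 : ℝ) ≤ if p.1 + h 0 ∈ blk m N ∧ p.2.1 + h 1 ∈ blk m N ∧
        p.2.2 + h 2 ∈ blk m N ∧ d + h 3 ∈ blk m N then
        χ (p.2.2 - h 0 - d) * χ (p.2.2 - h 0 - d + alt h) else 0 := fun d _ => by
      split_ifs
      · exact mul_nonneg (hχ.nonneg _) (hχ.nonneg _)
      · exact le_rfl
    rw [innerC, abs_of_nonneg (Finset.sum_nonneg h0)]
    refine (Finset.sum_le_sum fun d _ => ?_).trans (sum_blk_sel_le hχ m (p.2.2 - h 0))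
    split_ifs
    · exact mul_le_of_le_one_right (hχ.nonneg _) (hχ.le_one _)
    · exact hχ.nonneg _
  have hQB : |Q| ≤ B := by
    rw [hQ, quadSum_eq]
    refine sum_lagBox_le hg H _ fun h => ?_
    split_ifs <;> simp
  -- The margin is 2H because d + h₃ = s₂ - h₀ + h₃ is displaced from s₂ by two lags.
  have hdeep : ∀ p ∈ P, p.1 ∉ edge m N (2 * H) → p.2.1 ∉ edge m N (2 * H) →
      p.2.2 ∉ edge m N (2 * H) → I p - Q = 0 := by
    intro p hp d1 d2 d3
    simp only [hP, Finset.mem_product] at hp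
    obtain ⟨p1, p2, p3⟩ := hp
    rw [hQ, quadSum_eq, sub_eq_zero]
    refine Finset.sum_congr rfl fun h hh => ?_
    congr 1
    have hh' := mem_lagBox.1 hh
    have k : ∀ i, |h i| ≤ ((2 * H : ℕ) : ℤ) := fun i => by have := hh' i; push_cast; linarith
    have k0 : |-h 0| ≤ ((2 * H : ℕ) : ℤ) := by rw [abs_neg]; exact k 0
    have hd0 : p.2.2 - h 0 ∈ blk m N := by
      rw [sub_eq_add_neg]; exact add_mem_blk_of_notMem_edge p3 d3 k0
    have hd1 : p.2.2 - h 0 + h 3 ∈ blk m N := by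
      rw [sub_eq_add_neg, add_assoc]
      refine add_mem_blk_of_notMem_edge p3 d3 ?_
      have a0 := abs_le.1 (hh' 0); have a3 := abs_le.1 (hh' 3)
      rw [abs_le]; push_cast; constructor <;> linarith
    rw [innerC, Finset.sum_eq_single_of_mem _ hd0]
    · rw [if_pos ⟨add_mem_blk_of_notMem_edge p1 d1 (k 0), add_mem_blk_of_notMem_edge p2 d2 (k 1),
        add_mem_blk_of_notMem_edge p3 d3 (k 2), hd1⟩, sub_self, hχ.zero, one_mul,
        hχ.add_eq hχ.zero]
      have := abs_alt_le hh
      omega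
    · intro d hd hne
      split_ifs
      · by_contra hc
        exact hne (eq_of_mem_blk hd0 hd (hχ.dvd _ (left_ne_zero_of_mul hc))).symm
      · rfl
  have hcard : (N : ℝ) ^ 3 * Q = ∑ _p ∈ P, Q := by
    rw [Finset.sum_const, nsmul_eq_mul, hP]
    simp only [Finset.card_product, card_blk]; push_cast; ring
  rw [pairSum_diagC_trunc, hcard, ← Finset.sum_sub_distrib]
  set E := edge m N (2 * H)
  have hE : (E.card : ℝ) ≤ 4 * H := by
    have := card_edge_le m N (2 * H)
    calc (E.card : ℝ) ≤ ((2 * (2 * H) : ℕ) : ℝ) := by exact_mod_cast this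
      _ = _ := by push_cast; ring
  set r : ℤ → ℝ := fun x => if x ∈ E then 2 * B else 0 with hr
  calc |∑ p ∈ P, (I p - Q)|
      ≤ ∑ p ∈ P, (r p.1 + r p.2.1 + r p.2.2) := by
        simp only [hr]
        refine (Finset.abs_sum_le_sum_abs _ _).trans (Finset.sum_le_sum fun p hp => ?_)
        have h2 : |I p - Q| ≤ 2 * B := by
          rw [two_mul]; exact (abs_sub _ _).trans (add_le_add (hIB p) hQB)
        by_cases d1 : p.1 ∈ E
        · rw [if_pos d1]; split_ifs <;> linarith
        by_cases d2 : p.2.1 ∈ E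
        · rw [if_pos d2]; split_ifs <;> linarith
        by_cases d3 : p.2.2 ∈ E
        · rw [if_pos d3]; split_ifs <;> linarith
        rw [hdeep p hp d1 d2 d3, if_neg d1, if_neg d2, if_neg d3]; simp
    _ = 3 * (((blk m N).filter (· ∈ E)).card * (N : ℝ) ^ 2 * (2 * B)) := by
        rw [hP, sum_triple]
        have hE' : ∑ x ∈ blk m N, r x =
            ((blk m N).filter (· ∈ E)).card * (2 * B) := by
          simp only [hr, ← Finset.sum_filter, Finset.sum_const, nsmul_eq_mul]
        have w' : ∀ a : ℝ, ∑ _x ∈ blk m N, a = N * a := fun a => by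
          rw [Finset.sum_const, card_blk, nsmul_eq_mul]
        simp only [Finset.sum_add_distrib, w', ← Finset.mul_sum]
        rw [hE']
        ring
    _ ≤ 3 * ((4 * H) * (N : ℝ) ^ 2 * (2 * B)) := by
        gcongr
        refine le_trans ?_ hE
        exact_mod_cast Finset.card_le_card fun x hx => (Finset.mem_filter.1 hx).2
    _ = _ := by ring

/-! ### Counting the selected quadruples: N³ against (2N³ + N)/3. -/

/-- The two selectors: `x = 0` and `N ∣ x`. -/
def selZero (x : ℤ) : ℝ := if x = 0 then 1 else 0

def selDvd (N : ℕ) (x : ℤ) : ℝ := if (N : ℤ) ∣ x then 1 else 0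

lemma isSel_selZero (N : ℕ) : IsSel N selZero where
  zero_one x := by unfold selZero; split_ifs <;> simp
  dvd x hx := by
    unfold selZero at hx
    split_ifs at hx with h
    · simp [h]
    · exact absurd rfl hx
  neg x := by simp [selZero]
  zero := by simp [selZero]

lemma isSel_selDvd (N : ℕ) : IsSel N (selDvd N) where
  zero_one x := by unfold selDvd; split_ifs <;> simp
  dvd x hx := by
    unfold selDvd at hx
    split_ifs at hx with h
    · exact h
    · exact absurd rfl hx
  neg x := by simp [selDvd]
  zero := by simp [selDvd]

lemma sum_box (m : ℤ) (N : ℕ) (F : ℤ → ℤ → ℤ → ℤ → ℝ) :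
    ∑ s ∈ box m N, F (s 0) (s 1) (s 2) (s 3) =
      ∑ a ∈ blk m N, ∑ b ∈ blk m N, ∑ c ∈ blk m N, ∑ d ∈ blk m N, F a b c d := by
  rw [← sum_triple (F := fun p => ∑ d ∈ blk m N, F p.1 p.2.1 p.2.2 d),
    ← Finset.sum_product (f := fun q : (ℤ × ℤ × ℤ) × ℤ => F q.1.1 q.1.2.1 q.1.2.2 q.2)]
  refine Finset.sum_nbij' (fun s => ((s 0, s 1, s 2), s 3))
    (fun q => ![q.1.1, q.1.2.1, q.1.2.2, q.2]) ?_ ?_ ?_ ?_ ?_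
  · intro s hs
    have := mem_box.1 hs
    simp [this]
  · intro q hq
    simp only [Finset.mem_product] at hq
    obtain ⟨⟨h1, h2, h3⟩, h4⟩ := hq
    refine mem_box.2 fun i => ?_
    fin_cases i <;> assumption
  · intro s _; exact fun4_ext rfl rfl rfl rfl
  · intro q _; rfl
  · intro s _; rfl

/-- Three coordinates are free and the fourth has exactly one value in its residue class. -/
lemma sum_selDvd {N : ℕ} (hN : 0 < N) (m : ℤ) :
    ∑ s ∈ box m N, selDvd N (alt s) = (N : ℝ) ^ 3 := by
  have hN' : (0 : ℤ) < N := by exact_mod_cast hN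
  have h := sum_box m N (fun a b c d => selDvd N (a - b + c - d))
  simp only [alt]
  rw [h]
  have h1 : ∀ e : ℤ, ∑ d ∈ blk m N, selDvd N (e - d) = 1 := fun e => by
    have hd : m + (e - m) % N ∈ blk m N := by
      rw [mem_blk]
      have := Int.emod_nonneg (e - m) hN'.ne'
      have := Int.emod_lt_of_pos (e - m) hN'
      constructor <;> linarith
    have hdv : (N : ℤ) ∣ e - (m + (e - m) % N) := by
      have := Int.dvd_sub_self_of_emod_eq (a := e - m) (b := (N : ℤ)) (c := (e - m) % N) rfl
      rw [← dvd_neg]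
      exact this.trans (dvd_of_eq (by ring))
    rw [Finset.sum_eq_single_of_mem _ hd]
    · rw [selDvd, if_pos hdv]
    · intro y hy hne
      rw [selDvd, if_neg fun hc => hne (eq_of_mem_blk hy hd
        ((dvd_sub hdv hc).trans (dvd_of_eq (by ring))))]
  simp only [h1, Finset.sum_const, card_blk, nsmul_eq_mul, mul_one]
  ring

lemma card_diff (m d : ℤ) (N : ℕ) (hd : |d| ≤ N) :
    ∑ x ∈ blk m N, ∑ y ∈ blk m N, (if x - y = d then (1 : ℝ) else 0) = N - |(d : ℝ)| := by
  have h1 : ∀ x ∈ blk m N, ∑ y ∈ blk m N, (if x - y = d then (1 : ℝ) else 0) =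
      if x - d ∈ blk m N then 1 else 0 := fun x _ => by
    have : ∀ y, (if x - y = d then (1 : ℝ) else 0) = if y = x - d then 1 else 0 := fun y => by
      congr 1; apply propext; constructor <;> intro h <;> linarith
    simp only [this, Finset.sum_ite_eq']
  rw [Finset.sum_congr rfl h1, ← Finset.sum_filter, Finset.sum_const, nsmul_eq_mul, mul_one]
  have h2 : ((blk m N).filter fun x => x - d ∈ blk m N) =
      Finset.Ico (max m (m + d)) (min (m + N) (m + N + d)) := by
    ext x
    simp only [Finset.mem_filter, mem_blk, Finset.mem_Ico, max_le_iff, lt_min_iff]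
    constructor <;> rintro ⟨⟨_, _⟩, _, _⟩ <;> refine ⟨⟨?_, ?_⟩, ?_, ?_⟩ <;> linarith
  rw [h2, Int.card_Ico]
  have h3 : ((min (m + N) (m + N + d) - max m (m + d)).toNat : ℤ) = N - |d| := by
    rw [Int.toNat_of_nonneg] <;> rcases abs_cases d with ⟨h, h'⟩ | ⟨h, h'⟩ <;> rw [h] at hd <;> omega
  have h4 : (((min (m + N) (m + N + d) - max m (m + d)).toNat : ℤ) : ℝ) = N - |(d : ℝ)| := by
    rw [h3]; push_cast; rfl
  exact_mod_cast h4

lemma sum_Icc_sq (N : ℕ) :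
    ∑ d ∈ Finset.Icc (-(N : ℤ)) N, ((N : ℝ) - |(d : ℝ)|) ^ 2 = (2 * (N : ℝ) ^ 3 + N) / 3 := by
  -- The length n and the value x are decoupled so that induction on n is possible; x = n = N
  -- afterwards.
  have key : ∀ (n : ℕ) (x : ℝ), ∑ d ∈ Finset.Icc (-(n : ℤ)) n, (x - |(d : ℝ)|) ^ 2 =
      (2 * n + 1) * x ^ 2 - 2 * n * (n + 1) * x + n * (n + 1) * (2 * n + 1) / 3 := by
    intro n x
    induction n with
    | zero => simp
    | succ n ih =>
      have : Finset.Icc (-((n + 1 : ℕ) : ℤ)) (n + 1 : ℕ) =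
          insert (-((n + 1 : ℕ) : ℤ)) (insert ((n + 1 : ℕ) : ℤ) (Finset.Icc (-(n : ℤ)) n)) := by
        ext y; simp only [Finset.mem_insert, Finset.mem_Icc]; push_cast; omega
      rw [this, Finset.sum_insert, Finset.sum_insert, ih]
      · push_cast
        rw [abs_neg, abs_of_nonneg (by positivity : (0 : ℝ) ≤ (n : ℝ) + 1)]; ring
      · simp
      · simp only [Finset.mem_insert, Finset.mem_Icc]; push_cast; omega
  rw [key]; ring

/-- alt s = 0 means that s₀ - s₁ and s₃ - s₂ have a common value e, and each difference takes it N -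
|e| times. The sum of squares gives the density 2/3 that distinguishes the integrated statistic. -/
lemma sum_selZero (m : ℤ) (N : ℕ) :
    ∑ s ∈ box m N, selZero (alt s) = (2 * (N : ℝ) ^ 3 + N) / 3 := by
  have h := sum_box m N (fun a b c d => selZero (a - b + c - d))
  simp only [alt]
  rw [h, ← sum_Icc_sq]
  have e : ∀ a ∈ blk m N, ∀ b ∈ blk m N, ∀ c d : ℤ, selZero (a - b + c - d) =
      ∑ e ∈ Finset.Icc (-(N : ℤ)) N, (if a - b = e then (1 : ℝ) else 0) *
        (if d - c = e then 1 else 0) := fun a ha b hb c d => by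
    rw [mem_blk] at ha hb
    simp only [ite_mul, one_mul, zero_mul, Finset.sum_ite_eq]
    rw [if_pos (by rw [Finset.mem_Icc]; omega), selZero]
    congr 1; apply propext; constructor <;> intro h <;> linarith
  rw [Finset.sum_congr rfl fun a ha => Finset.sum_congr rfl fun b hb => Finset.sum_congr rfl
    fun c _ => Finset.sum_congr rfl fun d _ => e a ha b hb c d]
  have e2 : ∀ d ∈ Finset.Icc (-(N : ℤ)) N, ((N : ℝ) - |(d : ℝ)|) ^ 2 =
      ∑ a ∈ blk m N, ∑ b ∈ blk m N, ∑ c ∈ blk m N, ∑ d' ∈ blk m N,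
        (if a - b = d then (1 : ℝ) else 0) * (if d' - c = d then 1 else 0) := fun d hd => by
    rw [Finset.mem_Icc, ← abs_le] at hd
    have h1 := card_diff m d N hd
    have h2 : ∑ c ∈ blk m N, ∑ d' ∈ blk m N, (if d' - c = d then (1 : ℝ) else 0) =
      N - |(d : ℝ)| := by rw [Finset.sum_comm]; exact h1
    simp only [← Finset.mul_sum, h2, ← Finset.sum_mul, h1]; ring
  rw [Finset.sum_congr rfl e2]
  symm
  rw [Finset.sum_comm]
  refine Finset.sum_congr rfl fun a _ => ?_
  rw [Finset.sum_comm]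
  refine Finset.sum_congr rfl fun b _ => ?_
  rw [Finset.sum_comm]
  refine Finset.sum_congr rfl fun c _ => ?_
  exact Finset.sum_comm

/-! ### Assembling the covariance sums over all pairs of blocks. -/

lemma abs_trunc_le {g : ℤ → ℝ} {B : ℤ → ℝ} (hB : ∀ h, 0 ≤ B h) (hg : ∀ h, |g h| ≤ B h) (H : ℕ)
    (h : ℤ) : |trunc g H h| ≤ B h := by
  unfold trunc
  split_ifs
  · exact hg h
  · simpa using hB h

/-- Contribution of the pairs of equal blocks. -/
lemma exists_diag_bound {b δ : ℝ} (hb : 3 / 4 < b) (hδ : 0 < δ) (hbδ : b + δ < 1) :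
    ∃ C : ℝ, 0 ≤ C ∧ ∀ (N : ℕ) (χ : ℤ → ℝ) (j : ℤ) (H : ℕ) (K θ : ℝ) (c : ℤ → ℤ → ℝ) (g : ℤ → ℝ),
      4 * H < N → IsSel N χ → 0 ≤ K → 0 ≤ θ → (∀ x y, |c x y| ≤ K * kf (b + δ) (y - x)) →
      (∀ h, |g h| ≤ K * kf (b + δ) h) →
      (∀ x ∈ blk (j * N) N, ∀ y ∈ blk (j * N) N, |c x y - g (y - x)| ≤ θ * (K * kf b (y - x))) →
      |pairSum χ (j * N) (j * N) N (diagA c) -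
          (∑ s ∈ box (j * N) N, χ (alt s)) * quadSum g H| ≤
        C * K ^ 4 * ((θ + kf δ H) * (N : ℝ) ^ 3 + H * (2 * H + 1) ^ 4 * (N : ℝ) ^ 2) ∧
      |pairSum χ (j * N) (j * N) N (diagC c) - (N : ℝ) ^ 3 * quadSum g H| ≤
        C * K ^ 4 * ((θ + kf δ H) * (N : ℝ) ^ 3 + H * (2 * H + 1) ^ 4 * (N : ℝ) ^ 2) := by
  obtain ⟨C, hC, R⟩ := exists_replace_bound hb (by linarith : b < 1)
  refine ⟨C + 24, by positivity, fun N χ j H K θ c g hH hχ hK hθ hc hg hcg => ?_⟩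
  have hN : 0 < N := by omega
  have hkf : ∀ h, K * kf (b + δ) h ≤ K * kf b h := fun h =>
    mul_le_mul_of_nonneg_left (kf_exp_anti (by linarith) h) hK
  have hgK : ∀ h, |g h| ≤ K := fun h => (hg h).trans
    (mul_le_of_le_one_right hK (kf_le_one (by linarith) h))
  have hη : 0 ≤ θ + kf δ H := add_nonneg hθ (kf_nonneg _ _)
  obtain ⟨RA, RC⟩ := R N χ j K (θ + kf δ H) c (fun x y => trunc g H (y - x)) hN hχ hη
    (fun x y => (hc x y).trans (hkf _))
    (fun x y => abs_trunc_le (fun h => mul_nonneg hK (kf_nonneg _ _))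
      (fun h => (hg h).trans (hkf h)) H _)
    (fun x hx y hy => by
      have p := mul_nonneg hK (kf_nonneg b (y - x))
      have p' := mul_nonneg (kf_nonneg δ H) p
      have p'' := mul_nonneg hθ p
      unfold trunc
      split_ifs with h
      · refine (hcg x hx y hy).trans ?_
        rw [add_mul]; linarith
      -- Beyond lag H the truncated kernel vanishes, and the spare exponent of the covariance bound
      -- yields the factor `kf δ H`.
      · rw [sub_zero]
        push Not at h
        have h1 : kf δ (y - x) ≤ kf δ H := kf_anti hδ.le (by rw [Nat.abs_cast]; exact h.le)
        calc |c x y| ≤ K * kf (b + δ) (y - x) := hc x y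
          _ = kf δ (y - x) * (K * kf b (y - x)) := by rw [← kf_mul]; ring
          _ ≤ kf δ H * (K * kf b (y - x)) := by gcongr
          _ ≤ _ := by rw [add_mul]; linarith)
  have TA := abs_pairSum_diagA_trunc_sub_le hχ (j * N) H hH g hgK
  have TC := abs_pairSum_diagC_trunc_sub_le hχ (j * N) H hH g hgK
  have a1 : 0 ≤ K ^ 4 * ((θ + kf δ H) * (N : ℝ) ^ 3) := by positivity
  have a2 : 0 ≤ K ^ 4 * (H * (2 * (H : ℝ) + 1) ^ 4 * (N : ℝ) ^ 2) := by positivity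
  have a3 := mul_nonneg hC a2
  constructor
  · refine (abs_sub_le _ _ _).trans ((add_le_add RA TA).trans ?_)
    nlinarith
  · refine (abs_sub_le _ _ _).trans ((add_le_add RC TC).trans ?_)
    nlinarith

lemma sum_range_eq_add_image {f : ℤ → ℝ} {M j : ℕ} (hj : j < M) :
    ∑ j' ∈ Finset.range M, f j' =
      f j + ∑ j' ∈ ((Finset.range M).erase j).image (Nat.cast : ℕ → ℤ), f j' := by
  rw [Finset.sum_image (fun _ _ _ _ h => by exact_mod_cast h),
    Finset.add_sum_erase _ (fun j' : ℕ => f j') (Finset.mem_range.2 hj)]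

/-- The deterministic core: the covariance sums over all pairs of blocks. -/
lemma exists_total_bound {b δ : ℝ} (hb : 3 / 4 < b) (hδ : 0 < δ) (hbδ : b + δ < 1) :
    ∃ C : ℝ, 0 ≤ C ∧ ∀ (N M : ℕ) (χ : ℤ → ℝ) (H : ℕ) (K θ : ℝ) (c : ℤ → ℤ → ℝ) (g : ℕ → ℤ → ℝ),
      4 * H < N → IsSel N χ → 0 ≤ K → 0 ≤ θ → (∀ x y, c x y = c y x) →
      (∀ x y, |c x y| ≤ K * kf (b + δ) (y - x)) → (∀ j h, |g j h| ≤ K * kf (b + δ) h) →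
      (∀ j < M, ∀ x ∈ blk (j * N) N, ∀ y ∈ blk (j * N) N,
        |c x y - g j (y - x)| ≤ θ * (K * kf b (y - x))) →
      |∑ j ∈ Finset.range M, ∑ j' ∈ Finset.range M, pairSum χ (j * N) (j' * N) N (wickCov c) -
          ∑ j ∈ Finset.range M, (8 * ∑ s ∈ box (j * N) N, χ (alt s) + 32 * (N : ℝ) ^ 3) *
            quadSum (g j) H| ≤
        C * K ^ 4 * (M * ((θ + kf δ H) * (N : ℝ) ^ 3 + H * (2 * H + 1) ^ 4 * (N : ℝ) ^ 2 +
          (N : ℝ) ^ 2 * (N : ℝ) ^ (1 - δ) + (N : ℝ) ^ 2 * ((N : ℝ) ^ (1 - b)) ^ 4)) := by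
  obtain ⟨C1, h1, H1⟩ := exists_diag_bound hb hδ hbδ
  obtain ⟨C2, h2, H2⟩ := exists_cross_bound hb hδ hbδ
  obtain ⟨C3, h3, H3⟩ := exists_diagErr_bound (by linarith : 0 < b) (by linarith : b < 1)
  obtain ⟨C4, h4, H4⟩ := exists_sum_kf (p := b + b) (by linarith) (by linarith)
  -- 40 = 8 + 32 is the joint multiplicity of diagrams A and C; C₄ bounds the sum over the second
  -- block of `kf b` squared, finite since 2b > 1.
  refine ⟨40 * C1 + 40 * C2 + C3 * C4, by positivity,
    fun N M χ H K θ c g hH hχ hK hθ hsym hc hg hcg => ?_⟩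
  have hN : 0 < N := by omega
  have hη : 0 ≤ θ + kf δ H := add_nonneg hθ (kf_nonneg _ _)
  have hK4 : 0 ≤ K ^ 4 := by positivity
  have hcb : ∀ x y, |c x y| ≤ K * kf b (y - x) := fun x y => (hc x y).trans
    (mul_le_mul_of_nonneg_left (kf_exp_anti (by linarith) _) hK)
  set E1 := (θ + kf δ H) * (N : ℝ) ^ 3 + H * (2 * H + 1) ^ 4 * (N : ℝ) ^ 2 with hE1
  set E2 := (N : ℝ) ^ 2 * (N : ℝ) ^ (1 - δ) with hE2
  set E3 := (N : ℝ) ^ 2 * ((N : ℝ) ^ (1 - b)) ^ 4 with hE3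
  have p1 : 0 ≤ E1 := by positivity
  have p2 : 0 ≤ E2 := by positivity
  have p3 : 0 ≤ E3 := by positivity
  have key : ∀ j ∈ Finset.range M,
      |∑ j' ∈ Finset.range M, pairSum χ (j * N) (j' * N) N (wickCov c) -
        (8 * ∑ s ∈ box (j * N) N, χ (alt s) + 32 * (N : ℝ) ^ 3) * quadSum (g j) H| ≤
      (40 * C1 + 40 * C2 + C3 * C4) * K ^ 4 * (E1 + E2 + E3) := by
    intro j hj
    rw [Finset.mem_range] at hj
    set J := ((Finset.range M).erase j).image (Nat.cast : ℕ → ℤ) with hJ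
    have hjJ : (j : ℤ) ∉ J := by simp [hJ]
    obtain ⟨DA, DC⟩ := H1 N χ j H K θ c (g j) hH hχ hK hθ hc (hg j) (hcg j hj)
    obtain ⟨XA, XC⟩ := H2 N χ j J K c hN hχ hc hjJ
    have XA' := (Finset.abs_sum_le_sum_abs _ _).trans XA
    have XC' := (Finset.abs_sum_le_sum_abs _ _).trans XC
    have ER : |∑ j' ∈ Finset.range M, pairSum χ (j * N) (j' * N) N (diagErr c)| ≤
        C3 * K ^ 4 * E3 * C4 := by
      refine (Finset.abs_sum_le_sum_abs _ _).trans
        ((Finset.sum_le_sum fun (j' : ℕ) _ => H3 N χ j j' K c hN hχ hcb).trans ?_)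
      rw [← Finset.mul_sum]
      refine mul_le_mul_of_nonneg_left ?_ (by positivity)
      have := H4 ((Finset.range M).image (Nat.cast : ℕ → ℤ)) j
      rw [Finset.sum_image (fun _ _ _ _ h => by exact_mod_cast h)] at this
      refine le_trans (le_of_eq (Finset.sum_congr rfl fun j' _ => ?_)) this
      rw [sq, kf_mul, kf_sub_comm]
    have split : ∑ j' ∈ Finset.range M, pairSum χ (j * N) (j' * N) N (wickCov c) =
        8 * (pairSum χ (j * N) (j * N) N (diagA c) +
          ∑ j' ∈ J, pairSum χ (j * N) (j' * N) N (diagA c)) +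
        32 * (pairSum χ (j * N) (j * N) N (diagC c) +
          ∑ j' ∈ J, pairSum χ (j * N) (j' * N) N (diagC c)) +
        ∑ j' ∈ Finset.range M, pairSum χ (j * N) (j' * N) N (diagErr c) := by
      rw [hJ, ← sum_range_eq_add_image (f := fun j' => pairSum χ (j * N) (j' * N) N (diagA c)) hj,
        ← sum_range_eq_add_image (f := fun j' => pairSum χ (j * N) (j' * N) N (diagC c)) hj,
        Finset.mul_sum, Finset.mul_sum, ← Finset.sum_add_distrib, ← Finset.sum_add_distrib]
      exact Finset.sum_congr rfl fun j' _ => pairSum_wickCov χ hχ.neg _ _ N c hsym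
    rw [split]
    rw [abs_le] at DA DC XA' XC' ER ⊢
    have q1 : 0 ≤ C1 * K ^ 4 * E2 := by positivity
    have q2 : 0 ≤ C1 * K ^ 4 * E3 := by positivity
    have q3 : 0 ≤ C2 * K ^ 4 * E1 := by positivity
    have q4 : 0 ≤ C2 * K ^ 4 * E3 := by positivity
    have q5 : 0 ≤ C3 * C4 * K ^ 4 * E1 := by positivity
    have q6 : 0 ≤ C3 * C4 * K ^ 4 * E2 := by positivity
    constructor <;> linarith [DA.1, DA.2, DC.1, DC.2, XA'.1, XA'.2, XC'.1, XC'.2, ER.1, ER.2]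
  rw [← Finset.sum_sub_distrib]
  refine (Finset.abs_sum_le_sum_abs _ _).trans ((Finset.sum_le_sum key).trans (le_of_eq ?_))
  rw [Finset.sum_const, Finset.card_range, nsmul_eq_mul]; ring

/-- The same sums for a bounded even weight. -/
lemma exists_total_full_bound {b : ℝ} (hb : 3 / 4 < b) (hb1 : b < 1) :
    ∃ C : ℝ, 0 ≤ C ∧ ∀ (N M : ℕ) (χ : ℤ → ℝ) (K R : ℝ) (c : ℤ → ℤ → ℝ), 0 < N →
      (∀ x, χ (-x) = χ x) → (∀ x, |χ x| ≤ R) → (∀ x y, c x y = c y x) →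
      (∀ x y, |c x y| ≤ K * kf b (y - x)) →
      |∑ j ∈ Finset.range M, ∑ j' ∈ Finset.range M,
        pairSum χ (j * N) (j' * N) N (wickCov c)| ≤
        C * R ^ 2 * K ^ 4 * (M * ((N : ℝ) ^ 4 * ((N : ℝ) ^ (1 - b)) ^ 4)) := by
  obtain ⟨C3, h3, H3⟩ := exists_full_bound (by linarith : 0 < b) hb1
  obtain ⟨C4, h4, H4⟩ := exists_sum_kf (p := b + b) (by linarith) (by linarith)
  refine ⟨C3 * C4, by positivity, fun N M χ K R c hN hχ hR hsym hc => ?_⟩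
  have key : ∀ j ∈ Finset.range M,
      |∑ j' ∈ Finset.range M, pairSum χ (j * N) (j' * N) N (wickCov c)| ≤
      C3 * R ^ 2 * K ^ 4 * ((N : ℝ) ^ 4 * ((N : ℝ) ^ (1 - b)) ^ 4) * C4 := by
    intro j hj
    refine (Finset.abs_sum_le_sum_abs _ _).trans
      ((Finset.sum_le_sum fun (j' : ℕ) _ => H3 N χ j j' K R c hN hχ hR hsym hc).trans ?_)
    rw [← Finset.mul_sum]
    refine mul_le_mul_of_nonneg_left ?_ (by positivity)
    have := H4 ((Finset.range M).image (Nat.cast : ℕ → ℤ)) j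
    rw [Finset.sum_image (fun _ _ _ _ h => by exact_mod_cast h)] at this
    refine le_trans (le_of_eq (Finset.sum_congr rfl fun j' _ => ?_)) this
    rw [sq, kf_mul, kf_sub_comm]
  refine (Finset.abs_sum_le_sum_abs _ _).trans ((Finset.sum_le_sum key).trans (le_of_eq ?_))
  rw [Finset.sum_const, Finset.card_range, nsmul_eq_mul]; ring

lemma tendsto_kf_atTop {δ : ℝ} (hδ : 0 < δ) : Tendsto (fun H : ℕ => kf δ H) atTop (𝓝 0) := by
  have h : Tendsto (fun H : ℕ => (1 + (H : ℝ)) ^ (-δ)) atTop (𝓝 0) :=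
    (tendsto_rpow_neg_atTop hδ).comp (tendsto_atTop_add_const_left _ _ tendsto_natCast_atTop_atTop)
  refine h.congr fun H => by rw [kf_natCast]

lemma tendsto_natCast_rpow_neg {p : ℝ} (hp : 0 < p) {N : ℕ → ℕ} (hN : Tendsto N atTop atTop) :
    Tendsto (fun n => (N n : ℝ) ^ (-p)) atTop (𝓝 0) :=
  (tendsto_rpow_neg_atTop hp).comp (tendsto_natCast_atTop_atTop.comp hN)

/-- Limit of the normalised covariance sums. -/
lemma tendsto_total {b δ K w L : ℝ} (hb : 3 / 4 < b) (hδ : 0 < δ) (hbδ : b + δ < 1) (hK : 0 ≤ K)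
    {N M : ℕ → ℕ} {χ : ℕ → ℤ → ℝ} {θ : ℕ → ℝ} {c : ℕ → ℤ → ℤ → ℝ} {g : ℕ → ℕ → ℤ → ℝ}
    {l : ℕ → ℝ} {w' : ℕ → ℝ}
    (hN : Tendsto N atTop atTop) (hM : ∀ n, 0 < M n) (hχ : ∀ n, IsSel (N n) (χ n))
    (hθ : Tendsto θ atTop (𝓝 0)) (hθ0 : ∀ n, 0 ≤ θ n) (hsym : ∀ n x y, c n x y = c n y x)
    (hc : ∀ n x y, |c n x y| ≤ K * kf (b + δ) (y - x))
    (hg : ∀ n j h, |g n j h| ≤ K * kf (b + δ) h)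
    (hcg : ∀ n, ∀ j < M n, ∀ x ∈ blk (j * N n) (N n), ∀ y ∈ blk (j * N n) (N n),
        |c n x y - g n j (y - x)| ≤ θ n * (K * kf b (y - x)))
    (hw' : ∀ n (j : ℕ), ∑ s ∈ box (j * N n) (N n), χ n (alt s) = w' n * (N n : ℝ) ^ 3)
    (hw : Tendsto w' atTop (𝓝 w))
    (hl : ∀ H : ℕ, Tendsto (fun n => (1 / M n : ℝ) * ∑ j ∈ Finset.range (M n),
      quadSum (g n j) H) atTop (𝓝 (l H)))
    (hL : Tendsto l atTop (𝓝 L)) :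
    Tendsto (fun n => (1 / (M n * (N n : ℝ) ^ 3)) * ∑ j ∈ Finset.range (M n),
      ∑ j' ∈ Finset.range (M n), pairSum (χ n) (j * N n) (j' * N n) (N n) (wickCov (c n)))
      atTop (𝓝 ((8 * w + 32) * L)) := by
  obtain ⟨C, hC, T⟩ := exists_total_bound hb hδ hbδ
  set V := fun n => (1 / (M n * (N n : ℝ) ^ 3)) * ∑ j ∈ Finset.range (M n),
      ∑ j' ∈ Finset.range (M n), pairSum (χ n) (j * N n) (j' * N n) (N n) (wickCov (c n)) with hV
  set A := fun (H n : ℕ) => (8 * w' n + 32) * ((1 / M n : ℝ) * ∑ j ∈ Finset.range (M n),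
      quadSum (g n j) H) with hA
  set E := fun (H n : ℕ) => C * K ^ 4 * (θ n + kf δ H + H * (2 * H + 1) ^ 4 * (N n : ℝ) ^ (-1 : ℝ) +
    (N n : ℝ) ^ (-δ) + (N n : ℝ) ^ (-(4 * b - 3))) with hE
  have hbd : ∀ H n : ℕ, 4 * H < N n → |V n - A H n| ≤ E H n := by
    intro H n hH
    have t := T (N n) (M n) (χ n) H K (θ n) (c n) (g n) hH (hχ n) hK (hθ0 n) (hsym n) (hc n) (hg n)
      (hcg n)
    have hN0 : (0 : ℝ) < N n := by exact_mod_cast (by omega : 0 < N n)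
    have hM0 : (0 : ℝ) < M n := by exact_mod_cast hM n
    have hfac : 0 < (M n : ℝ) * (N n : ℝ) ^ 3 := by positivity
    have e1 : (∑ j ∈ Finset.range (M n), (8 * ∑ s ∈ box (j * N n) (N n), χ n (alt s) +
        32 * (N n : ℝ) ^ 3) * quadSum (g n j) H) = (M n * (N n : ℝ) ^ 3) * A H n := by
      simp only [hA, hw', ← Finset.mul_sum]
      field_simp
    have e2 : ∑ j ∈ Finset.range (M n), ∑ j' ∈ Finset.range (M n),
        pairSum (χ n) (j * N n) (j' * N n) (N n) (wickCov (c n)) = (M n * (N n : ℝ) ^ 3) * V n := by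
      rw [hV]; field_simp
    have r1 : (N n : ℝ) ^ (1 - δ) = N n * (N n : ℝ) ^ (-δ) := by
      rw [sub_eq_add_neg, Real.rpow_add hN0, Real.rpow_one]
    have r2 : ((N n : ℝ) ^ (1 - b)) ^ 4 = N n * (N n : ℝ) ^ (-(4 * b - 3)) := by
      rw [← Real.rpow_natCast, ← Real.rpow_mul hN0.le]
      nth_rewrite 2 [← Real.rpow_one (N n : ℝ)]
      rw [← Real.rpow_add hN0]; congr 1; push_cast; ring
    have r3 : (N n : ℝ) ^ 2 = (N n : ℝ) ^ 3 * (N n : ℝ) ^ (-1 : ℝ) := by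
      rw [Real.rpow_neg_one]; field_simp
    rw [e1, e2, ← mul_sub, abs_mul, abs_of_pos hfac] at t
    refine le_of_mul_le_mul_left (t.trans (le_of_eq ?_)) hfac
    rw [hE, r1, r2]
    nth_rewrite 1 [r3]
    ring
  have hElim : ∀ H : ℕ, Tendsto (fun n => E H n) atTop (𝓝 (C * K ^ 4 * kf δ H)) := fun H => by
    have := ((((hθ.add_const (kf δ H)).add ((tendsto_natCast_rpow_neg one_pos hN).const_mul
      ((H : ℝ) * (2 * H + 1) ^ 4))).add (tendsto_natCast_rpow_neg hδ hN)).add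
      (tendsto_natCast_rpow_neg (by linarith : 0 < 4 * b - 3) hN)).const_mul (C * K ^ 4)
    simpa only [zero_add, mul_zero, add_zero] using this
  have hAlim : ∀ H : ℕ, Tendsto (fun n => A H n) atTop (𝓝 ((8 * w + 32) * l H)) := fun H =>
    ((hw.const_mul 8).add_const 32).mul (hl H)
  have hB : Tendsto (fun H : ℕ => C * K ^ 4 * kf δ H) atTop (𝓝 0) := by
    simpa using (tendsto_kf_atTop hδ).const_mul (C * K ^ 4)
  rw [Metric.tendsto_atTop']
  intro ε hε
  -- The cut-off H is fixed first, making the truncation error and |l H - L| small; only then does n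
  -- grow, so powers of H do no harm.
  obtain ⟨H, hH1, hH2⟩ := ((hB.eventually (gt_mem_nhds (by linarith : 0 < ε / 4))).and
    ((hL.const_mul (8 * w + 32)).eventually (Metric.ball_mem_nhds _ (by linarith : 0 < ε / 4)))).exists
  have ev := (((hElim H).eventually (gt_mem_nhds hH1)).and ((hAlim H).eventually
    (Metric.ball_mem_nhds _ (by linarith : 0 < ε / 4)))).and (hN.eventually_gt_atTop (4 * H))
  obtain ⟨n₀, hn₀⟩ := eventually_atTop.1 ev
  refine ⟨n₀, fun n hn => ?_⟩
  obtain ⟨⟨q1, q2⟩, q3⟩ := hn₀ n hn.le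
  have q := hbd H n q3
  rw [Real.dist_eq] at hH2 q2
  rw [Real.dist_eq]
  rw [abs_lt] at hH2 q2 ⊢
  rw [abs_le] at q
  constructor <;> linarith [q.1, q.2, q2.1, q2.2, hH2.1, hH2.2]

/-- For the weights entering through the discretisation error the normalised sums vanish. -/
lemma tendsto_total_full {b K R : ℝ} (hb : 3 / 4 < b) (hb1 : b < 1)
    {N M : ℕ → ℕ} {χ : ℕ → ℤ → ℝ} {c : ℕ → ℤ → ℤ → ℝ}
    (hN : Tendsto N atTop atTop) (hN0 : ∀ n, 0 < N n) (hM : ∀ n, 0 < M n)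
    (hχ : ∀ n x, χ n (-x) = χ n x) (hR : ∀ n x, |χ n x| ≤ R) (hsym : ∀ n x y, c n x y = c n y x)
    (hc : ∀ n x y, |c n x y| ≤ K * kf b (y - x)) :
    Tendsto (fun n => (1 / (M n * (N n : ℝ) ^ 5)) * ∑ j ∈ Finset.range (M n),
      ∑ j' ∈ Finset.range (M n), pairSum (χ n) (j * N n) (j' * N n) (N n) (wickCov (c n)))
      atTop (𝓝 0) := by
  obtain ⟨C, hC, T⟩ := exists_total_full_bound hb hb1
  have lim : Tendsto (fun n => C * R ^ 2 * K ^ 4 * (N n : ℝ) ^ (-(4 * b - 3))) atTop (𝓝 0) := by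
    simpa using (tendsto_natCast_rpow_neg (by linarith : 0 < 4 * b - 3) hN).const_mul
      (C * R ^ 2 * K ^ 4)
  refine squeeze_zero_norm (fun n => ?_) lim
  have t := T (N n) (M n) (χ n) K R (c n) (hN0 n) (hχ n) (hR n) (hsym n) (hc n)
  have hN0 : (0 : ℝ) < N n := by exact_mod_cast hN0 n
  have hM0 : (0 : ℝ) < M n := by exact_mod_cast hM n
  have r2 : ((N n : ℝ) ^ (1 - b)) ^ 4 = N n * (N n : ℝ) ^ (-(4 * b - 3)) := by
    rw [← Real.rpow_natCast, ← Real.rpow_mul hN0.le]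
    nth_rewrite 2 [← Real.rpow_one (N n : ℝ)]
    rw [← Real.rpow_add hN0]; congr 1; push_cast; ring
  rw [Real.norm_eq_abs, abs_mul, abs_of_pos (by positivity : 0 < 1 / ((M n : ℝ) * (N n : ℝ) ^ 5))]
  calc _ ≤ _ := mul_le_mul_of_nonneg_left t (by positivity)
    _ = _ := by rw [r2]; field_simp

/-! ### Gaussian moments: integration by parts and Wick's recursion. -/

/-- Functions with moments of all orders. -/
def AllMoments {α : Type*} [MeasurableSpace α] (f : α → ℝ) (μ : Measure α) : Prop :=
  ∀ p : ENNReal, p ≠ ⊤ → MemLp f p μ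

namespace AllMoments

variable {α : Type*} [MeasurableSpace α] {μ : Measure α} {f g : α → ℝ}

lemma mul (hf : AllMoments f μ) (hg : AllMoments g μ) :
    AllMoments (fun x => f x * g x) μ := fun p hp => by
  have h2 : (2 * p) ≠ ⊤ := ENNReal.mul_ne_top (by simp) hp
  have : ENNReal.HolderTriple (2 * p) (2 * p) p := ⟨by
    rw [ENNReal.mul_inv (by simp) (by simp), ← add_mul, ENNReal.inv_two_add_inv_two, one_mul]⟩
  exact (hg _ h2).mul' (hf _ h2)

lemma add (hf : AllMoments f μ) (hg : AllMoments g μ) :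
    AllMoments (fun x => f x + g x) μ := fun p hp => (hf p hp).add (hg p hp)

lemma const [IsFiniteMeasure μ] (c : ℝ) : AllMoments (fun _ : α => c) μ := fun _ _ => memLp_const c

lemma const_mul (hf : AllMoments f μ) (c : ℝ) : AllMoments (fun x => c * f x) μ :=
  fun p hp => (hf p hp).const_mul c

lemma prod [IsFiniteMeasure μ] {ι : Type*} {s : Finset ι} {f : ι → α → ℝ}
    (hf : ∀ i ∈ s, AllMoments (f i) μ) : AllMoments (fun x => ∏ i ∈ s, f i x) μ := by
  classical
  induction s using Finset.induction_on with
  | empty => simpa using const 1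
  | insert i s hi ih =>
    simp only [Finset.prod_insert hi]
    exact (hf i (Finset.mem_insert_self _ _)).mul
      (ih fun j hj => hf j (Finset.mem_insert_of_mem hj))

lemma sum {ι : Type*} {s : Finset ι} {f : ι → α → ℝ}
    (hf : ∀ i ∈ s, AllMoments (f i) μ) : AllMoments (fun x => ∑ i ∈ s, f i x) μ :=
  fun p hp => memLp_finsetSum _ fun i hi => hf i hi p hp

lemma integrable (hf : AllMoments f μ) : Integrable f μ :=
  memLp_one_iff_integrable.1 (hf 1 (by simp))

lemma memLp_two (hf : AllMoments f μ) : MemLp f 2 μ := hf 2 (by simp)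

end AllMoments

lemma prod_erase_eq_prod_succAbove {m : ℕ} (i : Fin (m + 1)) (f : Fin (m + 1) → ℝ) :
    ∏ j ∈ Finset.univ.erase i, f j = ∏ j, f (i.succAbove j) := by
  rw [Fin.univ_succAbove m i, Finset.cons_eq_insert, Finset.erase_insert (by simp),
    Finset.prod_map]
  rfl

/-- Gaussian integration by parts for products of affine functions. -/
lemma integral_mul_prod_gaussianReal {v : NNReal} (hv : v ≠ 0) {m : ℕ} (r a : Fin (m + 1) → ℝ) :
    ∫ y, y * ∏ i, (r i + a i * y) ∂(gaussianReal 0 v) =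
      v * ∫ y, ∑ i, a i * ∏ j, (r (i.succAbove j) + a (i.succAbove j) * y) ∂(gaussianReal 0 v) := by
  have hid : AllMoments (fun y : ℝ => y) (gaussianReal 0 v) := fun p hp => memLp_id_gaussianReal' p hp
  have haff : ∀ i, AllMoments (fun y : ℝ => r i + a i * y) (gaussianReal 0 v) := fun i =>
    (AllMoments.const (r i)).add (hid.const_mul (a i))
  have hf : AllMoments (fun y : ℝ => ∏ i, (r i + a i * y)) (gaussianReal 0 v) :=
    AllMoments.prod fun i _ => haff i
  have hf' : AllMoments (fun y : ℝ => ∑ i, a i * ∏ j, (r (i.succAbove j) + a (i.succAbove j) * y))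
      (gaussianReal 0 v) :=
    AllMoments.sum fun i _ => (AllMoments.prod fun j _ => haff _).const_mul _
  have hi0 := hf.integrable
  have hi1 := hf'.integrable
  have hi2 := (hid.mul hf).integrable
  have conv : ∀ h : ℝ → ℝ, Integrable h (gaussianReal 0 v) →
      Integrable (fun y => gaussianPDFReal 0 v y * h y) := fun h hh => by
    rw [gaussianReal_of_var_ne_zero _ hv] at hh
    have := (integrable_withDensity_iff_integrable_smul₀' (by fun_prop)
      (ae_of_all _ fun x => by simp [gaussianPDF])).1 hh
    simpa [gaussianPDF, ENNReal.toReal_ofReal (gaussianPDFReal_nonneg 0 v _)] using this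
  have hder : ∀ y, HasDerivAt (fun y => gaussianPDFReal 0 v y * ∏ i, (r i + a i * y))
      (gaussianPDFReal 0 v y * (∑ i, a i * ∏ j, (r (i.succAbove j) + a (i.succAbove j) * y)) -
        (v : ℝ)⁻¹ * (gaussianPDFReal 0 v y * (y * ∏ i, (r i + a i * y)))) y := fun y => by
    have h1 : HasDerivAt (fun y => gaussianPDFReal 0 v y)
        (gaussianPDFReal 0 v y * (-y / v)) y := by
      unfold gaussianPDFReal
      have : HasDerivAt (fun y : ℝ => -(y - 0) ^ 2 / (2 * v)) (-y / v) y := by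
        have h := ((((hasDerivAt_id y).sub_const 0).pow 2).neg).div_const (2 * (v : ℝ))
        refine h.congr_deriv ?_
        have : (v : ℝ) ≠ 0 := by exact_mod_cast hv
        simp; field_simp
      exact (this.exp.const_mul ((√(2 * π * v))⁻¹)).congr_deriv (by ring)
    have h2 : HasDerivAt (fun y => ∏ i, (r i + a i * y))
        (∑ i, a i * ∏ j, (r (i.succAbove j) + a (i.succAbove j) * y)) y := by
      have := HasDerivAt.fun_finsetProd (u := Finset.univ) (f := fun i y => r i + a i * y)
        (f' := a) (x := y) (fun i _ => by
          simpa using ((hasDerivAt_id y).const_mul (a i)).const_add (r i))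
      refine this.congr_deriv (Finset.sum_congr rfl fun i _ => ?_)
      rw [prod_erase_eq_prod_succAbove i (fun j => r j + a j * y), smul_eq_mul, mul_comm]
    refine (h1.mul h2).congr_deriv ?_
    have : (v : ℝ) ≠ 0 := by exact_mod_cast hv
    field_simp; ring
  -- The Gaussian density φ satisfies φ' = -(y/v)φ; the integral of the derivative of φ times the
  -- product vanishes, which is the claimed identity.
  have key := integral_eq_zero_of_hasDerivAt_of_integrable hder
    ((conv _ hi1).sub ((conv _ hi2).const_mul _)) (conv _ hi0)
  rw [integral_sub (conv _ hi1) ((conv _ hi2).const_mul _), integral_const_mul] at key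
  rw [integral_gaussianReal_eq_integral_smul hv, integral_gaussianReal_eq_integral_smul hv]
  simp only [smul_eq_mul]
  have hv' : (v : ℝ) ≠ 0 := by exact_mod_cast hv
  rw [sub_eq_zero] at key
  rw [key, ← mul_assoc, mul_inv_cancel₀ hv', one_mul]

section Wick

variable {Ω : Type*} [MeasurableSpace Ω] {P : Measure Ω}

/-- Covariance kernel of a centred process. -/
def covK (P : Measure Ω) (x : ℤ → Ω → ℝ) (s t : ℤ) : ℝ := ∫ ω, x s ω * x t ω ∂P

lemma covK_comm (x : ℤ → Ω → ℝ) (s t : ℤ) : covK P x s t = covK P x t s := by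
  simp only [covK, mul_comm]

variable {x : ℤ → Ω → ℝ}

lemma allMoments_of_gaussian (hx : IsGaussianProcess x P) (t : ℤ) : AllMoments (x t) P :=
  fun _ hp => (hx.hasGaussianLaw_eval t).memLp hp

/-- Wick's recursion. -/
lemma integral_mul_prod [IsProbabilityMeasure P] (hx : IsGaussianProcess x P) (h0 : ∀ t, ∫ ω, x t ω ∂P = 0)
    {m : ℕ} (t : ℤ) (s : Fin (m + 1) → ℤ) :
    ∫ ω, x t ω * ∏ i, x (s i) ω ∂P =
      ∑ i, covK P x t (s i) * ∫ ω, ∏ j, x (s (i.succAbove j)) ω ∂P := by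
  have hM := allMoments_of_gaussian hx
  set v : ℝ := covK P x t t with hv
  have hvnn : 0 ≤ v := integral_nonneg fun ω => mul_self_nonneg _
  -- In the degenerate case x t = 0 almost surely and both sides vanish; otherwise regression on x t
  -- is possible.
  rcases eq_or_lt_of_le hvnn with hv0 | hvpos
  · have hz : x t =ᵐ[P] 0 := by
      have := (integral_eq_zero_iff_of_nonneg (fun ω => mul_self_nonneg (x t ω))
        ((hM t).mul (hM t)).integrable).1 hv0.symm
      filter_upwards [this] with ω h using mul_self_eq_zero.1 h
    have h1 : ∫ ω, x t ω * ∏ i, x (s i) ω ∂P = 0 := by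
      rw [integral_eq_zero_of_ae]
      filter_upwards [hz] with ω h; simp [h]
    have h2 : ∀ i, covK P x t (s i) = 0 := fun i => by
      unfold covK
      rw [integral_eq_zero_of_ae]
      filter_upwards [hz] with ω h; simp [h]
    simp [h1, h2]
  -- Regression coefficients: the residuals R i are uncorrelated with x t, hence independent of it
  -- by joint Gaussianity. For fixed residuals the integrand is a product of affine functions of x
  -- t, to which the one-dimensional formula applies.
  set a : Fin (m + 1) → ℝ := fun i => covK P x t (s i) / v with ha
  set R : Fin (m + 1) → Ω → ℝ := fun i ω => x (s i) ω - a i * x t ω with hR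
  have hae : ∀ u, AEMeasurable (x u) P := fun u => hx.aemeasurable u
  have hRm : ∀ i, AEMeasurable (R i) P := fun i => (hae _).sub ((hae t).const_mul _)
  have hgauss : HasGaussianLaw (fun ω => ((fun _ : Unit => x t ω), fun i => R i ω)) P := by
    classical
    set I : Finset ℤ := insert t (Finset.univ.image s)
    have ht : t ∈ I := Finset.mem_insert_self _ _
    have hs : ∀ i, s i ∈ I := fun i =>
      Finset.mem_insert_of_mem (Finset.mem_image_of_mem _ (Finset.mem_univ _))
    let L : (I → ℝ) →L[ℝ] (Unit → ℝ) × (Fin (m + 1) → ℝ) :=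
      ContinuousLinearMap.prod
        (ContinuousLinearMap.pi fun _ => ContinuousLinearMap.proj ⟨t, ht⟩)
        (ContinuousLinearMap.pi fun i => ContinuousLinearMap.proj ⟨s i, hs i⟩ -
          a i • ContinuousLinearMap.proj (φ := fun _ : I => ℝ) ⟨t, ht⟩)
    exact (hx.hasGaussianLaw I).map L
  have hind : IndepFun (fun ω (_ : Unit) => x t ω) (fun ω i => R i ω) P := by
    refine hgauss.indepFun_of_covariance_eval (X := fun _ => x t) (Y := R) fun _ i => ?_
    have hRi : MemLp (R i) 2 P := (hM (s i)).memLp_two.sub ((hM t).memLp_two.const_mul _)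
    rw [covariance_eq_sub (hM t).memLp_two hRi, h0 t, zero_mul, sub_zero]
    simp only [Pi.mul_apply, hR, mul_sub]
    rw [integral_sub ((hM t).mul (hM (s i))).integrable
      ((hM t).mul ((hM t).const_mul _)).integrable]
    have : ∀ ω, x t ω * (a i * x t ω) = a i * (x t ω * x t ω) := fun ω => by ring
    simp only [this, integral_const_mul]
    change covK P x t (s i) - a i * v = 0
    rw [ha]; field_simp; ring
  have hind' : IndepFun (x t) (fun ω i => R i ω) P :=
    hind.comp (φ := fun f : Unit → ℝ => f ()) (ψ := id) (measurable_pi_apply _) measurable_id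
  set μ := P.map (fun ω i => R i ω) with hμ
  have hRm' : AEMeasurable (fun ω i => R i ω) P := aemeasurable_pi_lambda _ hRm
  have : IsProbabilityMeasure μ := Measure.isProbabilityMeasure_map hRm'
  have hlaw : P.map (x t) = gaussianReal 0 v.toNNReal := by
    rw [(hx.hasGaussianLaw_eval t).map_eq_gaussianReal, h0 t]
    congr 2
    rw [variance_eq_sub (hM t).memLp_two, h0 t]
    simp [hv, covK, pow_two]
  have hjoint : P.map (fun ω => (x t ω, fun i => R i ω)) =
      (gaussianReal 0 v.toNNReal).prod μ := by
    rw [(indepFun_iff_map_prod_eq_prod_map_map (hae t) hRm').1 hind', hlaw]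
  have hpair : AEMeasurable (fun ω => (x t ω, fun i => R i ω)) P := (hae t).prodMk hRm'
  have transfer : ∀ F : ℝ × (Fin (m + 1) → ℝ) → ℝ, Continuous F →
      Integrable (fun ω => F (x t ω, fun i => R i ω)) P →
      ∫ ω, F (x t ω, fun i => R i ω) ∂P = ∫ r, ∫ y, F (y, r) ∂(gaussianReal 0 v.toNNReal) ∂μ := by
    intro F hF hFi
    have hFm := hF.aestronglyMeasurable (μ := P.map (fun ω => (x t ω, fun i => R i ω)))
    rw [← integral_map hpair hFm, hjoint, integral_prod_symm]
    rw [← hjoint, integrable_map_measure hFm hpair]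
    exact hFi
  have hxs : ∀ i ω, x (s i) ω = R i ω + a i * x t ω := fun i ω => by simp [hR]
  have hv' : v.toNNReal ≠ 0 := by simpa using hvpos
  have t1 := transfer (fun p => p.1 * ∏ i, (p.2 i + a i * p.1)) (by fun_prop) (by
    simp only [← hxs]
    exact ((hM t).mul (AllMoments.prod fun i _ => hM (s i))).integrable)
  have t2 := transfer (fun p => ∑ i, a i * ∏ j, (p.2 (i.succAbove j) + a (i.succAbove j) * p.1))
    (by fun_prop) (by
    simp only [← hxs]
    exact (AllMoments.sum fun i _ => (AllMoments.prod fun j _ => hM _).const_mul _).integrable)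
  simp only [← hxs] at t1 t2
  rw [t1]
  simp only [integral_mul_prod_gaussianReal hv', integral_const_mul]
  rw [← t2, integral_finsetSum _ fun i _ =>
    ((AllMoments.prod fun j _ => hM (s (i.succAbove j))).const_mul (a i)).integrable, Finset.mul_sum]
  refine Finset.sum_congr rfl fun i _ => ?_
  rw [integral_const_mul, Real.coe_toNNReal _ hvnn, ← mul_assoc, ha]
  congr 1
  field_simp

variable [IsProbabilityMeasure P] (hx : IsGaussianProcess x P) (h0 : ∀ t, ∫ ω, x t ω ∂P = 0)

include hx h0

lemma integral_prod_succ {m : ℕ} (s : Fin (m + 2) → ℤ) :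
    ∫ ω, ∏ i, x (s i) ω ∂P =
      ∑ i : Fin (m + 1), covK P x (s 0) (s i.succ) * ∫ ω, ∏ j, x (s (i.succAbove j).succ) ω ∂P := by
  simp only [Fin.prod_univ_succ (n := m + 1)]
  exact integral_mul_prod hx h0 (s 0) fun i => s i.succ

lemma integral_prod_four (s : Fin 4 → ℤ) :
    ∫ ω, ∏ i, x (s i) ω ∂P = wick4 (covK P x) (s 0) (s 1) (s 2) (s 3) := by
  rw [integral_prod_succ hx h0, Fin.sum_univ_three]
  simp only [Fin.prod_univ_two]
  rfl

lemma integral_prod_six (s : Fin 6 → ℤ) :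
    ∫ ω, ∏ i, x (s i) ω ∂P =
      wick6 (covK P x) (s 0) (s 1) (s 2) (s 3) (s 4) (s 5) := by
  rw [integral_prod_succ hx h0, Fin.sum_univ_five]
  simp only [integral_prod_four hx h0]
  rfl

lemma integral_prod_eight (s : Fin 8 → ℤ) :
    ∫ ω, ∏ i, x (s i) ω ∂P =
      wick8 (covK P x) (s 0) (s 1) (s 2) (s 3) (s 4) (s 5) (s 6) (s 7) := by
  rw [integral_prod_succ hx h0, Fin.sum_univ_seven]
  simp only [integral_prod_six hx h0]
  rfl

lemma covariance_prod (s t : Fin 4 → ℤ) :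
    cov[fun ω => ∏ i, x (s i) ω, fun ω => ∏ i, x (t i) ω; P] = wickCov (covK P x) s t := by
  have hM := allMoments_of_gaussian hx
  rw [covariance_eq_sub (AllMoments.prod fun i _ => hM (s i)).memLp_two
    (AllMoments.prod fun i _ => hM (t i)).memLp_two, integral_prod_four hx h0,
    integral_prod_four hx h0, wickCov]
  congr 1
  have := integral_prod_eight hx h0 ![s 0, s 1, s 2, s 3, t 0, t 1, t 2, t 3]
  simp only [Pi.mul_apply]
  refine Eq.trans (integral_congr_ae (ae_of_all _ fun ω => ?_)) this
  simp [Fin.prod_univ_four, Fin.prod_univ_eight, mul_assoc]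

/-- The quartic statistic of a block. -/
def blockStat (χ : ℤ → ℝ) (m : ℤ) (N : ℕ) (y : ℤ → ℝ) : ℝ :=
  ∑ s ∈ box m N, χ (alt s) * ∏ i, y (s i)

omit h0 in
lemma allMoments_blockStat (χ : ℤ → ℝ) (m : ℤ) (N : ℕ) :
    AllMoments (fun ω => blockStat χ m N fun t => x t ω) P :=
  AllMoments.sum fun _ _ => (AllMoments.prod fun _ _ => allMoments_of_gaussian hx _).const_mul _

lemma covariance_blockStat (χ : ℤ → ℝ) (m m' : ℤ) (N : ℕ) :
    cov[fun ω => blockStat χ m N fun t => x t ω, fun ω => blockStat χ m' N fun t => x t ω; P] =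
      pairSum χ m m' N (wickCov (covK P x)) := by
  have hL : ∀ s : Fin 4 → ℤ, MemLp (fun ω => χ (alt s) * ∏ i, x (s i) ω) 2 P := fun s =>
    ((AllMoments.prod fun _ _ => allMoments_of_gaussian hx _).const_mul _).memLp_two
  unfold blockStat
  rw [covariance_fun_sum_fun_sum' (fun s _ => hL s) (fun s _ => hL s), pairSum_apply]
  refine Finset.sum_congr rfl fun s _ => Finset.sum_congr rfl fun t _ => ?_
  rw [covariance_const_mul_left, covariance_const_mul_right, covariance_prod hx h0]
  ring

lemma variance_sum_blockStat (χ : ℤ → ℝ) (N M : ℕ) :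
    Var[fun ω => ∑ j ∈ Finset.range M, blockStat χ (j * N) N fun t => x t ω; P] =
      ∑ j ∈ Finset.range M, ∑ j' ∈ Finset.range M,
        pairSum χ (j * N) (j' * N) N (wickCov (covK P x)) := by
  have hL : ∀ j : ℕ, MemLp (fun ω => blockStat χ (j * N) N fun t => x t ω) 2 P := fun j =>
    (allMoments_blockStat hx _ _ _).memLp_two
  rw [← covariance_self (AllMoments.sum fun j _ =>
    allMoments_blockStat hx _ _ _).memLp_two.aestronglyMeasurable.aemeasurable,
    covariance_fun_sum_fun_sum' (fun j _ => hL j) (fun j _ => hL j)]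
  exact Finset.sum_congr rfl fun j _ => Finset.sum_congr rfl fun j' _ =>
    covariance_blockStat hx h0 _ _ _ _

end Wick

/-! ### L² limits of Gaussian processes and the law of the sample. -/

section GaussianLimit

variable {Ω : Type*} [MeasurableSpace Ω] {P : Measure Ω}

lemma tendsto_integral_mul_of_tendsto_eLpNorm {f g : Ω → ℝ} {fn gn : ℕ → Ω → ℝ}
    (hf : MemLp f 2 P) (hg : MemLp g 2 P) (hfn : ∀ n, MemLp (fn n) 2 P)
    (hgn : ∀ n, MemLp (gn n) 2 P)
    (lf : Tendsto (fun n => eLpNorm (fun ω => f ω - fn n ω) 2 P) atTop (𝓝 0))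
    (lg : Tendsto (fun n => eLpNorm (fun ω => g ω - gn n ω) 2 P) atTop (𝓝 0)) :
    Tendsto (fun n => ∫ ω, fn n ω * gn n ω ∂P) atTop (𝓝 (∫ ω, f ω * g ω ∂P)) := by
  have conv : ∀ {h : Ω → ℝ} {hn : ℕ → Ω → ℝ} (mh : MemLp h 2 P) (mhn : ∀ n, MemLp (hn n) 2 P),
      Tendsto (fun n => eLpNorm (fun ω => h ω - hn n ω) 2 P) atTop (𝓝 0) →
      Tendsto (fun n => (mhn n).toLp) atTop (𝓝 mh.toLp) := fun mh mhn hl => by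
    rw [Lp.tendsto_Lp_iff_tendsto_eLpNorm'']
    refine hl.congr fun n => ?_
    rw [← eLpNorm_neg]
    congr 1; ext ω; simp
  have hin : ∀ {h k : Ω → ℝ} (mh : MemLp h 2 P) (mk : MemLp k 2 P),
      inner ℝ mh.toLp mk.toLp = ∫ ω, h ω * k ω ∂P := fun mh mk => by
    rw [L2.inner_def]
    refine integral_congr_ae ?_
    filter_upwards [mh.coeFn_toLp, mk.coeFn_toLp] with ω h1 h2
    simp [h1, h2, mul_comm]
  have := (conv hf hfn lf).inner (𝕜 := ℝ) (conv hg hgn lg)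
  simpa only [hin] using this

variable [IsProbabilityMeasure P]

lemma tendsto_integral_of_tendsto_eLpNorm {f : Ω → ℝ} {fn : ℕ → Ω → ℝ}
    (hf : MemLp f 2 P) (hfn : ∀ n, MemLp (fn n) 2 P)
    (lf : Tendsto (fun n => eLpNorm (fun ω => f ω - fn n ω) 2 P) atTop (𝓝 0)) :
    Tendsto (fun n => ∫ ω, fn n ω ∂P) atTop (𝓝 (∫ ω, f ω ∂P)) := by
  have := tendsto_integral_mul_of_tendsto_eLpNorm hf (memLp_const 1) hfn (fun _ => memLp_const 1)
    lf (gn := fun _ _ => 1) (by simp)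
  simpa using this

/-- An `L²`-limit of centred Gaussian variables is Gaussian. -/
lemma isGaussian_map_of_tendsto {Y : Ω → ℝ} {Yn : ℕ → Ω → ℝ} (hG : ∀ n, HasGaussianLaw (Yn n) P)
    (h0 : ∀ n, ∫ ω, Yn n ω ∂P = 0) (hY : MemLp Y 2 P)
    (lim : Tendsto (fun n => eLpNorm (fun ω => Y ω - Yn n ω) 2 P) atTop (𝓝 0)) :
    IsGaussian (P.map Y) := by
  have hYn : ∀ n, MemLp (Yn n) 2 P := fun n => (hG n).memLp_two
  set v : ℝ := ∫ ω, Y ω * Y ω ∂P with hv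
  have hv0 : 0 ≤ v := integral_nonneg fun ω => mul_self_nonneg _
  have hvn := tendsto_integral_mul_of_tendsto_eLpNorm hY hY hYn hYn lim lim
  have hmeas : AEMeasurable Y P := hY.aestronglyMeasurable.aemeasurable
  -- The characteristic functions have two limits that must agree: the Gaussian one, because the
  -- variances converge, and that of Y, because |e^{ia} - e^{ib}| ≤ |a - b| and L² convergence
  -- implies L¹ convergence.
  have hcf : ∀ t : ℝ, charFun (P.map Y) t = Complex.exp (-(v * t ^ 2 / 2 : ℝ)) := by
    intro t
    have e1 : ∀ n, charFun (P.map (Yn n)) t =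
        Complex.exp (-((∫ ω, Yn n ω * Yn n ω ∂P) * t ^ 2 / 2 : ℝ)) := fun n => by
      rw [(hG n).map_eq_gaussianReal, charFun_gaussianReal, h0 n, variance_eq_sub (hYn n), h0 n]
      have : 0 ≤ ∫ ω, Yn n ω * Yn n ω ∂P := integral_nonneg fun ω => mul_self_nonneg _
      simp only [Pi.pow_apply, pow_two, mul_zero, sub_zero, Real.coe_toNNReal _ this]
      push_cast; ring_nf
    have l1 : Tendsto (fun n => charFun (P.map (Yn n)) t) atTop
        (𝓝 (Complex.exp (-(v * t ^ 2 / 2 : ℝ)))) := by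
      simp only [e1]
      exact (Complex.continuous_exp.tendsto _).comp ((Complex.continuous_ofReal.tendsto _).comp
        ((hvn.mul_const (t ^ 2)).div_const 2)).neg
    refine tendsto_nhds_unique ?_ l1
    have habs : Tendsto (fun n => ∫ ω, |Y ω - Yn n ω| ∂P) atTop (𝓝 0) := by
      have := tendsto_integral_of_tendsto_eLpNorm (f := fun _ => 0)
        (fn := fun n ω => |Y ω - Yn n ω|) (memLp_const 0) (fun n => (hY.sub (hYn n)).abs)
        (lim.congr fun n => by
          simp only [zero_sub]
          exact eLpNorm_congr_norm_ae (ae_of_all _ fun ω => by simp))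
      simpa using this
    rw [tendsto_iff_norm_sub_tendsto_zero]
    refine squeeze_zero (fun _ => norm_nonneg _) (fun n => ?_)
      (by simpa using habs.const_mul |t|)
    have hm : ∀ {W : Ω → ℝ}, AEMeasurable W P →
        Integrable (fun ω => Complex.exp (t * W ω * Complex.I)) P := fun {W} hW => by
      refine Integrable.of_bound (C := 1) ?_ (ae_of_all _ fun ω => ?_)
      · exact (Complex.measurable_exp.comp_aemeasurable
          (((Complex.measurable_ofReal.comp_aemeasurable hW).const_mul _).mul_const _)
          ).aestronglyMeasurable
      · rw [← Complex.ofReal_mul, Complex.norm_exp_ofReal_mul_I]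
    have hmn := (hYn n).aestronglyMeasurable.aemeasurable
    rw [charFun_apply_real, charFun_apply_real, integral_map hmn (by fun_prop),
      integral_map hmeas (by fun_prop), ← integral_sub (hm hmn) (hm hmeas)]
    refine (norm_integral_le_integral_norm _).trans ?_
    rw [← integral_const_mul]
    refine integral_mono ((hm hmn).sub (hm hmeas)).norm
      (((hY.sub (hYn n)).integrable (by simp)).abs.const_mul _) fun ω => ?_
    have : Complex.exp (t * Yn n ω * Complex.I) - Complex.exp (t * Y ω * Complex.I) =
        Complex.exp ((t * Y ω : ℝ) * Complex.I) *
          (Complex.exp (Complex.I * (t * (Yn n ω - Y ω) : ℝ)) - 1) := by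
      rw [mul_sub, ← Complex.exp_add]; push_cast; ring_nf
    simp only [this, norm_mul, Complex.norm_exp_ofReal_mul_I, one_mul]
    refine (Real.norm_exp_I_mul_ofReal_sub_one_le).trans ?_
    rw [Real.norm_eq_abs, abs_mul, abs_sub_comm]
  have : P.map Y = gaussianReal 0 v.toNNReal := by
    have := Measure.isProbabilityMeasure_map hmeas
    refine Measure.ext_of_charFun ?_
    ext t
    rw [hcf t, charFun_gaussianReal, Real.coe_toNNReal _ hv0]
    congr 1; push_cast; ring
  rw [this]; infer_instance

lemma tendsto_eLpNorm_sum {ι : Type*} (s : Finset ι) (a : ι → ℝ) {Y : ι → Ω → ℝ}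
    {Yn : ℕ → ι → Ω → ℝ} (hY : ∀ i, MemLp (Y i) 2 P) (hYn : ∀ n i, MemLp (Yn n i) 2 P)
    (lim : ∀ i, Tendsto (fun n => eLpNorm (fun ω => Y i ω - Yn n i ω) 2 P) atTop (𝓝 0)) :
    Tendsto (fun n => eLpNorm (fun ω => ∑ i ∈ s, a i * Y i ω - ∑ i ∈ s, a i * Yn n i ω) 2 P)
      atTop (𝓝 0) := by
  have l : Tendsto (fun n => ∑ i ∈ s, ‖a i‖ₑ * eLpNorm (fun ω => Y i ω - Yn n i ω) 2 P) atTop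
      (𝓝 0) := by
    have := tendsto_finsetSum s fun i _ =>
      ENNReal.Tendsto.const_mul (a := ‖a i‖ₑ) (lim i) (Or.inr (by simp))
    simpa using this
  refine tendsto_of_tendsto_of_tendsto_of_le_of_le tendsto_const_nhds l (fun _ => bot_le)
    fun n => ?_
  have e : (fun ω => ∑ i ∈ s, a i * Y i ω - ∑ i ∈ s, a i * Yn n i ω) =
      ∑ i ∈ s, a i • fun ω => Y i ω - Yn n i ω := by
    ext ω; simp [Finset.sum_apply, ← Finset.sum_sub_distrib, mul_sub]
  simp only [e]
  refine (eLpNorm_sum_le (fun i _ =>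
    (((hY i).sub (hYn n i)).const_smul (a i)).aestronglyMeasurable) (by norm_num)).trans ?_
  refine Finset.sum_le_sum fun i _ => ?_
  rw [eLpNorm_const_smul]
  rfl

/-- Every linear functional of a finite-dimensional marginal is an L² limit of centred Gaussian
variables, and this characterises Gaussian vectors. -/
lemma isGaussianProcess_of_tendsto {S : Type*} {Y : S → Ω → ℝ} {Yn : ℕ → S → Ω → ℝ}
    (hG : ∀ n, IsGaussianProcess (Yn n) P) (h0 : ∀ n s, ∫ ω, Yn n s ω ∂P = 0)
    (hY : ∀ s, MemLp (Y s) 2 P)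
    (lim : ∀ s, Tendsto (fun n => eLpNorm (fun ω => Y s ω - Yn n s ω) 2 P) atTop (𝓝 0)) :
    IsGaussianProcess Y P := by
  refine ⟨fun I => ⟨isGaussian_of_isGaussian_map fun L => ?_⟩⟩
  classical
  have hYn : ∀ n s, MemLp (Yn n s) 2 P := fun n s => ((hG n).hasGaussianLaw_eval s).memLp_two
  set a : I → ℝ := fun i => L (Pi.single i 1) with ha
  have hL : ∀ y : I → ℝ, L y = ∑ i, a i * y i := fun y => by
    conv_lhs => rw [← Finset.univ_sum_single y, map_sum]
    refine Finset.sum_congr rfl fun i _ => ?_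
    have : Pi.single i (y i) = y i • (Pi.single i 1 : I → ℝ) := by
      rw [← Pi.single_smul]; simp
    rw [this, map_smul, smul_eq_mul, mul_comm]
  have hmeas : AEMeasurable (fun ω => I.restrict (Y · ω)) P :=
    aemeasurable_pi_lambda _ fun i => (hY i).aestronglyMeasurable.aemeasurable
  rw [AEMeasurable.map_map_of_aemeasurable L.continuous.measurable.aemeasurable hmeas]
  refine isGaussian_map_of_tendsto (Yn := fun n => L ∘ fun ω => I.restrict (Yn n · ω))
    (fun n => ((hG n).hasGaussianLaw I).map L) (fun n => ?_) ?_ ?_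
  · simp only [Function.comp_apply, hL, Finset.restrict]
    rw [integral_finsetSum _ fun (i : I) _ => ((hYn n i).integrable (by simp)).const_mul (a i)]
    simp [integral_const_mul, h0]
  · have : (L ∘ fun ω => I.restrict (Y · ω)) = fun ω => ∑ i, a i * Y i ω := by
      ext ω; simp [hL]
    rw [this]
    exact memLp_finsetSum _ fun i _ => (hY i).const_mul _
  · have := tendsto_eLpNorm_sum Finset.univ a (Y := fun i : I => Y i)
      (Yn := fun n (i : I) => Yn n i) (fun i => hY i) (fun n i => hYn n i) (fun i => lim i)
    refine this.congr fun n => ?_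
    simp [hL]

end GaussianLimit

section SampleLaw

variable {Ω : Type*} [MeasurableSpace Ω] {P : Measure Ω} [IsProbabilityMeasure P]
  {X : ℕ → ℤ → Ω → ℝ} {Z : ℤ → Ω → ℝ} {ψT : ℕ → ℤ → ℕ → ℝ} {ψ : ℕ → ℝ → ℝ} {d a : ℝ → ℝ}

lemma isGaussianProcess_innovations (hX : IsLocallyStationary P X Z ψT ψ d a) :
    IsGaussianProcess Z P where
  hasGaussianLaw I := by
    have h1 : ∀ i : I, HasGaussianLaw (Z i) P := fun i => (hX.gauss i).hasGaussianLaw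
    exact iIndepFun.hasGaussianLaw h1 (hX.indep.precomp Subtype.val_injective)

lemma integral_innovation (hX : IsLocallyStationary P X Z ψT ψ d a) (t : ℤ) :
    ∫ ω, Z t ω ∂P = 0 := by
  rw [(hX.gauss t).integral_eq]; simp

lemma integral_innovation_mul (hX : IsLocallyStationary P X Z ψT ψ d a) (s t : ℤ) :
    ∫ ω, Z s ω * Z t ω ∂P = if s = t then 1 else 0 := by
  have hZ := isGaussianProcess_innovations hX
  split_ifs with h
  · subst h
    have := (hX.gauss s).variance_eq
    rw [variance_eq_sub (hZ.hasGaussianLaw_eval s).memLp_two, integral_innovation hX] at this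
    simpa [pow_two] using this
  · have := (hX.indep.indepFun h).integral_fun_mul_eq_mul_integral
      (hZ.aemeasurable s).aestronglyMeasurable (hZ.aemeasurable t).aestronglyMeasurable
    rw [this, integral_innovation hX, zero_mul]

/-- The shifted sample `x(t) = X_{t+1,T}`, extended by zero. -/
def sample (X : ℕ → ℤ → Ω → ℝ) (T : ℕ) (t : ℤ) (ω : Ω) : ℝ := zeroExt X T ω (t + 1)

/-- The `n`-th partial sum approximating `sample`. -/
def samplePart (Z : ℤ → Ω → ℝ) (ψT : ℕ → ℤ → ℕ → ℝ) (T n : ℕ) (t : ℤ) (ω : Ω) : ℝ :=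
  if 1 ≤ t + 1 ∧ t + 1 ≤ T then ∑ l ∈ Finset.range n, ψT T (t + 1) l * Z (t + 1 - l) ω else 0

lemma isGaussianProcess_samplePart (hX : IsLocallyStationary P X Z ψT ψ d a) (T n : ℕ) :
    IsGaussianProcess (samplePart Z ψT T n) P := by
  refine IsGaussianProcess.of_isGaussianProcess (isGaussianProcess_innovations hX) fun t => ?_
  refine ⟨(Finset.range n).image fun l : ℕ => t + 1 - l,
    if 1 ≤ t + 1 ∧ t + 1 ≤ T then
      ∑ l : Finset.range n, ψT T (t + 1) l • ContinuousLinearMap.proj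
        (φ := fun _ : ((Finset.range n).image fun l : ℕ => t + 1 - l) => ℝ)
        ⟨t + 1 - l, Finset.mem_image_of_mem _ l.2⟩
    else 0, fun ω => ?_⟩
  unfold samplePart
  split_ifs
  · simp only [sum_apply, smul_apply,
      ContinuousLinearMap.proj_apply, Finset.restrict, smul_eq_mul]
    rw [← Finset.sum_coe_sort]
  · simp

lemma integral_samplePart (hX : IsLocallyStationary P X Z ψT ψ d a) (T n : ℕ) (t : ℤ) :
    ∫ ω, samplePart Z ψT T n t ω ∂P = 0 := by
  have hZ := isGaussianProcess_innovations hX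
  unfold samplePart
  split_ifs
  · rw [integral_finsetSum _ fun l _ => (hZ.hasGaussianLaw_eval _).integrable.const_mul _]
    simp [integral_const_mul, integral_innovation hX]
  · simp

lemma tendsto_samplePart (hX : IsLocallyStationary P X Z ψT ψ d a) (T : ℕ) (t : ℤ) :
    Tendsto (fun n => eLpNorm (fun ω => sample X T t ω - samplePart Z ψT T n t ω) 2 P)
      atTop (𝓝 0) := by
  unfold sample samplePart zeroExt
  split_ifs with h
  · exact hX.repr T (t + 1) h.1 h.2
  · simp

/-- Convergence to 0 makes the L² distance to some partial sum finite, and that partial sum is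
square integrable. -/
lemma memLp_sample (hX : IsLocallyStationary P X Z ψT ψ d a) (T : ℕ) (t : ℤ) :
    MemLp (sample X T t) 2 P := by
  have hm : AEStronglyMeasurable (sample X T t) P := by
    unfold sample zeroExt
    split_ifs with h
    · exact (hX.meas T (t + 1) h.1 h.2).aestronglyMeasurable
    · exact aestronglyMeasurable_const
  have hp : ∀ n, MemLp (samplePart Z ψT T n t) 2 P := fun n =>
    ((isGaussianProcess_samplePart hX T n).hasGaussianLaw_eval t).memLp_two
  obtain ⟨n, hn⟩ := ((tendsto_samplePart hX T t).eventually
    (gt_mem_nhds ENNReal.zero_lt_top)).exists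
  have : MemLp (fun ω => sample X T t ω - samplePart Z ψT T n t ω) 2 P :=
    ⟨hm.sub (hp n).aestronglyMeasurable, hn⟩
  exact (this.add (hp n)).ae_eq (ae_of_all _ fun ω => by simp)

lemma isGaussianProcess_sample (hX : IsLocallyStationary P X Z ψT ψ d a) (T : ℕ) :
    IsGaussianProcess (sample X T) P :=
  isGaussianProcess_of_tendsto (fun n => isGaussianProcess_samplePart hX T n)
    (fun n t => integral_samplePart hX T n t) (memLp_sample hX T) (tendsto_samplePart hX T)

lemma integral_sample (hX : IsLocallyStationary P X Z ψT ψ d a) (T : ℕ) (t : ℤ) :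
    ∫ ω, sample X T t ω ∂P = 0 := by
  have := tendsto_integral_of_tendsto_eLpNorm (memLp_sample hX T t)
    (fun n => ((isGaussianProcess_samplePart hX T n).hasGaussianLaw_eval t).memLp_two)
    (tendsto_samplePart hX T t)
  simp only [integral_samplePart hX] at this
  exact tendsto_nhds_unique this tendsto_const_nhds

lemma tendsto_covK_sample (hX : IsLocallyStationary P X Z ψT ψ d a) (T : ℕ) (s t : ℤ) :
    Tendsto (fun n => ∫ ω, samplePart Z ψT T n s ω * samplePart Z ψT T n t ω ∂P) atTop
      (𝓝 (covK P (sample X T) s t)) :=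
  tendsto_integral_mul_of_tendsto_eLpNorm (memLp_sample hX T s) (memLp_sample hX T t)
    (fun n => ((isGaussianProcess_samplePart hX T n).hasGaussianLaw_eval s).memLp_two)
    (fun n => ((isGaussianProcess_samplePart hX T n).hasGaussianLaw_eval t).memLp_two)
    (tendsto_samplePart hX T s) (tendsto_samplePart hX T t)

end SampleLaw

/-! ### Decay, increments and regularity in u of the coefficients. -/

lemma one_le_idx (l : ℕ) : 1 ≤ idx l := by
  unfold idx
  split_ifs with h
  · exact le_rfl
  · exact_mod_cast Nat.one_le_iff_ne_zero.2 h

lemma one_add_le_two_mul_idx (l : ℕ) : 1 + (l : ℝ) ≤ 2 * idx l := by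
  unfold idx
  split_ifs with h
  · simp [h]
  · have : (1 : ℝ) ≤ l := by exact_mod_cast Nat.one_le_iff_ne_zero.2 h
    linarith

lemma inv_idx_rpow_le {p q : ℝ} (hp : 0 ≤ p) (hp2 : p ≤ 2) (hpq : p ≤ q) (l : ℕ) :
    1 / idx l ^ q ≤ 4 * kf p l := by
  have h1 := one_le_idx l
  have h0 : (0 : ℝ) < 1 + l := by positivity
  have h2 : ((1 + (l : ℝ)) / 2) ^ p ≤ idx l ^ q := by
    calc ((1 + (l : ℝ)) / 2) ^ p ≤ idx l ^ p :=
          Real.rpow_le_rpow (by positivity) (by linarith [one_add_le_two_mul_idx l]) hp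
      _ ≤ _ := Real.rpow_le_rpow_of_exponent_le h1 hpq
  have h3 : (2 : ℝ) ^ p ≤ 4 := by
    calc (2 : ℝ) ^ p ≤ 2 ^ (2 : ℝ) := Real.rpow_le_rpow_of_exponent_le (by norm_num) hp2
      _ = 4 := by norm_num
  calc 1 / idx l ^ q ≤ 1 / ((1 + (l : ℝ)) / 2) ^ p := by gcongr
    _ = 2 ^ p * kf p l := by
        rw [Real.div_rpow h0.le (by norm_num), kf_natCast, Real.rpow_neg h0.le]; field_simp
    _ ≤ _ := by have := kf_nonneg p l; gcongr

/-- The asymptotic expansion holds only for large l; the finitely many remaining indices are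
absorbed by adding the ratios of their bounds to the weights. -/
lemma exists_bound_of_eventually {w : ℕ → ℝ} (hw : ∀ l, 0 < w l) {f : ℕ → ℝ → ℝ}
    (hf : ∀ l, ∃ B, ∀ u ∈ Icc (0 : ℝ) 1, |f l u| ≤ B) {C : ℝ}
    (hev : ∀ᶠ l : ℕ in atTop, ∀ u ∈ Icc (0 : ℝ) 1, |f l u| ≤ C * w l) :
    ∃ C' : ℝ, 0 ≤ C' ∧ ∀ l, ∀ u ∈ Icc (0 : ℝ) 1, |f l u| ≤ C' * w l := by
  obtain ⟨n, hn⟩ := eventually_atTop.1 hev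
  choose B hB using hf
  refine ⟨|C| + ∑ l ∈ Finset.range n, |B l| / w l, add_nonneg (abs_nonneg _)
    (Finset.sum_nonneg fun l _ => div_nonneg (abs_nonneg _) (hw l).le), fun l u hu => ?_⟩
  have hs : 0 ≤ ∑ l ∈ Finset.range n, |B l| / w l :=
    Finset.sum_nonneg fun l _ => div_nonneg (abs_nonneg _) (hw l).le
  rcases le_or_gt n l with h | h
  · refine (hn l h u hu).trans (mul_le_mul_of_nonneg_right ?_ (hw l).le)
    linarith [le_abs_self C]
  · have h1 : |B l| / w l ≤ ∑ l ∈ Finset.range n, |B l| / w l :=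
      Finset.single_le_sum (f := fun l => |B l| / w l)
        (fun l _ => div_nonneg (abs_nonneg _) (hw l).le) (Finset.mem_range.2 h)
    calc |f l u| ≤ |B l| := (hB l u hu).trans (le_abs_self _)
      _ = |B l| / w l * w l := by rw [div_mul_cancel₀ _ (hw l).ne']
      _ ≤ _ := mul_le_mul_of_nonneg_right (by linarith [abs_nonneg C]) (hw l).le

section Coeff

variable {Ω : Type*} [MeasurableSpace Ω] {P : Measure Ω}
  {X : ℕ → ℤ → Ω → ℝ} {Z : ℤ → Ω → ℝ} {ψT : ℕ → ℤ → ℕ → ℝ} {ψ : ℕ → ℝ → ℝ} {d a : ℝ → ℝ}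

lemma le_dSup (hX : IsLocallyStationary P X Z ψT ψ d a) {u : ℝ} (hu : u ∈ Icc (0 : ℝ) 1) :
    d u ≤ dSup d :=
  le_csSup (isCompact_Icc.image_of_continuousOn hX.d_diff.1.continuousOn).bddAbove
    (mem_image_of_mem _ hu)

lemma dSup_nonneg (hX : IsLocallyStationary P X Z ψT ψ d a) : 0 ≤ dSup d :=
  (hX.d_nonneg 0 (by simp)).trans (le_dSup hX (by simp))

lemma exists_a_bound (hX : IsLocallyStationary P X Z ψT ψ d a) :
    ∃ A : ℝ, 0 ≤ A ∧ ∀ u ∈ Icc (0 : ℝ) 1, |a u| ≤ A := by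
  obtain ⟨A, hA⟩ := isCompact_Icc.exists_bound_of_continuousOn hX.a_diff.1.continuousOn
  exact ⟨|A|, abs_nonneg _, fun u hu => (hA u hu).trans (le_abs_self _)⟩

lemma exists_psi_bounded (hX : IsLocallyStationary P X Z ψT ψ d a) (l : ℕ) :
    ∃ B, ∀ u ∈ Icc (0 : ℝ) 1, |ψ l u| ≤ B :=
  isCompact_Icc.exists_bound_of_continuousOn (hX.psi_smooth l).continuousOn

variable {e : ℝ}

lemma exists_psi_bound (hX : IsLocallyStationary P X Z ψT ψ d a) (he0 : 0 < e)
    (he : e < 1 - dSup d) :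
    ∃ C : ℝ, 0 ≤ C ∧ ∀ l, ∀ u ∈ Icc (0 : ℝ) 1, |ψ l u| ≤ C * kf e l := by
  obtain ⟨A, hA0, hA⟩ := exists_a_bound hX
  obtain ⟨C, hC⟩ := hX.psi_asymp
  have hd0 := dSup_nonneg hX
  refine exists_bound_of_eventually (C := (A + |C|) * 4) (fun l => kf_pos e l)
    (exists_psi_bounded hX) ?_
  filter_upwards [hC] with l hl u hu
  have h1 := hl u hu
  have h2 := inv_idx_rpow_le he0.le (by linarith) (by linarith [le_dSup hX hu] : e ≤ 1 - d u) l
  have h3 := inv_idx_rpow_le he0.le (by linarith) (by linarith : e ≤ 2 - dSup d) l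
  have hi := one_le_idx l
  calc |ψ l u| ≤ |a u / idx l ^ (1 - d u)| + |ψ l u - a u / idx l ^ (1 - d u)| := by
        have := abs_add_le (a u / idx l ^ (1 - d u)) (ψ l u - a u / idx l ^ (1 - d u))
        rwa [add_sub_cancel] at this
    _ ≤ A * (4 * kf e l) + |C| * (4 * kf e l) := by
        refine add_le_add ?_ (h1.trans ?_)
        · rw [abs_div, abs_of_nonneg (by positivity : 0 ≤ idx l ^ (1 - d u)), ← mul_one_div]
          exact mul_le_mul (hA u hu) h2 (by positivity) hA0
        · rw [← mul_one_div]
          exact mul_le_mul (le_abs_self _) h3 (by positivity) (abs_nonneg _)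
    _ = _ := by ring

lemma rpow_sub_succ_le {p : ℝ} (hp : 0 ≤ p) (hp1 : p ≤ 1) {l : ℕ} (hl : l ≠ 0) :
    |1 / idx l ^ p - 1 / idx (l + 1) ^ p| ≤ 1 / idx l ^ (p + 1) := by
  have h0 : (0 : ℝ) < l := by exact_mod_cast Nat.pos_of_ne_zero hl
  have e1 : idx l = l := by simp [idx, hl]
  have e2 : idx (l + 1) = (l : ℝ) + 1 := by simp [idx]
  rw [e1, e2]
  have h1 : 0 < (l : ℝ) ^ p := by positivity
  have h2 : (l : ℝ) / (l + 1) ≤ ((l : ℝ) / (l + 1)) ^ p := by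
    conv_lhs => rw [← Real.rpow_one ((l : ℝ) / (l + 1))]
    exact Real.rpow_le_rpow_of_exponent_ge (by positivity)
      (by rw [div_le_one (by positivity)]; linarith) hp1
  rw [Real.div_rpow h0.le (by positivity)] at h2
  have h3 : (l : ℝ) ^ p ≤ ((l : ℝ) + 1) ^ p := Real.rpow_le_rpow h0.le (by linarith) hp
  rw [abs_of_nonneg (sub_nonneg.2 (by gcongr)), Real.rpow_add h0, Real.rpow_one]
  calc 1 / (l : ℝ) ^ p - 1 / ((l : ℝ) + 1) ^ p
      = (1 / (l : ℝ) ^ p) * (1 - (l : ℝ) ^ p / ((l : ℝ) + 1) ^ p) := by field_simp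
    _ ≤ (1 / (l : ℝ) ^ p) * (1 - l / (l + 1)) := by gcongr
    _ = (1 / (l : ℝ) ^ p) * (1 / (l + 1)) := by field_simp; ring
    _ ≤ (1 / (l : ℝ) ^ p) * (1 / l) := by gcongr; linarith
    _ = _ := by field_simp

/-- The increments of I(l)^(-(1-d(u))) are O(l^(-(2-d(u)))), which is no worse than the order 2 -
d_∞ of the remainder. This is what makes Abel summation of the transfer function work. -/
lemma exists_psi_variation (hX : IsLocallyStationary P X Z ψT ψ d a)
    (he0 : 0 < e) (he : e < 1 - dSup d) :
    ∃ C : ℝ, 0 ≤ C ∧ ∀ l, ∀ u ∈ Icc (0 : ℝ) 1, |ψ (l + 1) u - ψ l u| ≤ C * kf (1 + e) l := by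
  obtain ⟨A, hA0, hA⟩ := exists_a_bound hX
  obtain ⟨C, hC⟩ := hX.psi_asymp
  have hd0 := dSup_nonneg hX
  refine exists_bound_of_eventually (f := fun l u => ψ (l + 1) u - ψ l u)
    (C := (A + 2 * |C|) * 4) (fun l => kf_pos (1 + e) l) (fun l => ?_) ?_
  · obtain ⟨B, hB⟩ := exists_psi_bounded hX l
    obtain ⟨B', hB'⟩ := exists_psi_bounded hX (l + 1)
    exact ⟨B' + B, fun u hu => (abs_sub _ _).trans (add_le_add (hB' u hu) (hB u hu))⟩
  filter_upwards [hC, (tendsto_add_atTop_nat 1).eventually hC, eventually_ne_atTop 0]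
    with l hl hl1 hl0 u hu
  have h1 := hl u hu
  have h1' := hl1 u hu
  have h2 := inv_idx_rpow_le (by linarith) (by linarith)
    (by linarith [le_dSup hX hu] : 1 + e ≤ 1 - d u + 1) l
  have h3 := inv_idx_rpow_le (by linarith) (by linarith) (by linarith : 1 + e ≤ 2 - dSup d) l
  have h3' := inv_idx_rpow_le (by linarith) (by linarith) (by linarith : 1 + e ≤ 2 - dSup d) (l + 1)
  have h4 : kf (1 + e) (l + 1 : ℕ) ≤ kf (1 + e) l :=
    kf_anti (by linarith) (by rw [Nat.abs_cast, Nat.abs_cast]; exact_mod_cast Nat.le_succ l)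
  have hm := rpow_sub_succ_le (p := 1 - d u) (by linarith [le_dSup hX hu])
    (by linarith [hX.d_nonneg u hu]) hl0
  have hi := one_le_idx l
  have hi' := one_le_idx (l + 1)
  have b1 : |ψ l u - a u / idx l ^ (1 - d u)| ≤ |C| * (4 * kf (1 + e) l) := by
    refine h1.trans ?_
    rw [← mul_one_div]
    exact mul_le_mul (le_abs_self _) h3 (by positivity) (abs_nonneg _)
  have b2 : |ψ (l + 1) u - a u / idx (l + 1) ^ (1 - d u)| ≤ |C| * (4 * kf (1 + e) l) := by
    refine h1'.trans ?_
    rw [← mul_one_div]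
    exact mul_le_mul (le_abs_self _) (h3'.trans (by linarith)) (by positivity) (abs_nonneg _)
  have b3 : |a u / idx l ^ (1 - d u) - a u / idx (l + 1) ^ (1 - d u)| ≤ A * (4 * kf (1 + e) l) := by
    rw [← mul_one_div, ← mul_one_div (a u), ← mul_sub, abs_mul]
    exact mul_le_mul (hA u hu) (hm.trans h2) (abs_nonneg _) hA0
  rw [abs_le] at *
  constructor <;> linarith [b1.1, b1.2, b2.1, b2.2, b3.1, b3.2]

/-- Mean value theorem. The gap ε = 1 - d_∞ - e absorbs the logarithm through log l ≤ l^ε/ε. The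
derivative bound does not cover l = 0, where continuity of the derivative on [0,1] is used. -/
lemma exists_psi_lipschitz (hX : IsLocallyStationary P X Z ψT ψ d a)
    (he0 : 0 < e) (he : e < 1 - dSup d) :
    ∃ C : ℝ, 0 ≤ C ∧ ∀ l, ∀ u ∈ Icc (0 : ℝ) 1, ∀ v ∈ Icc (0 : ℝ) 1,
      |ψ l u - ψ l v| ≤ C * kf e l * |u - v| := by
  obtain ⟨C, hC⟩ := hX.psi_deriv
  have hd0 := dSup_nonneg hX
  set ε := 1 - dSup d - e with hε
  have hε0 : 0 < ε := by rw [hε]; linarith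
  have hdiff : ∀ l, ∀ u ∈ Ioo (0 : ℝ) 1, DifferentiableAt ℝ (ψ l) u := fun l u hu =>
    ((hX.psi_smooth l).contDiffAt (Icc_mem_nhds hu.1 hu.2)).differentiableAt (by norm_num)
  have hder : ∃ C' : ℝ, 0 ≤ C' ∧ ∀ l, ∀ u ∈ Ioo (0 : ℝ) 1, |deriv (ψ l) u| ≤ C' * kf e l := by
    have hcont : ContinuousOn (derivWithin (ψ 0) (Icc 0 1)) (Icc 0 1) :=
      (hX.psi_smooth 0).continuousOn_derivWithin (uniqueDiffOn_Icc one_pos) (by norm_num)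
    obtain ⟨B, hB⟩ := isCompact_Icc.exists_bound_of_continuousOn hcont
    refine ⟨|B| + |C| * (1 + 1 / ε) * 4, by positivity, fun l u hu => ?_⟩
    have hk := kf_nonneg e l
    rcases eq_or_ne l 0 with rfl | hl
    · have h1 := hB u ⟨hu.1.le, hu.2.le⟩
      rw [derivWithin_of_mem_nhds (Icc_mem_nhds hu.1 hu.2), Real.norm_eq_abs] at h1
      rw [Nat.cast_zero, kf_zero, mul_one]
      have : 0 ≤ |C| * (1 + 1 / ε) * 4 := by positivity
      linarith [le_abs_self B]
    · have h1 := hC l hl u hu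
      have hl1 : (1 : ℝ) ≤ l := by exact_mod_cast Nat.one_le_iff_ne_zero.2 hl
      have hlog := Real.log_le_rpow_div (by linarith : (0 : ℝ) ≤ l) hε0
      have hlp : 1 ≤ (l : ℝ) ^ ε := Real.one_le_rpow hl1 hε0.le
      have hidx : idx l = l := by simp [idx, hl]
      have h2 := inv_idx_rpow_le he0.le (by linarith) le_rfl l
      rw [hidx] at h2
      have hlog0 := Real.log_nonneg hl1
      calc |deriv (ψ l) u| ≤ C * (1 + Real.log l) / (l : ℝ) ^ (1 - dSup d) := h1
        _ ≤ |C| * ((1 + 1 / ε) * (l : ℝ) ^ ε) / (l : ℝ) ^ (1 - dSup d) := by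
            gcongr
            · exact le_abs_self C
            · rw [add_mul, one_mul, div_mul_eq_mul_div, one_mul]; linarith
        _ = |C| * (1 + 1 / ε) * (1 / (l : ℝ) ^ e) := by
            have : (l : ℝ) ^ (1 - dSup d) = (l : ℝ) ^ ε * (l : ℝ) ^ e := by
              rw [← Real.rpow_add (by linarith)]; congr 1; rw [hε]; ring
            rw [this]; field_simp
        _ ≤ |C| * (1 + 1 / ε) * (4 * kf e l) := by gcongr
        _ ≤ _ := by nlinarith [abs_nonneg B]
  obtain ⟨C', hC0, hC'⟩ := hder
  have main : ∀ l, ∀ u ∈ Icc (0 : ℝ) 1, ∀ v ∈ Icc (0 : ℝ) 1, u < v →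
      |ψ l u - ψ l v| ≤ C' * kf e l * |u - v| := fun l u hu v hv huv => by
    have hsub : Ioo u v ⊆ Ioo 0 1 := Ioo_subset_Ioo hu.1 hv.2
    obtain ⟨c, hc, hcd⟩ := exists_deriv_eq_slope (ψ l) huv
      ((hX.psi_smooth l).continuousOn.mono (Icc_subset_Icc hu.1 hv.2))
      (fun x hx => (hdiff l x (hsub hx)).differentiableWithinAt)
    have h1 := hC' l c (hsub hc)
    rw [hcd, abs_div, div_le_iff₀ (abs_pos.2 (by linarith))] at h1
    rwa [abs_sub_comm, abs_sub_comm u]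
  refine ⟨C', hC0, fun l u hu v hv => ?_⟩
  rcases lt_trichotomy u v with h | h | h
  · exact main l u hu v hv h
  · simp [h]
  · rw [abs_sub_comm, abs_sub_comm u]; exact main l v hv u hu h

lemma exists_psiT_approx (hX : IsLocallyStationary P X Z ψT ψ d a)
    (he0 : 0 < e) (he : e < 1 - dSup d) :
    ∃ C : ℝ, 0 ≤ C ∧ ∀ T : ℕ, ∀ t : ℤ, 1 ≤ t → t ≤ T → ∀ v ∈ Icc (0 : ℝ) 1, ∀ l,
      |ψT T t l - ψ l v| ≤ C * (1 / T + |(t : ℝ) / T - v|) * kf e l := by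
  obtain ⟨C1, h1, H1⟩ := exists_psi_lipschitz hX he0 he
  obtain ⟨C2, H2⟩ := hX.approx
  have hd0 := dSup_nonneg hX
  refine ⟨C1 + |C2| * 4, by positivity, fun T t ht htT v hv l => ?_⟩
  have hk := kf_nonneg e l
  have ht' : (1 : ℝ) ≤ t := by exact_mod_cast ht
  have htT' : (t : ℝ) ≤ T := by exact_mod_cast htT
  have hT : (0 : ℝ) < T := by linarith
  have hu : (t : ℝ) / T ∈ Icc (0 : ℝ) 1 := ⟨by positivity, by rwa [div_le_one hT]⟩
  have h2 := inv_idx_rpow_le he0.le (by linarith) he.le l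
  have hi := one_le_idx l
  have a1 : |ψT T t l - ψ l ((t : ℝ) / T)| ≤ |C2| * (1 / T) * (4 * kf e l) := by
    refine (H2 T t ht htT l).trans ?_
    calc C2 / (T * idx l ^ (1 - dSup d)) = C2 * (1 / T) * (1 / idx l ^ (1 - dSup d)) := by
          field_simp
      _ ≤ _ := by gcongr; exact le_abs_self _
  refine (abs_sub_le _ _ _).trans ((add_le_add a1 (H1 l _ hu v hv)).trans ?_)
  have p1 : 0 ≤ C1 * (1 / (T : ℝ)) * kf e l := by positivity
  have p2 : 0 ≤ |C2| * 4 * |(t : ℝ) / T - v| * kf e l := by positivity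
  nlinarith

end Coeff

/-! ### Covariances of the sample and of the approximating stationary processes. -/

/-- `∑_{l, l' < n, l - l' = h} p(l) q(l')`. -/
def lagSum (n : ℕ) (p q : ℕ → ℝ) (h : ℤ) : ℝ :=
  ∑ l ∈ Finset.range n, ∑ l' ∈ Finset.range n, if (l : ℤ) - l' = h then p l * q l' else 0

lemma lagSum_sub (n : ℕ) (p q p' q' : ℕ → ℝ) (h : ℤ) :
    lagSum n p q h - lagSum n p' q' h =
      lagSum n (fun l => p l - p' l) q h + lagSum n p' (fun l => q l - q' l) h := by
  simp only [lagSum, ← Finset.sum_sub_distrib, ← Finset.sum_add_distrib]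
  refine Finset.sum_congr rfl fun l _ => Finset.sum_congr rfl fun l' _ => ?_
  split_ifs <;> ring

/-- For given h and l' at most one l contributes, so this is the convolution of two kernels of
exponent e, of exponent 2e - 1. -/
lemma exists_lagSum_bound {e : ℝ} (he : 1 / 2 < e) (he1 : e < 1) : ∃ C : ℝ, 0 ≤ C ∧
    ∀ (n : ℕ) (p q : ℕ → ℝ) (A B : ℝ) (h : ℤ), (∀ l, |p l| ≤ A * kf e l) →
      (∀ l, |q l| ≤ B * kf e l) → |lagSum n p q h| ≤ C * (A * B) * kf (2 * e - 1) h := by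
  obtain ⟨C, hC, H⟩ := exists_conv (a := e) (b := e) (by linarith) he1 (by linarith) he1
    (by linarith)
  refine ⟨C, hC, fun n p q A B h hp hq => ?_⟩
  have hA : 0 ≤ A := by simpa [kf_zero] using (abs_nonneg _).trans (hp 0)
  have hB : 0 ≤ B := by simpa [kf_zero] using (abs_nonneg _).trans (hq 0)
  calc |lagSum n p q h|
      ≤ ∑ l' ∈ Finset.range n, ∑ l ∈ Finset.range n,
          if (l : ℤ) = h + l' then A * kf e (h + l') * (B * kf e l') else 0 := by
        unfold lagSum
        rw [Finset.sum_comm]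
        refine (Finset.abs_sum_le_sum_abs _ _).trans (Finset.sum_le_sum fun l' _ =>
          (Finset.abs_sum_le_sum_abs _ _).trans (Finset.sum_le_sum fun l _ => ?_))
        by_cases hl : (l : ℤ) - l' = h
        · have hl2 : (l : ℤ) = h + l' := by linarith
          rw [if_pos hl, if_pos hl2, abs_mul, ← hl2]
          exact mul_le_mul (hp l) (hq l') (abs_nonneg _) (mul_nonneg hA (kf_nonneg _ _))
        · rw [if_neg hl, if_neg fun h2 => hl (by linarith), abs_zero]
    _ ≤ ∑ l' ∈ Finset.range n, A * kf e (h + l') * (B * kf e l') := by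
        refine Finset.sum_le_sum fun l' _ => ?_
        have h0 : 0 ≤ A * kf e (h + l') * (B * kf e l') :=
          mul_nonneg (mul_nonneg hA (kf_nonneg _ _)) (mul_nonneg hB (kf_nonneg _ _))
        rw [← Finset.sum_filter, Finset.sum_const, nsmul_eq_mul]
        refine mul_le_of_le_one_left h0 ?_
        have : ((Finset.range n).filter fun l : ℕ => (l : ℤ) = h + l').card ≤ 1 := by
          refine Finset.card_le_one.2 fun x hx y hy => ?_
          have hx := (Finset.mem_filter.1 hx).2
          have hy := (Finset.mem_filter.1 hy).2
          omega
        exact_mod_cast this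
    _ ≤ A * B * (C * kf (2 * e - 1) h) := by
        have h2 : ∑ l' ∈ Finset.range n, A * kf e (h + l') * (B * kf e l') =
            A * B * ∑ l' ∈ Finset.range n, kf e (-h - l') * kf e (l' - 0) := by
          rw [Finset.mul_sum]
          refine Finset.sum_congr rfl fun l' _ => ?_
          rw [← kf_neg e (h + l'), neg_add', sub_zero]; ring
        have hconv' := H ((Finset.range n).image (Nat.cast : ℕ → ℤ)) (-h) 0
        rw [Finset.sum_image (fun _ _ _ _ h => by exact_mod_cast h), sub_zero, kf_neg,
          show e + e - 1 = 2 * e - 1 by ring] at hconv'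
        rw [h2]
        exact mul_le_mul_of_nonneg_left hconv' (mul_nonneg hA hB)
    _ = _ := by ring

lemma lagSum_self (n : ℕ) (p : ℕ → ℝ) (h : ℤ) :
    lagSum n p p h = ∑ l ∈ Finset.range (n - h.natAbs), p l * p (l + h.natAbs) := by
  have key : ∀ k : ℕ, ∑ l ∈ Finset.range n, ∑ l' ∈ Finset.range n,
      (if (l : ℤ) - l' = k then p l * p l' else 0) =
        ∑ l ∈ Finset.range (n - k), p l * p (l + k) := fun k => by
    rw [Finset.sum_comm]
    have : ∀ l' ∈ Finset.range n, ∑ l ∈ Finset.range n,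
        (if (l : ℤ) - l' = k then p l * p l' else 0) =
        if l' < n - k then p l' * p (l' + k) else 0 := fun l' _ => by
      have e1 : ∀ l : ℕ, (if (l : ℤ) - l' = k then p l * p l' else 0) =
          if l = l' + k then p l' * p (l' + k) else 0 := fun l => by
        by_cases hl : l = l' + k
        · rw [if_pos hl, if_pos (by rw [hl]; push_cast; ring), hl, mul_comm]
        · rw [if_neg hl, if_neg (by omega)]
      simp only [e1, Finset.sum_ite_eq', Finset.mem_range]
      congr 1; apply propext; omega
    rw [Finset.sum_congr rfl this, ← Finset.sum_filter]
    refine Finset.sum_congr ?_ fun _ _ => rfl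
    ext l; simp only [Finset.mem_filter, Finset.mem_range]; omega
  unfold lagSum
  rcases Int.natAbs_eq h with hh | hh
  · conv_lhs => rw [hh]
    exact key _
  · rw [← key, Finset.sum_comm]
    refine Finset.sum_congr rfl fun l _ => Finset.sum_congr rfl fun l' _ => ?_
    rw [mul_comm (p l')]
    congr 1; apply propext; omega

/-- Autocovariances of the stationary process with coefficients `p`. -/
def acov (p : ℕ → ℝ) (h : ℤ) : ℝ := ∑' l, p l * p (l + h.natAbs)

lemma acov_neg (p : ℕ → ℝ) (h : ℤ) : acov p (-h) = acov p h := by simp [acov]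

section

variable {e C : ℝ} {p q : ℕ → ℝ}

lemma summable_kf {e : ℝ} (he : 1 < e) : Summable fun l : ℕ => kf e l := by
  have := (summable_nat_add_iff 1).2 (Real.summable_nat_rpow.2 (by linarith : -e < -1))
  refine this.congr fun l => ?_
  rw [kf_natCast]; push_cast; rw [add_comm]

lemma summable_mul_shift (he : 1 / 2 < e) (hp : ∀ l, |p l| ≤ C * kf e l) (k : ℕ) :
    Summable fun l => p l * p (l + k) := by
  have hC : 0 ≤ C := by simpa [kf_zero] using (abs_nonneg _).trans (hp 0)
  refine Summable.of_norm_bounded ((summable_kf (by linarith : 1 < e + e)).mul_left (C * C))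
    fun l => ?_
  rw [Real.norm_eq_abs, abs_mul, ← kf_mul]
  have h1 : kf e (l + k : ℕ) ≤ kf e l := kf_anti (by linarith)
    (by rw [Nat.abs_cast, Nat.abs_cast]; exact_mod_cast Nat.le_add_right l k)
  calc |p l| * |p (l + k)| ≤ (C * kf e l) * (C * kf e l) :=
        mul_le_mul (hp l) ((hp _).trans (mul_le_mul_of_nonneg_left h1 hC)) (abs_nonneg _)
          (mul_nonneg hC (kf_nonneg _ _))
    _ = _ := by ring

lemma tendsto_lagSum (he : 1 / 2 < e) (hp : ∀ l, |p l| ≤ C * kf e l) (h : ℤ) :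
    Tendsto (fun n => lagSum n p p h) atTop (𝓝 (acov p h)) := by
  simp only [lagSum_self]
  exact (summable_mul_shift he hp h.natAbs).hasSum.tendsto_sum_nat.comp
    (tendsto_sub_atTop_nat h.natAbs)

end

section

variable {Ω : Type*} [MeasurableSpace Ω] {P : Measure Ω} [IsProbabilityMeasure P]
  {X : ℕ → ℤ → Ω → ℝ} {Z : ℤ → Ω → ℝ} {ψT : ℕ → ℤ → ℕ → ℝ} {ψ : ℕ → ℝ → ℝ} {d a : ℝ → ℝ}

lemma integral_samplePart_mul (hX : IsLocallyStationary P X Z ψT ψ d a) (T n : ℕ) (s t : ℤ) :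
    ∫ ω, samplePart Z ψT T n s ω * samplePart Z ψT T n t ω ∂P =
      if (1 ≤ s + 1 ∧ s + 1 ≤ T) ∧ (1 ≤ t + 1 ∧ t + 1 ≤ T) then
        lagSum n (ψT T (s + 1)) (ψT T (t + 1)) (s - t) else 0 := by
  have hZ := isGaussianProcess_innovations hX
  by_cases hs : 1 ≤ s + 1 ∧ s + 1 ≤ (T : ℤ)
  swap; · simp only [samplePart, hs, if_false, zero_mul, false_and, integral_zero]
  by_cases ht : 1 ≤ t + 1 ∧ t + 1 ≤ (T : ℤ)
  swap; · simp only [samplePart, ht, if_false, mul_zero, and_false, integral_zero]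
  rw [if_pos ⟨hs, ht⟩]
  simp only [samplePart, if_pos hs, if_pos ht, Finset.sum_mul_sum]
  have hint : ∀ l l' : ℕ, Integrable (fun ω => ψT T (s + 1) l * Z (s + 1 - l) ω *
      (ψT T (t + 1) l' * Z (t + 1 - l') ω)) P := fun l l' =>
    ((((allMoments_of_gaussian hZ _).const_mul _).mul
      ((allMoments_of_gaussian hZ _).const_mul _))).integrable
  rw [integral_finsetSum _ fun l _ => integrable_finsetSum _ fun l' _ => hint l l']
  unfold lagSum
  refine Finset.sum_congr rfl fun l _ => ?_
  rw [integral_finsetSum _ fun l' _ => hint l l']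
  refine Finset.sum_congr rfl fun l' _ => ?_
  have e1 : ∀ ω, ψT T (s + 1) l * Z (s + 1 - l) ω * (ψT T (t + 1) l' * Z (t + 1 - l') ω) =
      (ψT T (s + 1) l * ψT T (t + 1) l') * (Z (s + 1 - l) ω * Z (t + 1 - l') ω) := fun ω => by ring
  simp only [e1, integral_const_mul, integral_innovation_mul hX, mul_ite, mul_one, mul_zero]
  congr 1; apply propext; constructor <;> intro h <;> linarith

variable {e : ℝ}

/-- For partial sums the covariance is a `lagSum`, because the innovations are orthonormal. Bounds
uniform in n, and bilinearity for the comparison with a stationary process, pass to the limit. -/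
lemma exists_covK_bound (he : 1 / 2 < e) (he1 : e < 1) : ∃ C : ℝ, 0 ≤ C ∧
    ∀ {Ω : Type*} [MeasurableSpace Ω] {P : Measure Ω} [IsProbabilityMeasure P]
      {X : ℕ → ℤ → Ω → ℝ} {Z : ℤ → Ω → ℝ} {ψT : ℕ → ℤ → ℕ → ℝ} {ψ : ℕ → ℝ → ℝ} {d a : ℝ → ℝ}
      (_ : IsLocallyStationary P X Z ψT ψ d a) (T : ℕ) (A : ℝ)
      (_ : ∀ t : ℤ, 1 ≤ t → t ≤ T → ∀ l, |ψT T t l| ≤ A * kf e l) (s t : ℤ),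
      |covK P (sample X T) s t| ≤ C * A ^ 2 * kf (2 * e - 1) (t - s) ∧
      ∀ (p : ℕ → ℝ) (B η : ℝ), (∀ l, |p l| ≤ B * kf e l) → 0 ≤ A →
        (1 ≤ s + 1 ∧ s + 1 ≤ T) → (1 ≤ t + 1 ∧ t + 1 ≤ T) →
        (∀ l, |ψT T (s + 1) l - p l| ≤ η * kf e l) → (∀ l, |ψT T (t + 1) l - p l| ≤ η * kf e l) →
        |covK P (sample X T) s t - acov p (t - s)| ≤ η * (C * (A + B) * kf (2 * e - 1) (t - s)) := by
  obtain ⟨C, hC, H⟩ := exists_lagSum_bound he he1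
  refine ⟨C, hC, fun hX T A hA s t => ⟨?_, fun p B η hp hA0 hs ht h1 h2 => ?_⟩⟩
  · refine le_of_tendsto (tendsto_covK_sample hX T s t).abs (Eventually.of_forall fun n => ?_)
    rw [integral_samplePart_mul hX]
    split_ifs with h
    · refine (H n _ _ A A _ (hA _ h.1.1 h.1.2) (hA _ h.2.1 h.2.2)).trans (le_of_eq ?_)
      rw [kf_sub_comm]; ring
    · rw [abs_zero]
      exact mul_nonneg (mul_nonneg hC (sq_nonneg _)) (kf_nonneg _ _)
  · have hlim := (tendsto_covK_sample hX T s t).sub (tendsto_lagSum he hp (s - t))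
    rw [← acov_neg p (t - s), neg_sub]
    refine le_of_tendsto hlim.abs (Eventually.of_forall fun n => ?_)
    rw [integral_samplePart_mul hX, if_pos ⟨hs, ht⟩, lagSum_sub]
    refine (abs_add_le _ _).trans ((add_le_add (H n _ _ η A _ h1 (hA _ ht.1 ht.2))
      (H n _ _ B η _ hp h2)).trans (le_of_eq ?_))
    rw [kf_sub_comm]; ring

/-- The difference bound is what makes the autocovariances Lipschitz in u later on. -/
lemma exists_acov_bound (he : 1 / 2 < e) (he1 : e < 1) : ∃ C : ℝ, 0 ≤ C ∧
    ∀ (p q : ℕ → ℝ) (A η : ℝ) (h : ℤ), (∀ l, |p l| ≤ A * kf e l) → (∀ l, |q l| ≤ A * kf e l) →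
      |acov p h| ≤ C * A ^ 2 * kf (2 * e - 1) h ∧
      ((∀ l, |p l - q l| ≤ η * kf e l) →
        |acov p h - acov q h| ≤ C * (2 * A) * η * kf (2 * e - 1) h) := by
  obtain ⟨C, hC, H⟩ := exists_lagSum_bound he he1
  refine ⟨C, hC, fun p q A η h hp hq => ⟨?_, fun hpq => ?_⟩⟩
  · refine le_of_tendsto (tendsto_lagSum he hp h).abs (Eventually.of_forall fun n => ?_)
    exact (H n p p A A h hp hp).trans (le_of_eq (by ring))
  · refine le_of_tendsto ((tendsto_lagSum he hp h).sub (tendsto_lagSum he hq h)).abs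
      (Eventually.of_forall fun n => ?_)
    rw [lagSum_sub]
    refine (abs_add_le _ _).trans ((add_le_add (H n _ _ η A _ hpq hp) (H n _ _ A η _ hq hpq)).trans
      (le_of_eq (by ring)))

end

/-! ### The statistics as quartic forms. -/

/-- Expanding z z̄ z z̄ gives phases of alternating sign, whence alt; taking real parts turns the
exponentials into cosines. -/
lemma norm_sum_pow_four (A : Finset ℤ) (y : ℤ → ℝ) (x : ℝ) :
    ‖∑ h ∈ A, (y h : ℂ) * Complex.exp (-Complex.I * (x : ℂ) * (h : ℂ))‖ ^ 4 =
      ∑ s ∈ Fintype.piFinset fun _ : Fin 4 => A, (∏ i, y (s i)) * Real.cos (x * alt s) := by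
  set z := ∑ h ∈ A, (y h : ℂ) * Complex.exp (-Complex.I * (x : ℂ) * (h : ℂ)) with hz
  set f : Fin 4 → ℤ → ℂ := fun i h =>
    (y h : ℂ) * Complex.exp ((-1) ^ (i.1 + 1) * Complex.I * (x : ℂ) * (h : ℂ)) with hf
  have hzc : (starRingEnd ℂ) z = ∑ h ∈ A, (y h : ℂ) * Complex.exp (Complex.I * (x : ℂ) * (h : ℂ)) := by
    rw [hz, map_sum]
    refine Finset.sum_congr rfl fun h _ => ?_
    rw [map_mul, Complex.conj_ofReal, ← Complex.exp_conj]
    simp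
  have h1 : ((‖z‖ ^ 4 : ℝ) : ℂ) = ∏ i, ∑ h ∈ A, f i h := by
    have : ((‖z‖ ^ 4 : ℝ) : ℂ) = z * (starRingEnd ℂ) z * (z * (starRingEnd ℂ) z) := by
      rw [Complex.mul_conj, Complex.normSq_eq_norm_sq]; push_cast; ring
    rw [this, hzc, Fin.prod_univ_four]
    simp only [hf, hz]
    simp only [Fin.coe_ofNat_eq_mod]
    norm_num
    ring
  rw [Finset.prod_univ_sum] at h1
  have h2 := congrArg Complex.re h1
  rw [Complex.ofReal_re, Complex.re_sum] at h2
  rw [h2]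
  refine Finset.sum_congr rfl fun s _ => ?_
  have h3 : ∏ i, f i (s i) = ((∏ i, y (s i) : ℝ) : ℂ) *
      Complex.exp (((-(x * alt s) : ℝ) : ℂ) * Complex.I) := by
    simp only [hf, Finset.prod_mul_distrib, ← Complex.exp_sum, Complex.ofReal_prod]
    congr 2
    rw [Fin.sum_univ_four]
    simp only [Fin.coe_ofNat_eq_mod, alt]
    push_cast
    norm_num
    ring
  rw [h3, Complex.re_ofReal_mul, Complex.exp_ofReal_mul_I_re, Real.cos_neg]

lemma periodogram_sq (y : ℤ → ℝ) (m : ℤ) (N : ℕ) (x : ℝ) :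
    periodogram y m N x ^ 2 = (1 / (2 * π * N)) ^ 2 *
      ∑ s ∈ box m N, (∏ i, y (s i)) * Real.cos (x * alt s) := by
  unfold box
  rw [← norm_sum_pow_four, periodogram, mul_pow, ← pow_mul]
  congr 2
  have h1 : ∑ h ∈ blk m N, (y h : ℂ) * Complex.exp (-Complex.I * (x : ℂ) * (h : ℂ)) =
      Complex.exp (((-(x * m) : ℝ) : ℂ) * Complex.I) * ∑ s ∈ Finset.range N, (y (m + s) : ℂ) *
        Complex.exp (-Complex.I * (x : ℂ) * (s : ℂ)) := by
    have hb : blk m N = (Finset.range N).image fun s : ℕ => m + (s : ℤ) := by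
      ext h
      simp only [mem_blk, Finset.mem_image, Finset.mem_range]
      constructor
      · rintro ⟨h1, h2⟩; exact ⟨(h - m).toNat, by omega, by omega⟩
      · rintro ⟨s, hs, rfl⟩; omega
    rw [hb, Finset.sum_image (fun _ _ _ _ h => by simpa using h), Finset.mul_sum]
    refine Finset.sum_congr rfl fun s _ => ?_
    rw [mul_left_comm, ← Complex.exp_add]
    congr 2
    push_cast; ring
  rw [h1, norm_mul, Complex.norm_exp_ofReal_mul_I, one_mul]

lemma integral_cos_mul_int (k : ℤ) :
    ∫ x in (-π)..π, Real.cos (x * k) = 2 * π * selZero k := by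
  unfold selZero
  split_ifs with h
  · simp [h]; ring
  · have hk : (k : ℝ) ≠ 0 := by exact_mod_cast h
    rw [intervalIntegral.integral_comp_mul_right (fun x => Real.cos x) hk, integral_cos]
    have : Real.sin (-π * k) = 0 := by rw [neg_mul, mul_comm, Real.sin_neg, Real.sin_int_mul_pi, neg_zero]
    rw [this, mul_comm π, Real.sin_int_mul_pi]; simp

lemma integral_periodogram_sq (y : ℤ → ℝ) (m : ℤ) (N : ℕ) :
    ∫ x in (-π)..π, periodogram y m N x ^ 2 =
      1 / (2 * π * (N : ℝ) ^ 2) * blockStat selZero m N y := by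
  simp only [periodogram_sq]
  rw [intervalIntegral.integral_const_mul, intervalIntegral.integral_finsetSum]
  · simp only [intervalIntegral.integral_const_mul, integral_cos_mul_int, blockStat,
      Finset.mul_sum]
    refine Finset.sum_congr rfl fun s _ => ?_
    rcases eq_or_ne (N : ℝ) 0 with h | h
    · simp [h]
    · have := Real.pi_ne_zero
      field_simp
  · intro s _
    exact (Continuous.intervalIntegrable (by fun_prop) _ _)

lemma sum_Icc_one_eq (M : ℕ) (f : ℕ → ℝ) :
    ∑ j ∈ Finset.Icc 1 M, f j = ∑ j ∈ Finset.range M, f (j + 1) := by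
  induction M with
  | zero => simp
  | succ n ih => rw [Finset.sum_Icc_succ_top (by omega), ih, Finset.sum_range_succ]

/-- `cos(2πka/N)`. -/
def cosF (N : ℕ) (a : ℤ) (k : ℕ) : ℝ := Real.cos (fourierFreq N k * a)

/-- Real part of a geometric sum over powers of an N-th root of unity. -/
lemma sum_range_cosF {N : ℕ} (hN : 0 < N) (a : ℤ) :
    ∑ k ∈ Finset.range N, cosF N a k = N * selDvd N a := by
  have hN' : (N : ℂ) ≠ 0 := by exact_mod_cast hN.ne'
  set z := Complex.exp (2 * π * Complex.I * a / N) with hz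
  have hzk : ∀ k : ℕ, cosF N a k = (z ^ k).re := fun k => by
    rw [hz, ← Complex.exp_nat_mul, cosF, fourierFreq]
    rw [← Complex.exp_ofReal_mul_I_re]
    congr 2
    push_cast; field_simp
  simp only [hzk, ← Complex.re_sum]
  unfold selDvd
  split_ifs with h
  · obtain ⟨c, rfl⟩ := h
    have : z = 1 := by
      rw [hz, Complex.exp_eq_one_iff]
      exact ⟨c, by push_cast; field_simp⟩
    simp [this]
  · have hne : z ≠ 1 := fun h1 => by
      rw [hz, Complex.exp_eq_one_iff] at h1
      obtain ⟨c, hc⟩ := h1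
      apply h
      have h2 := Complex.two_pi_I_ne_zero
      have : (a : ℂ) = N * c := by
        field_simp at hc
        have h3 : (2 * π * Complex.I) * (a : ℂ) = (2 * π * Complex.I) * (N * c) := by
          linear_combination (2 * π * Complex.I) * hc
        exact mul_left_cancel₀ h2 h3
      exact ⟨c, by exact_mod_cast this⟩
    have hzN : z ^ N = 1 := by
      rw [hz, ← Complex.exp_nat_mul, Complex.exp_eq_one_iff]
      exact ⟨a, by field_simp⟩
    rw [geom_sum_eq hne, hzN, sub_self, zero_div, Complex.zero_re, mul_zero]

lemma cosF_zero (N : ℕ) (a : ℤ) : cosF N a 0 = 1 := by simp [cosF, fourierFreq]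

lemma cosF_self {N : ℕ} (hN : 0 < N) (a : ℤ) : cosF N a N = 1 := by
  have : (N : ℝ) ≠ 0 := by exact_mod_cast hN.ne'
  rw [cosF, fourierFreq, mul_div_assoc, div_self this, mul_one, mul_comm]
  exact Real.cos_int_mul_two_pi a

lemma sum_Icc_cosF {N : ℕ} (hN : 0 < N) (a : ℤ) :
    ∑ k ∈ Finset.Icc 1 N, cosF N a k = N * selDvd N a := by
  have h1 := Finset.sum_range_succ' (cosF N a) N
  rw [Finset.sum_range_succ, cosF_zero, cosF_self hN] at h1
  rw [sum_Icc_one_eq, ← sum_range_cosF hN a]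
  linarith

/-- The weight by which the half sum of cosines deviates from the full one. -/
def rhoW (a : ℤ) : ℝ := Real.cos (π * a) - 1

lemma rhoW_neg (a : ℤ) : rhoW (-a) = rhoW a := by simp [rhoW]

lemma abs_rhoW_le (a : ℤ) : |rhoW a| ≤ 2 := by
  unfold rhoW
  rw [abs_le]
  constructor <;> linarith [Real.neg_one_le_cos (π * a), Real.cos_le_one (π * a)]

/-- By the reflection k ↦ N - k the full sum is twice the half sum, except that k = 0 and k = N/2
have no partner; their values 1 and cos(πa) produce `rhoW`. -/
lemma sum_Icc_half_cosF {N : ℕ} (hN : 0 < N) (hE : Even N) (a : ℤ) :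
    ∑ k ∈ Finset.Icc 1 (N / 2), cosF N a k = 1 / 2 * (N * selDvd N a + rhoW a) := by
  obtain ⟨n, rfl⟩ := hE
  have hn : (n : ℝ) ≠ 0 := by
    have : 0 < n := by omega
    exact_mod_cast this.ne'
  have h2 : (n + n) / 2 = n := by omega
  have href : ∀ k ≤ n, cosF (n + n) a (n + k) = cosF (n + n) a (n - k) := fun k hk => by
    unfold cosF fourierFreq
    push_cast [hk]
    have : 2 * π * ((n : ℝ) + k) / (n + n) * a = a * (2 * π) - 2 * π * (n - k) / (n + n) * a := by
      field_simp; ring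
    rw [this, Real.cos_int_mul_two_pi_sub]
  have hmid : cosF (n + n) a n = rhoW a + 1 := by
    unfold cosF fourierFreq rhoW
    rw [sub_add_cancel]; congr 1; push_cast; field_simp; ring
  have hs := sum_range_cosF hN a
  rw [Finset.sum_range_add] at hs
  have e1 : ∑ k ∈ Finset.range n, cosF (n + n) a (n + k) =
      ∑ k ∈ Finset.range n, cosF (n + n) a (k + 1) := by
    rw [← Finset.sum_range_reflect]
    refine Finset.sum_congr rfl fun k hk => ?_
    rw [Finset.mem_range] at hk
    rw [href _ (by omega)]
    congr 1; omega
  have e2 := Finset.sum_range_succ' (cosF (n + n) a) n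
  rw [Finset.sum_range_succ, cosF_zero, hmid] at e2
  rw [h2, sum_Icc_one_eq]
  rw [e1] at hs
  linarith

section

variable {Ω : Type*} (X : ℕ → ℤ → Ω → ℝ)

/-- For even N the point u_{j+1}T is the integer jN + N/2, so the window starts at time jN + 1,
which is index jN of the shifted `sample`. The blocks therefore tile {0, …, T-1} exactly. -/
lemma localPeriodogram_midpoint {T N M : ℕ} (hN : 0 < N) (hE : Even N) (hM : 0 < M) (hT : T = N * M)
    (j : ℕ) (x : ℝ) (ω : Ω) :
    localPeriodogram X T N (midpoint T N (j + 1)) x ω =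
      periodogram (fun t => sample X T t ω) (j * N) N x := by
  have hT0 : (T : ℝ) ≠ 0 := by
    have : 0 < T := hT ▸ Nat.mul_pos hN hM
    exact_mod_cast this.ne'
  obtain ⟨n, rfl⟩ := hE
  have h2 : (n + n) / 2 = n := by omega
  have hfl : ⌊midpoint T (n + n) (j + 1) * T⌋ = (j * (n + n : ℕ) + n : ℤ) := by
    have : midpoint T (n + n) (j + 1) * T = ((j * (n + n : ℕ) + n : ℤ) : ℝ) := by
      unfold midpoint; rw [div_mul_cancel₀ _ hT0]; push_cast; ring
    rw [this, Int.floor_intCast]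
  rw [localPeriodogram, hfl, h2, add_sub_cancel_right, periodogram, periodogram]
  congr 3
  refine Finset.sum_congr rfl fun s _ => ?_
  rw [sample]
  congr 3
  ring

lemma fullPeriodogram_eq (T : ℕ) (x : ℝ) (ω : Ω) :
    fullPeriodogram X T x ω = periodogram (fun t => sample X T t ω) (((0 : ℕ) : ℤ) * T) T x := by
  rw [fullPeriodogram, periodogram, periodogram]
  congr 3
  refine Finset.sum_congr rfl fun s _ => ?_
  rw [sample]
  congr 3
  push_cast; ring

lemma FTilde_eq {T N M : ℕ} (hN : 0 < N) (hE : Even N) (hM : 0 < M) (hT : T = N * M) :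
    FTilde X T N M = fun ω => 1 / (8 * π ^ 2 * M * (N : ℝ) ^ 2) *
      ∑ j ∈ Finset.range M, blockStat selZero (j * N) N fun t => sample X T t ω := by
  ext ω
  rw [FTilde, sum_Icc_one_eq]
  simp only [localPeriodogram_midpoint X hN hE hM hT, integral_periodogram_sq]
  rw [← Finset.mul_sum]
  have : (N : ℝ) ≠ 0 := by exact_mod_cast hN.ne'
  have : (M : ℝ) ≠ 0 := by exact_mod_cast hM.ne'
  have := Real.pi_ne_zero
  field_simp; ring

lemma sum_periodogram_sq (y : ℤ → ℝ) (m : ℤ) (N : ℕ) (A : Finset ℕ) (χ : ℤ → ℝ) (r : ℝ)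
    (h : ∀ a : ℤ, ∑ k ∈ A, cosF N a k = r * χ a) :
    ∑ k ∈ A, periodogram y m N (fourierFreq N k) ^ 2 =
      (1 / (2 * π * N)) ^ 2 * r * blockStat χ m N y := by
  simp only [periodogram_sq]
  rw [← Finset.mul_sum, Finset.sum_comm, mul_assoc _ r]
  congr 1
  rw [blockStat, Finset.mul_sum]
  refine Finset.sum_congr rfl fun s _ => ?_
  rw [← Finset.mul_sum]
  have := h (alt s)
  unfold cosF at this
  rw [this]; ring

/-- The second sum carries the extra factor 1/N, which makes it negligible. -/
lemma FHat_eq {T N M : ℕ} (hN : 0 < N) (hE : Even N) (hM : 0 < M) (hT : T = N * M) :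
    FHat X T N M = fun ω => 1 / (8 * π ^ 2 * M * (N : ℝ) ^ 2) *
      ∑ j ∈ Finset.range M, blockStat (selDvd N) (j * N) N (fun t => sample X T t ω) +
      1 / (8 * π ^ 2 * M * (N : ℝ) ^ 3) *
      ∑ j ∈ Finset.range M, blockStat rhoW (j * N) N (fun t => sample X T t ω) := by
  ext ω
  rw [FHat, sum_Icc_one_eq]
  simp only [localPeriodogram_midpoint X hN hE hM hT]
  simp only [sum_periodogram_sq _ _ N _ _ (1 / 2) (sum_Icc_half_cosF hN hE)]
  have e : ∀ j : ℕ, blockStat (fun a => N * selDvd N a + rhoW a) (j * N) N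
      (fun t => sample X T t ω) = N * blockStat (selDvd N) (j * N) N (fun t => sample X T t ω) +
        blockStat rhoW (j * N) N (fun t => sample X T t ω) := fun j => by
    simp only [blockStat, Finset.mul_sum, ← Finset.sum_add_distrib]
    exact Finset.sum_congr rfl fun s _ => by ring
  simp only [e]
  rw [← Finset.mul_sum, Finset.sum_add_distrib, ← Finset.mul_sum]
  have : (N : ℝ) ≠ 0 := by exact_mod_cast hN.ne'
  have : (M : ℝ) ≠ 0 := by exact_mod_cast hM.ne'
  have := Real.pi_ne_zero
  subst hT
  push_cast
  field_simp; ring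

lemma GInt_eq (T : ℕ) :
    GInt X T = fun ω => 1 / (2 * π * (T : ℝ) ^ 2) *
      ∑ j ∈ Finset.range 1, blockStat selZero (j * T) T fun t => sample X T t ω := by
  ext ω
  rw [GInt]
  simp only [fullPeriodogram_eq, integral_periodogram_sq, Finset.sum_range_one]

lemma GSum_eq {T : ℕ} (hT : 0 < T) :
    GSum X T = fun ω => 1 / (2 * π * (T : ℝ) ^ 2) *
      ∑ j ∈ Finset.range 1, blockStat (selDvd T) (j * T) T fun t => sample X T t ω := by
  ext ω
  rw [GSum]
  simp only [fullPeriodogram_eq, sum_periodogram_sq _ _ T _ _ T (sum_Icc_cosF hT),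
    Finset.sum_range_one]
  have : (T : ℝ) ≠ 0 := by exact_mod_cast hT.ne'
  have := Real.pi_ne_zero
  field_simp

end

/-! ### The transfer function near the origin and Parseval's identity for its eighth power. -/

/-- Partial sums of the transfer function. -/
def transfer (p : ℕ → ℝ) (n : ℕ) (x : ℝ) : ℂ :=
  ∑ l ∈ Finset.range n, (p l : ℂ) * Complex.exp (-Complex.I * (x : ℂ) * (l : ℂ))

/-- `f(x) = (2π)⁻¹ |∑ p_l e^{-ixl}|²`. -/
def sDens (p : ℕ → ℝ) (x : ℝ) : ℝ :=
  1 / (2 * π) * ‖limUnder atTop fun n => transfer p n x‖ ^ 2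

lemma specDensity_eq (ψ : ℕ → ℝ → ℝ) (u x : ℝ) :
    specDensity ψ u x = sDens (fun l => ψ l u) x := rfl

lemma summation_by_parts (p : ℕ → ℝ) (z : ℂ) {m n : ℕ} (hmn : m ≤ n) :
    (1 - z) * ∑ l ∈ Finset.Ico m n, (p l : ℂ) * z ^ l =
      p m * z ^ m - p n * z ^ n + ∑ l ∈ Finset.Ico m n, ((p (l + 1) - p l : ℝ) : ℂ) * z ^ (l + 1) := by
  induction n, hmn using Nat.le_induction with
  | base => simp
  | succ n hn ih =>
    rw [Finset.sum_Ico_succ_top hn, Finset.sum_Ico_succ_top hn, mul_add, ih]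
    push_cast; ring

lemma sum_Ico_kf_le {e : ℝ} (he : 0 < e) (he1 : e ≤ 1) {m n : ℕ} (hmn : m ≤ n) :
    ∑ l ∈ Finset.Ico m n, kf (1 + e) l ≤ 4 / e * (kf e m - kf e n) := by
  induction n, hmn using Nat.le_induction with
  | base => simp
  | succ n hn ih =>
    rw [Finset.sum_Ico_succ_top hn]
    have := kf_le_telescope (p := 1 + e) (by linarith) (by linarith) n
    rw [add_sub_cancel_left] at this
    push_cast at this ⊢
    linarith

/-- |1 - e^{-ix}| = 2|sin(x/2)| together with Jordan's inequality. -/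
lemma norm_one_sub_exp_ge {x : ℝ} (hx : |x| ≤ π) :
    2 / π * |x| ≤ ‖1 - Complex.exp (-Complex.I * (x : ℂ))‖ := by
  have h1 : ‖1 - Complex.exp (-Complex.I * (x : ℂ))‖ = ‖Complex.exp (Complex.I * (-x : ℝ)) - 1‖ := by
    rw [norm_sub_rev]; congr 3; push_cast; ring
  rw [h1, Complex.norm_exp_I_mul_ofReal_sub_one, norm_mul, Real.norm_eq_abs, Real.norm_eq_abs,
    abs_of_pos (by norm_num : (0 : ℝ) < 2), neg_div, Real.sin_neg, abs_neg]
  have h2 : |Real.sin (x / 2)| = Real.sin |x / 2| := by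
    refine Real.abs_sin_eq_sin_abs_of_abs_le_pi ?_
    rw [abs_div, abs_two]; linarith [Real.pi_pos, abs_nonneg x]
  have h3 : |x / 2| = |x| / 2 := by rw [abs_div, abs_two]
  have h4 := Real.mul_le_sin (x := |x| / 2) (by positivity) (by linarith)
  rw [h2, h3]
  calc 2 / π * |x| = 2 * (2 / π * (|x| / 2)) := by ring
    _ ≤ _ := by linarith

section

variable {e C : ℝ} {p : ℕ → ℝ}

/-- Abel summation: multiplication by 1 - z leaves boundary terms and a sum of increments, all of
order m^(-e), and |1 - z| is bounded below by a multiple of |x|. -/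
lemma norm_transfer_sub_le (he : 0 < e) (he1 : e < 1) (hp : ∀ l, |p l| ≤ C * kf e l)
    (hv : ∀ l, |p (l + 1) - p l| ≤ C * kf (1 + e) l) {x : ℝ} (hx0 : x ≠ 0) (hx : |x| ≤ π)
    {m n : ℕ} (hmn : m ≤ n) :
    ‖transfer p n x - transfer p m x‖ ≤ C * (2 + 4 / e) * (π / 2) * kf e m / |x| := by
  have hC : 0 ≤ C := by simpa [kf_zero] using (abs_nonneg _).trans (hp 0)
  set z := Complex.exp (-Complex.I * (x : ℂ)) with hz
  have hzn : ‖z‖ = 1 := by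
    rw [hz, show -Complex.I * (x : ℂ) = ((-x : ℝ) : ℂ) * Complex.I by push_cast; ring,
      Complex.norm_exp_ofReal_mul_I]
  have hzl : ∀ l : ℕ, Complex.exp (-Complex.I * (x : ℂ) * (l : ℂ)) = z ^ l := fun l => by
    rw [hz, ← Complex.exp_nat_mul]; congr 1; ring
  have h1 : transfer p n x - transfer p m x = ∑ l ∈ Finset.Ico m n, (p l : ℂ) * z ^ l := by
    simp only [transfer, hzl]
    rw [Finset.sum_Ico_eq_sub _ hmn]
  have hkn : kf e n ≤ kf e m := kf_anti he.le (by
    rw [Nat.abs_cast, Nat.abs_cast]; exact_mod_cast hmn)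
  have h2 : ‖(1 - z) * ∑ l ∈ Finset.Ico m n, (p l : ℂ) * z ^ l‖ ≤ C * (2 + 4 / e) * kf e m := by
    rw [summation_by_parts p z hmn]
    have t1 : ‖(p m : ℂ) * z ^ m‖ ≤ C * kf e m := by
      rw [norm_mul, norm_pow, hzn, one_pow, mul_one, Complex.norm_real]; exact hp m
    have t2 : ‖(p n : ℂ) * z ^ n‖ ≤ C * kf e m := by
      rw [norm_mul, norm_pow, hzn, one_pow, mul_one, Complex.norm_real]
      exact (hp n).trans (mul_le_mul_of_nonneg_left hkn hC)
    have t3 : ‖∑ l ∈ Finset.Ico m n, ((p (l + 1) - p l : ℝ) : ℂ) * z ^ (l + 1)‖ ≤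
        C * (4 / e * kf e m) := by
      calc _ ≤ ∑ l ∈ Finset.Ico m n, C * kf (1 + e) l := by
            refine (norm_sum_le _ _).trans (Finset.sum_le_sum fun l _ => ?_)
            rw [norm_mul, norm_pow, hzn, one_pow, mul_one, Complex.norm_real]; exact hv l
        _ ≤ _ := by
            rw [← Finset.mul_sum]
            refine mul_le_mul_of_nonneg_left ((sum_Ico_kf_le he he1.le hmn).trans ?_) hC
            have := kf_nonneg e n
            gcongr; linarith
    calc _ ≤ C * kf e m + C * kf e m + C * (4 / e * kf e m) :=
          (norm_add_le _ _).trans (add_le_add ((norm_sub_le _ _).trans (add_le_add t1 t2)) t3)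
      _ = _ := by ring
  rw [norm_mul] at h2
  have h3 := norm_one_sub_exp_ge hx
  have hxp : 0 < |x| := abs_pos.2 hx0
  rw [h1, le_div_iff₀ hxp]
  have h4 := mul_le_mul_of_nonneg_right h3
    (norm_nonneg (∑ l ∈ Finset.Ico m n, (p l : ℂ) * z ^ l))
  calc _ = π / 2 * (2 / π * |x| * ‖∑ l ∈ Finset.Ico m n, (p l : ℂ) * z ^ l‖) := by
        have := Real.pi_ne_zero
        field_simp
    _ ≤ π / 2 * (C * (2 + 4 / e) * kf e m) :=
        mul_le_mul_of_nonneg_left (h4.trans h2) (by positivity)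
    _ = _ := by ring

lemma tendsto_transfer (he : 0 < e) (he1 : e < 1) (hp : ∀ l, |p l| ≤ C * kf e l)
    (hv : ∀ l, |p (l + 1) - p l| ≤ C * kf (1 + e) l) {x : ℝ} (hx0 : x ≠ 0) (hx : |x| ≤ π) :
    Tendsto (fun n => transfer p n x) atTop (𝓝 (limUnder atTop fun n => transfer p n x)) := by
  have hcs : CauchySeq fun n => transfer p n x := by
    refine cauchySeq_of_le_tendsto_0 (fun m => C * (2 + 4 / e) * (π / 2) * kf e m / |x| * 2)
      (fun n m N hn hm => ?_) ?_
    · have h1 := norm_transfer_sub_le he he1 hp hv hx0 hx hn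
      have h2 := norm_transfer_sub_le he he1 hp hv hx0 hx hm
      have h3 := dist_triangle_right (transfer p n x) (transfer p m x) (transfer p N x)
      rw [dist_eq_norm (transfer p n x) (transfer p N x),
        dist_eq_norm (transfer p m x) (transfer p N x)] at h3
      linarith
    · have := (((tendsto_kf_atTop he).const_mul (C * (2 + 4 / e) * (π / 2))).div_const |x|).mul_const 2
      simpa using this
  obtain ⟨L, hL⟩ := cauchySeq_tendsto_of_complete hcs
  rwa [hL.limUnder_eq]

/-- Split at m ≈ 1/|x|: up to m the absolute values sum to m^(1-e), and beyond m Abel summation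
gives m^(-e)/|x|. Both are of order |x|^(-(1-e)). -/
lemma norm_transfer_le (he : 0 < e) (he1 : e < 1) (hp : ∀ l, |p l| ≤ C * kf e l)
    (hv : ∀ l, |p (l + 1) - p l| ≤ C * kf (1 + e) l) {x : ℝ} (hx0 : x ≠ 0) (hx : |x| ≤ π) (n : ℕ) :
    ‖transfer p n x‖ ≤ C * ((1 + π) / (1 - e) + (2 + 4 / e) * (π / 2)) * |x| ^ (-(1 - e)) := by
  have hC : 0 ≤ C := by simpa [kf_zero] using (abs_nonneg _).trans (hp 0)
  have hxp : 0 < |x| := abs_pos.2 hx0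
  have h1e : 0 < 1 - e := by linarith
  have hpi := Real.pi_pos
  set m := ⌈1 / |x|⌉₊ with hm
  have hm1 : 1 / |x| ≤ m := Nat.le_ceil _
  have hm2 : (m : ℝ) ≤ (1 + π) / |x| := by
    have := (Nat.ceil_lt_add_one (by positivity : 0 ≤ 1 / |x|)).le
    refine this.trans ?_
    rw [add_div]
    have : 1 ≤ π / |x| := by rwa [le_div_iff₀ hxp, one_mul]
    linarith
  have hsmall : ∀ k ≤ m, ‖transfer p k x‖ ≤ C * ((1 + π) / (1 - e)) * |x| ^ (-(1 - e)) := by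
    intro k hk
    calc ‖transfer p k x‖ ≤ ∑ l ∈ Finset.range k, C * kf e l := by
          refine (norm_sum_le _ _).trans (Finset.sum_le_sum fun l _ => ?_)
          rw [norm_mul, show -Complex.I * (x : ℂ) * (l : ℂ) = ((-(x * l) : ℝ) : ℂ) * Complex.I by
            push_cast; ring, Complex.norm_exp_ofReal_mul_I, mul_one, Complex.norm_real]
          exact hp l
      _ ≤ C * (1 / (1 - e) * (k : ℝ) ^ (1 - e)) := by
          rw [← Finset.mul_sum]
          exact mul_le_mul_of_nonneg_left (sum_kf_range he he1 k) hC
      _ ≤ C * (1 / (1 - e) * ((1 + π) * |x| ^ (-(1 - e)))) := by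
          have : (k : ℝ) ^ (1 - e) ≤ (1 + π) * |x| ^ (-(1 - e)) := by
            calc (k : ℝ) ^ (1 - e) ≤ ((1 + π) / |x|) ^ (1 - e) :=
                  Real.rpow_le_rpow (by positivity)
                    (le_trans (by exact_mod_cast hk) hm2) h1e.le
              _ = (1 + π) ^ (1 - e) * |x| ^ (-(1 - e)) := by
                  rw [Real.div_rpow (by positivity) hxp.le, Real.rpow_neg hxp.le, div_eq_mul_inv]
              _ ≤ (1 + π) * |x| ^ (-(1 - e)) := by
                  gcongr
                  conv_rhs => rw [← Real.rpow_one (1 + π)]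
                  exact Real.rpow_le_rpow_of_exponent_le (by linarith) (by linarith)
          gcongr
      _ = _ := by ring
  have hpos : 0 ≤ C * ((2 + 4 / e) * (π / 2)) * |x| ^ (-(1 - e)) := by positivity
  rcases le_or_gt n m with h | h
  · refine (hsmall n h).trans ?_
    rw [mul_add, add_mul]; linarith
  · have h1 := norm_transfer_sub_le he he1 hp hv hx0 hx h.le
    have h2 := hsmall m le_rfl
    have h3 : kf e m ≤ |x| ^ e := by
      rw [kf_natCast]
      calc (1 + (m : ℝ)) ^ (-e) ≤ (1 / |x|) ^ (-e) :=
            Real.rpow_le_rpow_of_nonpos (by positivity) (by linarith) (by linarith)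
        _ = |x| ^ e := by
            rw [one_div, Real.inv_rpow hxp.le, Real.rpow_neg hxp.le, inv_inv]
    have h4 : ‖transfer p n x - transfer p m x‖ ≤
        C * ((2 + 4 / e) * (π / 2)) * |x| ^ (-(1 - e)) := by
      refine h1.trans ?_
      have : |x| ^ (-(1 - e)) = |x| ^ e / |x| := by
        rw [neg_sub, Real.rpow_sub hxp, Real.rpow_one]
      rw [this]
      calc _ ≤ C * (2 + 4 / e) * (π / 2) * |x| ^ e / |x| := by gcongr
        _ = _ := by ring
    calc ‖transfer p n x‖ ≤ ‖transfer p m x‖ + ‖transfer p n x - transfer p m x‖ := by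
          have := norm_add_le (transfer p m x) (transfer p n x - transfer p m x)
          rwa [add_sub_cancel] at this
      _ ≤ _ := by rw [mul_add, add_mul]; linarith

end

lemma norm_transfer_sq (p : ℕ → ℝ) (n : ℕ) (x : ℝ) :
    ((‖transfer p n x‖ ^ 2 : ℝ) : ℂ) = ∑ h ∈ Finset.Icc (-(n : ℤ)) n,
      (lagSum n p p h : ℂ) * Complex.exp (-Complex.I * (x : ℂ) * (h : ℂ)) := by
  have hc : (starRingEnd ℂ) (transfer p n x) =
      ∑ l ∈ Finset.range n, (p l : ℂ) * Complex.exp (Complex.I * (x : ℂ) * (l : ℂ)) := by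
    rw [transfer, map_sum]
    refine Finset.sum_congr rfl fun h _ => ?_
    rw [map_mul, Complex.conj_ofReal, ← Complex.exp_conj]
    simp
  have h1 : ((‖transfer p n x‖ ^ 2 : ℝ) : ℂ) = transfer p n x * (starRingEnd ℂ) (transfer p n x) := by
    rw [Complex.mul_conj, Complex.normSq_eq_norm_sq]
  rw [h1, hc, transfer, Finset.sum_mul_sum]
  simp only [lagSum, Complex.ofReal_sum, Finset.sum_mul]
  symm
  rw [Finset.sum_comm]
  refine Finset.sum_congr rfl fun l hl => ?_
  rw [Finset.sum_comm]
  refine Finset.sum_congr rfl fun l' hl' => ?_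
  rw [Finset.mem_range] at hl hl'
  rw [Finset.sum_eq_single_of_mem ((l : ℤ) - l') (by rw [Finset.mem_Icc]; omega)]
  · rw [if_pos rfl, Complex.ofReal_mul]
    have : Complex.exp (-Complex.I * (x : ℂ) * (((l : ℤ) - l' : ℤ) : ℂ)) =
        Complex.exp (-Complex.I * (x : ℂ) * l) * Complex.exp (Complex.I * (x : ℂ) * l') := by
      rw [← Complex.exp_add]; congr 1; push_cast; ring
    rw [this]; ring
  · intro h _ hne
    rw [if_neg fun hh => hne hh.symm]; simp

/-- |A|² is itself a trigonometric polynomial, with coefficients `lagSum`, so the fourth-power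
expansion applies to it in turn. -/
lemma norm_transfer_pow_eight (p : ℕ → ℝ) (n : ℕ) (x : ℝ) :
    ‖transfer p n x‖ ^ 8 =
      ∑ s ∈ lagBox n, (∏ i, lagSum n p p (s i)) * Real.cos (x * alt s) := by
  rw [lagBox, ← norm_sum_pow_four, ← norm_transfer_sq, Complex.norm_real, norm_pow, norm_norm,
    ← pow_mul]

lemma continuous_transfer (p : ℕ → ℝ) (n : ℕ) : Continuous (transfer p n) := by
  unfold transfer; fun_prop

lemma integral_norm_transfer_pow_eight (p : ℕ → ℝ) (n : ℕ) :
    ∫ x in (-π)..π, ‖transfer p n x‖ ^ 8 = 2 * π * quadSum (lagSum n p p) n := by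
  simp only [norm_transfer_pow_eight]
  rw [intervalIntegral.integral_finsetSum
    fun s _ => (Continuous.intervalIntegrable (by fun_prop) _ _)]
  simp only [intervalIntegral.integral_const_mul, integral_cos_mul_int]
  rw [quadSum, Finset.sum_filter, Finset.mul_sum]
  refine Finset.sum_congr rfl fun s _ => ?_
  unfold selZero
  split_ifs <;> ring

/-- Truncation error for `quadSum`, uniform in the outer cut-off. -/
lemma exists_quadSum_tail {b δ : ℝ} (hb : 3 / 4 < b) (hδ : 0 < δ) (hbδ : b + δ < 1) :
    ∃ C : ℝ, 0 ≤ C ∧ ∀ (g : ℤ → ℝ) (K : ℝ) (H n : ℕ), (∀ h, |g h| ≤ K * kf (b + δ) h) → H ≤ n →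
      |quadSum g n - quadSum g H| ≤ C * K ^ 4 * kf δ H := by
  obtain ⟨C, hC, Q⟩ := exists_quad hb (by linarith : b < 1)
  refine ⟨C, hC, fun g K H n hg hHn => ?_⟩
  have hK : 0 ≤ K := by simpa [kf_zero] using (abs_nonneg _).trans (hg 0)
  have hsub : ((lagBox H).filter fun h => alt h = 0) ⊆ (lagBox n).filter fun h => alt h = 0 := by
    refine Finset.filter_subset_filter _ fun h hh => mem_lagBox.2 fun i => ?_
    exact (mem_lagBox.1 hh i).trans (by exact_mod_cast hHn)
  unfold quadSum
  rw [← Finset.sum_sdiff hsub, add_sub_cancel_right]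
  refine (Finset.abs_sum_le_sum_abs _ _).trans ?_
  calc ∑ h ∈ ((lagBox n).filter fun h => alt h = 0) \ (lagBox H).filter fun h => alt h = 0,
        |∏ i, g (h i)| ≤
      ∑ h ∈ ((lagBox n).filter fun h => alt h = 0) \ (lagBox H).filter fun h => alt h = 0,
        K ^ 4 * kf δ H * ∏ i, kf b (h i) := by
        refine Finset.sum_le_sum fun h hh => ?_
        rw [Finset.mem_sdiff, Finset.mem_filter, Finset.mem_filter] at hh
        -- Some lag exceeds H; its factor `kf δ` is at most `kf δ H` and the other three are at most
        -- 1.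
        have hex : ∃ i, (H : ℤ) < |h i| := by
          by_contra hcon
          push Not at hcon
          exact hh.2 ⟨mem_lagBox.2 hcon, hh.1.2⟩
        obtain ⟨i, hi⟩ := hex
        have h1 : kf δ (h i) ≤ kf δ H := kf_anti hδ.le (by rw [Nat.abs_cast]; exact hi.le)
        have h2 : ∏ j, kf δ (h j) ≤ kf δ H := by
          rw [← Finset.mul_prod_erase _ _ (Finset.mem_univ i)]
          refine (mul_le_of_le_one_right (kf_nonneg _ _) ?_).trans h1
          exact Finset.prod_le_one (fun j _ => kf_nonneg _ _) fun j _ => kf_le_one hδ.le _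
        rw [Finset.abs_prod]
        calc ∏ j, |g (h j)| ≤ ∏ j, K * (kf b (h j) * kf δ (h j)) :=
              Finset.prod_le_prod (fun _ _ => abs_nonneg _) fun j _ => by
                rw [kf_mul]; exact hg _
          _ = K ^ 4 * (∏ j, kf δ (h j)) * ∏ j, kf b (h j) := by
              rw [Finset.prod_mul_distrib, Finset.prod_mul_distrib, Finset.prod_const,
                Finset.card_univ, Fintype.card_fin]; ring
          _ ≤ _ := by
              have : 0 ≤ ∏ j, kf b (h j) := Finset.prod_nonneg fun j _ => kf_nonneg _ _
              gcongr
    _ ≤ K ^ 4 * kf δ H * C := by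
        rw [← Finset.mul_sum]
        refine mul_le_mul_of_nonneg_left (Q _ 0 fun h hh => ?_)
          (mul_nonneg (by positivity) (kf_nonneg _ _))
        exact (Finset.mem_filter.1 (Finset.mem_sdiff.1 hh).1).2
    _ = _ := by ring

lemma intervalIntegrable_abs_rpow {r : ℝ} (hr : r < 1) :
    IntervalIntegrable (fun x : ℝ => |x| ^ (-r)) volume (-π) π := by
  have h1 : IntervalIntegrable (fun x : ℝ => x ^ (-r)) volume 0 π :=
    intervalIntegral.intervalIntegrable_rpow' (by linarith)
  have h2 : IntervalIntegrable (fun x : ℝ => |x| ^ (-r)) volume 0 π := by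
    refine h1.congr ?_
    intro x hx
    rw [uIoc_of_le Real.pi_pos.le] at hx
    simp only [abs_of_pos hx.1]
  have h3 : IntervalIntegrable (fun x : ℝ => |x| ^ (-r)) volume (-π) 0 := by
    have := (IntervalIntegrable.iff_comp_neg (f := fun x : ℝ => |x| ^ (-r)) (a := 0) (b := π)).1 h2
    simp only [abs_neg, neg_zero] at this
    exact this.symm
  exact h3.trans h2

section

variable {e C : ℝ} {p : ℕ → ℝ}

lemma sDens_pow_four (p : ℕ → ℝ) (x : ℝ) :
    sDens p x ^ 4 = (1 / (2 * π)) ^ 4 * ‖limUnder atTop fun n => transfer p n x‖ ^ 8 := by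
  rw [sDens, mul_pow, ← pow_mul]

lemma ae_interval_ne_zero : ∀ᵐ x : ℝ, x ∈ Set.uIoc (-π) π → x ≠ 0 ∧ |x| ≤ π := by
  have : ∀ᵐ x : ℝ, x ≠ 0 := by simp [ae_iff]
  filter_upwards [this] with x hx hm
  rw [uIoc_of_le (by linarith [Real.pi_pos])] at hm
  exact ⟨hx, abs_le.2 ⟨hm.1.le, hm.2⟩⟩

/-- `2π ∑_{alt h = 0} ∏ γ_n(h_i) → ∫ |A|⁸`. -/
lemma tendsto_quadSum_lagSum (he : 7 / 8 < e) (he1 : e < 1) (hp : ∀ l, |p l| ≤ C * kf e l)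
    (hv : ∀ l, |p (l + 1) - p l| ≤ C * kf (1 + e) l) :
    Tendsto (fun n => quadSum (lagSum n p p) n) atTop
      (𝓝 (8 * π ^ 3 * ∫ x in (-π)..π, sDens p x ^ 4)) := by
  have he0 : 0 < e := by linarith
  set B := C * ((1 + π) / (1 - e) + (2 + 4 / e) * (π / 2)) with hB
  have hlim : Tendsto (fun n => ∫ x in (-π)..π, ‖transfer p n x‖ ^ 8) atTop
      (𝓝 (∫ x in (-π)..π, ‖limUnder atTop fun n => transfer p n x‖ ^ 8)) := by
    -- The majorant |x|^(-8(1-e)) is integrable because e > 7/8.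
    refine intervalIntegral.tendsto_integral_filter_of_dominated_convergence
      (fun x => B ^ 8 * |x| ^ (-(8 * (1 - e)))) ?_ ?_ ?_ ?_
    · exact Eventually.of_forall fun n =>
        ((continuous_transfer p n).norm.pow 8).aestronglyMeasurable
    · refine Eventually.of_forall fun n => ?_
      filter_upwards [ae_interval_ne_zero] with x hx hm
      obtain ⟨h0, h1⟩ := hx hm
      have h2 := norm_transfer_le he0 he1 hp hv h0 h1 n
      rw [norm_pow, norm_norm]
      calc ‖transfer p n x‖ ^ 8 ≤ (B * |x| ^ (-(1 - e))) ^ 8 := by gcongr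
        _ = _ := by
            rw [mul_pow, ← Real.rpow_natCast (|x| ^ _), ← Real.rpow_mul (abs_nonneg x)]
            congr 2; push_cast; ring
    · exact (intervalIntegrable_abs_rpow (by linarith)).const_mul _
    · filter_upwards [ae_interval_ne_zero] with x hx hm
      obtain ⟨h0, h1⟩ := hx hm
      exact (tendsto_transfer he0 he1 hp hv h0 h1).norm.pow 8
  simp only [integral_norm_transfer_pow_eight] at hlim
  have h2 := hlim.const_mul (1 / (2 * π))
  have hpi := Real.pi_ne_zero
  have e1 : ∀ y : ℝ, 1 / (2 * π) * (2 * π * y) = y := fun y => by field_simp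
  simp only [e1] at h2
  convert h2 using 2
  simp only [sDens_pow_four, intervalIntegral.integral_const_mul]
  field_simp; ring

/-- The truncation error of the partial sums is uniform in n; as n → ∞ the untruncated side
converges by dominated convergence and the truncated one term by term. The bound depends on p only
through C, hence is uniform in u. -/
lemma exists_quadSum_acov {b δ : ℝ} (hb : 3 / 4 < b) (hδ : 0 < δ) (hbδ : b + δ = 2 * e - 1)
    (he1 : e < 1) :
    ∃ K : ℝ, 0 ≤ K ∧ ∀ (p : ℕ → ℝ) (C : ℝ) (H : ℕ), (∀ l, |p l| ≤ C * kf e l) →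
      (∀ l, |p (l + 1) - p l| ≤ C * kf (1 + e) l) →
      |8 * π ^ 3 * (∫ x in (-π)..π, sDens p x ^ 4) - quadSum (acov p) H| ≤ K * C ^ 8 * kf δ H := by
  have he : 7 / 8 < e := by linarith
  obtain ⟨C1, h1, H1⟩ := exists_quadSum_tail hb hδ (by linarith)
  obtain ⟨C2, h2, H2⟩ := exists_lagSum_bound (e := e) (by linarith) he1
  refine ⟨C1 * C2 ^ 4, by positivity, fun p C H hp hv => ?_⟩
  have t1 := tendsto_quadSum_lagSum he he1 hp hv
  have t2 : Tendsto (fun n => quadSum (lagSum n p p) H) atTop (𝓝 (quadSum (acov p) H)) :=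
    tendsto_finsetSum _ fun h _ => tendsto_finsetProd _ fun i _ =>
      tendsto_lagSum (by linarith) hp (h i)
  refine le_of_tendsto (t1.sub t2).abs ((eventually_ge_atTop H).mono fun n hn => ?_)
  have := H1 (lagSum n p p) (C2 * (C * C)) H n (fun h => by
    rw [hbδ]; exact H2 n p p C C h hp hp) hn
  refine this.trans (le_of_eq (by ring))

/-- `∑_{alt h = 0} ∏ g(h_i) ≥ g(0)⁴`. -/
lemma pow_four_le_quadSum (g : ℤ → ℝ) (H : ℕ) : g 0 ^ 4 ≤ quadSum g H := by
  set A := Finset.Icc (-(H : ℤ)) H with hA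
  have hA' : ∀ y, y ∈ A ↔ |y| ≤ H := fun y => by rw [hA, Finset.mem_Icc, abs_le]
  -- r is the autocorrelation of the truncated g, an even function, so the quadruple sum equals Σ
  -- r(c) r(-c) = Σ r(c)², and r(0) ≥ g(0)².
  set r : ℤ → ℝ := fun c => ∑ x ∈ A ×ˢ A with x.1 - x.2 = c, g x.1 * g x.2 with hr
  have hneg : ∀ c, r (-c) = r c := fun c => by
    simp only [hr]
    refine Finset.sum_nbij' (fun x => (x.2, x.1)) (fun x => (x.2, x.1)) ?_ ?_ ?_ ?_ ?_
    · intro x hx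
      simp only [Finset.mem_filter, Finset.mem_product] at hx ⊢
      exact ⟨⟨hx.1.2, hx.1.1⟩, by linarith [hx.2]⟩
    · intro x hx
      simp only [Finset.mem_filter, Finset.mem_product] at hx ⊢
      exact ⟨⟨hx.1.2, hx.1.1⟩, by linarith [hx.2]⟩
    · intro x _; rfl
    · intro x _; rfl
    · intro x _; simp only [mul_comm]
  set Λ := Finset.Icc (-(2 * H : ℤ)) (2 * H) with hΛ
  have key : quadSum g H = ∑ c ∈ Λ, r c * r (-c) := by
    have e1 : quadSum g H = ∑ q ∈ (A ×ˢ A) ×ˢ (A ×ˢ A) with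
        (q.1.1 - q.1.2) + (q.2.1 - q.2.2) = 0, (g q.1.1 * g q.1.2) * (g q.2.1 * g q.2.2) := by
      unfold quadSum
      refine Finset.sum_nbij' (fun h => ((h 0, h 1), (h 2, h 3)))
        (fun q => ![q.1.1, q.1.2, q.2.1, q.2.2]) ?_ ?_ ?_ ?_ ?_
      · intro h hh
        simp only [Finset.mem_filter, Finset.mem_product, mem_lagBox, hA'] at hh ⊢
        have := hh.2
        unfold alt at this
        exact ⟨⟨⟨hh.1 0, hh.1 1⟩, hh.1 2, hh.1 3⟩, by linarith⟩
      · intro q hq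
        simp only [Finset.mem_filter, Finset.mem_product, mem_lagBox, hA'] at hq ⊢
        refine ⟨fun i => ?_, ?_⟩
        · fin_cases i
          · exact hq.1.1.1
          · exact hq.1.1.2
          · exact hq.1.2.1
          · exact hq.1.2.2
        · have := hq.2
          simp only [alt, Matrix.cons_val]
          linarith
      · intro h _; ext i; fin_cases i <;> rfl
      · intro q _; rfl
      · intro h _; rw [Fin.prod_univ_four]; ring
    have e2 : ∀ c ∈ Λ, r c * r (-c) = ∑ q ∈ (A ×ˢ A) ×ˢ (A ×ˢ A) with
        (q.1.1 - q.1.2) + (q.2.1 - q.2.2) = 0 ∧ q.1.1 - q.1.2 = c,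
        (g q.1.1 * g q.1.2) * (g q.2.1 * g q.2.2) := fun c _ => by
      simp only [hr]
      rw [Finset.sum_mul_sum, ← Finset.sum_product', ← Finset.filter_product]
      refine Finset.sum_congr (Finset.filter_congr fun q _ => ?_) fun _ _ => rfl
      constructor <;> rintro ⟨_, _⟩ <;> constructor <;> linarith
    rw [e1, Finset.sum_congr rfl e2]
    rw [← Finset.sum_fiberwise_of_maps_to (t := Λ) (g := fun q => q.1.1 - q.1.2) (fun q hq => by
      simp only [Finset.mem_filter, Finset.mem_product, hA, hΛ, Finset.mem_Icc] at hq ⊢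
      omega)]
    simp only [Finset.filter_filter]
  rw [key]
  have h0 : 0 ∈ Λ := by rw [hΛ, Finset.mem_Icc]; omega
  have hnn : ∀ c ∈ Λ, 0 ≤ r c * r (-c) := fun c _ => by rw [hneg]; exact mul_self_nonneg _
  refine le_trans ?_ (Finset.single_le_sum hnn h0)
  have hr0 : g 0 ^ 2 ≤ r 0 := by
    have hmem : ((0, 0) : ℤ × ℤ) ∈ (A ×ˢ A).filter fun x => x.1 - x.2 = 0 := by
      simp [hA]
    have := Finset.single_le_sum (f := fun x : ℤ × ℤ => g x.1 * g x.2) (fun x hx => by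
      have : x.1 = x.2 := by linarith [(Finset.mem_filter.1 hx).2]
      rw [this]; exact mul_self_nonneg _) hmem
    rw [pow_two]; exact this
  rw [neg_zero]
  calc g 0 ^ 4 = g 0 ^ 2 * g 0 ^ 2 := by ring
    _ ≤ r 0 * r 0 := mul_self_le_mul_self (sq_nonneg _) hr0

lemma sq_le_acov_zero (he : 1 / 2 < e) (hp : ∀ l, |p l| ≤ C * kf e l) (l : ℕ) :
    p l ^ 2 ≤ acov p 0 := by
  have h := summable_mul_shift he hp 0
  have := h.le_tsum l fun j _ => mul_self_nonneg _
  rw [pow_two]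
  exact this

end

/-! ### Integrability of f⁴ and identification and positivity of the limit constant. -/

/-- Uniform decay of the coefficient functions and of their increments. -/
structure CoeffDecay (ψ : ℕ → ℝ → ℝ) (e C : ℝ) : Prop where
  cont : ∀ l, ContinuousOn (ψ l) (Icc 0 1)
  bound : ∀ l, ∀ u ∈ Icc (0 : ℝ) 1, |ψ l u| ≤ C * kf e l
  variation : ∀ l, ∀ u ∈ Icc (0 : ℝ) 1, |ψ (l + 1) u - ψ l u| ≤ C * kf (1 + e) l
  lipschitz : ∀ l, ∀ u ∈ Icc (0 : ℝ) 1, ∀ v ∈ Icc (0 : ℝ) 1,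
    |ψ l u - ψ l v| ≤ C * kf e l * |u - v|

lemma exists_coeffDecay {Ω : Type*} [MeasurableSpace Ω] {P : Measure Ω}
    {X : ℕ → ℤ → Ω → ℝ} {Z : ℤ → Ω → ℝ} {ψT : ℕ → ℤ → ℕ → ℝ} {ψ : ℕ → ℝ → ℝ} {d a : ℝ → ℝ}
    (hX : IsLocallyStationary P X Z ψT ψ d a) (hd : dSup d < 1 / 8) :
    ∃ e b δ C : ℝ, 3 / 4 < b ∧ 0 < δ ∧ b + δ = 2 * e - 1 ∧ e < 1 ∧ e < 1 - dSup d ∧ 0 ≤ C ∧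
      CoeffDecay ψ e C := by
  have hd0 := dSup_nonneg hX
  -- e is the midpoint of 7/8 and 1 - d_∞; below, b is the midpoint of 3/4 and 2e - 1, and δ is what
  -- is left. Room for both exists because d_∞ < 1/8.
  set e : ℝ := 1 - (dSup d + 1 / 8) / 2 with he
  have he0 : 0 < e := by rw [he]; linarith
  have he1 : e < 1 - dSup d := by rw [he]; linarith
  obtain ⟨C1, h1, H1⟩ := exists_psi_bound hX he0 he1
  obtain ⟨C2, h2, H2⟩ := exists_psi_variation hX he0 he1
  obtain ⟨C3, h3, H3⟩ := exists_psi_lipschitz hX he0 he1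
  refine ⟨e, (2 * e - 1 + 3 / 4) / 2, 2 * e - 1 - (2 * e - 1 + 3 / 4) / 2, C1 + C2 + C3, ?_, ?_, by ring,
    ?_, he1, by positivity, ⟨fun l => (hX.psi_smooth l).continuousOn, fun l u hu => ?_,
    fun l u hu => ?_, fun l u hu v hv => ?_⟩⟩
  · rw [he]; linarith
  · rw [he]; linarith
  · rw [he]; linarith
  · exact (H1 l u hu).trans (mul_le_mul_of_nonneg_right (by linarith) (kf_nonneg _ _))
  · exact (H2 l u hu).trans (mul_le_mul_of_nonneg_right (by linarith) (kf_nonneg _ _))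
  · refine (H3 l u hu v hv).trans ?_
    have := kf_nonneg e l
    gcongr; linarith

section

variable {ψ : ℕ → ℝ → ℝ} {e C : ℝ}

/-- Off x = 0 the density is the limit of its continuous partial-sum versions, which gives
measurability; the majorant is a multiple of |x|^(-8(1-e)), uniformly in u. -/
lemma CoeffDecay.integrableOn (h : CoeffDecay ψ e C) (he : 7 / 8 < e) (he1 : e < 1) :
    IntegrableOn (fun p : ℝ × ℝ => specDensity ψ p.1 p.2 ^ 4) (Icc 0 1 ×ˢ Icc (-π) π) := by
  have he0 : 0 < e := by linarith
  have hpi := Real.pi_pos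
  set R : Set (ℝ × ℝ) := Icc 0 1 ×ˢ Icc (-π) π with hR
  have hRm : MeasurableSet R := measurableSet_Icc.prod measurableSet_Icc
  set B := C * ((1 + π) / (1 - e) + (2 + 4 / e) * (π / 2)) with hB
  have hne : ∀ᵐ p : ℝ × ℝ ∂(volume.restrict R), p.2 ≠ 0 := by
    refine ae_restrict_of_ae ?_
    have : ∀ᵐ x : ℝ, x ≠ 0 := by simp [ae_iff]
    rw [Measure.volume_eq_prod]
    exact Measure.quasiMeasurePreserving_snd.ae this
  have hmem : ∀ᵐ p : ℝ × ℝ ∂(volume.restrict R), p ∈ R := ae_restrict_mem hRm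
  have hlim : ∀ᵐ p : ℝ × ℝ ∂(volume.restrict R), Tendsto
      (fun n => (1 / (2 * π) * ‖transfer (fun l => ψ l p.1) n p.2‖ ^ 2) ^ 4) atTop
      (𝓝 (specDensity ψ p.1 p.2 ^ 4)) := by
    filter_upwards [hne, hmem] with p hp hpR
    exact (((tendsto_transfer he0 he1 (fun l => h.bound l p.1 hpR.1)
      (fun l => h.variation l p.1 hpR.1) hp (abs_le.2 hpR.2)).norm.pow 2).const_mul _).pow 4
  have hmeas : AEStronglyMeasurable (fun p : ℝ × ℝ => specDensity ψ p.1 p.2 ^ 4)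
      (volume.restrict R) := by
    refine aestronglyMeasurable_of_tendsto_ae atTop (fun n => ?_) hlim
    refine ContinuousOn.aestronglyMeasurable ?_ hRm
    refine (continuousOn_const.mul (ContinuousOn.pow (ContinuousOn.norm ?_) 2)).pow 4
    unfold transfer
    refine continuousOn_finsetSum _ fun l _ => ContinuousOn.mul ?_
      (Continuous.continuousOn (by fun_prop))
    exact Complex.continuous_ofReal.comp_continuousOn
      ((h.cont l).comp continuousOn_fst fun p hp => hp.1)
  have hdom : Integrable (fun p : ℝ × ℝ => (1 / (2 * π)) ^ 4 * (B ^ 8 * |p.2| ^ (-(8 * (1 - e)))))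
      (volume.restrict R) := by
    refine Integrable.const_mul (Integrable.const_mul ?_ _) _
    rw [hR, Measure.volume_eq_prod, ← Measure.prod_restrict]
    have h1 : Integrable (fun x : ℝ => |x| ^ (-(8 * (1 - e)))) (volume.restrict (Icc (-π) π)) := by
      have := intervalIntegrable_abs_rpow (r := 8 * (1 - e)) (by linarith)
      rw [intervalIntegrable_iff_integrableOn_Icc_of_le (by linarith)] at this
      exact this
    exact h1.comp_snd _
  refine hdom.mono' hmeas ?_
  filter_upwards [hne, hmem, hlim] with p hp hpR hl
  have hk : 0 ≤ specDensity ψ p.1 p.2 ^ 4 := by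
    rw [specDensity_eq, sDens_pow_four]; positivity
  rw [Real.norm_of_nonneg hk]
  refine le_of_tendsto hl (Eventually.of_forall fun n => ?_)
  have h2 := norm_transfer_le he0 he1 (fun l => h.bound l p.1 hpR.1)
      (fun l => h.variation l p.1 hpR.1) hp (abs_le.2 hpR.2) n
  calc (1 / (2 * π) * ‖transfer (fun l => ψ l p.1) n p.2‖ ^ 2) ^ 4
      = (1 / (2 * π)) ^ 4 * ‖transfer (fun l => ψ l p.1) n p.2‖ ^ 8 := by ring
    _ ≤ (1 / (2 * π)) ^ 4 * (B * |p.2| ^ (-(1 - e))) ^ 8 := by gcongr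
    _ = _ := by
        rw [mul_pow, ← Real.rpow_natCast (|p.2| ^ _), ← Real.rpow_mul (abs_nonneg p.2)]
        congr 3; push_cast; ring

/-- `∫ f(u, x)⁴ dx`. -/
def slice (ψ : ℕ → ℝ → ℝ) (u : ℝ) : ℝ := ∫ x in (-π)..π, sDens (fun l => ψ l u) x ^ 4

lemma CoeffDecay.slice (h : CoeffDecay ψ e C) (he : 7 / 8 < e) (he1 : e < 1) :
    IntervalIntegrable (slice ψ) volume 0 1 ∧ intF4 ψ = ∫ u in (0 : ℝ)..1, slice ψ u := by
  have hpi := Real.pi_pos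
  have hint := h.integrableOn he he1
  have hsub : (Ioc 0 1 ×ˢ Ioc (-π) π : Set (ℝ × ℝ)) ⊆ Icc 0 1 ×ˢ Icc (-π) π :=
    Set.prod_mono Ioc_subset_Icc_self Ioc_subset_Icc_self
  have hint' := hint.mono_set hsub
  rw [IntegrableOn, Measure.volume_eq_prod, ← Measure.prod_restrict] at hint'
  have e1 : ∀ u, LongMemory.slice ψ u = ∫ x in Ioc (-π) π, specDensity ψ u x ^ 4 := fun u => by
    rw [LongMemory.slice, intervalIntegral.integral_of_le (by linarith)]; rfl
  constructor
  · rw [intervalIntegrable_iff_integrableOn_Ioc_of_le zero_le_one]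
    simp only [funext e1]
    exact hint'.integral_prod_left
  · rw [intF4, intervalIntegral.integral_of_le (by linarith),
      intervalIntegral.integral_of_le zero_le_one]
    simp only [intervalIntegral.integral_of_le zero_le_one, e1]
    exact (integral_integral_swap hint').symm

lemma CoeffDecay.continuousOn_acov (h : CoeffDecay ψ e C) (he : 1 / 2 < e) (he1 : e < 1) (hC : 0 ≤ C) (k : ℤ) :
    ContinuousOn (fun u => acov (fun l => ψ l u) k) (Icc 0 1) := by
  obtain ⟨K, hK, H⟩ := exists_acov_bound he he1
  have hl : ∀ u ∈ Icc (0 : ℝ) 1, ∀ v ∈ Icc (0 : ℝ) 1,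
      |acov (fun l => ψ l u) k - acov (fun l => ψ l v) k| ≤
        K * (2 * C) * C * kf (2 * e - 1) k * |u - v| := fun u hu v hv => by
    refine ((H _ _ C (C * |u - v|) k (fun l => h.bound l u hu) (fun l => h.bound l v hv)).2
      fun l => ?_).trans (le_of_eq (by ring))
    exact (h.lipschitz l u hu v hv).trans (le_of_eq (by ring))
  have hL : 0 ≤ K * (2 * C) * C * kf (2 * e - 1) k :=
    mul_nonneg (by positivity) (kf_nonneg _ _)
  refine (LipschitzOnWith.of_dist_le_mul (K := ⟨_, hL⟩) fun u hu v hv => ?_).continuousOn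
  rw [Real.dist_eq, Real.dist_eq]
  exact hl u hu v hv

lemma CoeffDecay.continuousOn_quadSum (h : CoeffDecay ψ e C) (he : 1 / 2 < e) (he1 : e < 1)
    (hC : 0 ≤ C) (H : ℕ) :
    ContinuousOn (fun u => quadSum (acov fun l => ψ l u) H) (Icc 0 1) :=
  continuousOn_finsetSum _ fun s _ => continuousOn_finsetProd _ fun i _ =>
    h.continuousOn_acov he he1 hC (s i)

/-- `∫ quadSum(γ_u, H) du → 8π³ ∫∫ f⁴`. -/
lemma CoeffDecay.tendsto_integral_quadSum (h : CoeffDecay ψ e C) {b δ : ℝ} (hb : 3 / 4 < b)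
    (hδ : 0 < δ) (hbδ : b + δ = 2 * e - 1) (he1 : e < 1) (hC : 0 ≤ C) :
    Tendsto (fun H : ℕ => ∫ u in (0 : ℝ)..1, quadSum (acov fun l => ψ l u) H) atTop
      (𝓝 (8 * π ^ 3 * intF4 ψ)) ∧
    ∀ u ∈ Icc (0 : ℝ) 1, Tendsto (fun H : ℕ => quadSum (acov fun l => ψ l u) H) atTop
      (𝓝 (8 * π ^ 3 * LongMemory.slice ψ u)) := by
  have he : 7 / 8 < e := by linarith
  obtain ⟨K, hK, Q⟩ := exists_quadSum_acov hb hδ hbδ he1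
  have hz : Tendsto (fun H : ℕ => K * C ^ 8 * kf δ H) atTop (𝓝 0) := by
    simpa using (tendsto_kf_atTop hδ).const_mul (K * C ^ 8)
  have hQ : ∀ H : ℕ, ∀ u ∈ Icc (0 : ℝ) 1,
      |8 * π ^ 3 * LongMemory.slice ψ u - quadSum (acov fun l => ψ l u) H| ≤ K * C ^ 8 * kf δ H :=
    fun H u hu => Q (fun l => ψ l u) C H (fun l => h.bound l u hu) (fun l => h.variation l u hu)
  obtain ⟨hs1, hs2⟩ := h.slice he he1
  constructor
  · rw [hs2, ← intervalIntegral.integral_const_mul, tendsto_iff_norm_sub_tendsto_zero]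
    refine squeeze_zero (fun _ => norm_nonneg _) (fun H => ?_) hz
    have hc : IntervalIntegrable (fun u => quadSum (acov fun l => ψ l u) H) volume 0 1 := by
      refine ContinuousOn.intervalIntegrable ?_
      rw [uIcc_of_le zero_le_one]
      exact h.continuousOn_quadSum (by linarith) he1 hC H
    rw [← intervalIntegral.integral_sub hc (hs1.const_mul _)]
    have := intervalIntegral.norm_integral_le_of_norm_le_const (a := (0 : ℝ)) (b := 1)
      (f := fun u => quadSum (acov fun l => ψ l u) H - 8 * π ^ 3 * LongMemory.slice ψ u)
      (C := K * C ^ 8 * kf δ H) (fun u hu => by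
        rw [uIoc_of_le zero_le_one] at hu
        rw [norm_sub_rev]; exact hQ H u ⟨hu.1.le, hu.2⟩)
    simpa using this
  · intro u hu
    rw [tendsto_iff_norm_sub_tendsto_zero]
    refine squeeze_zero (fun _ => norm_nonneg _) (fun H => ?_) hz
    rw [norm_sub_rev]; exact hQ H u hu

lemma CoeffDecay.pow_eight_le (h : CoeffDecay ψ e C) (he : 1 / 2 < e) {u : ℝ}
    (hu : u ∈ Icc (0 : ℝ) 1) (l H : ℕ) : ψ l u ^ 8 ≤ quadSum (acov fun l => ψ l u) H := by
  refine le_trans ?_ (pow_four_le_quadSum _ H)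
  have := sq_le_acov_zero he (fun l => h.bound l u hu) l
  calc ψ l u ^ 8 = (ψ l u ^ 2) ^ 4 := by ring
    _ ≤ _ := by gcongr

/-- The lower bound ψ_l(u)⁸ for the truncated sums does not depend on H and so survives the limit.
-/
lemma CoeffDecay.slice_pos (h : CoeffDecay ψ e C) {b δ : ℝ} (hb : 3 / 4 < b)
    (hδ : 0 < δ) (hbδ : b + δ = 2 * e - 1) (he1 : e < 1) (hC : 0 ≤ C) {l : ℕ} {u : ℝ}
    (hu : u ∈ Icc (0 : ℝ) 1) (hne : ψ l u ≠ 0) : 0 < LongMemory.slice ψ u := by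
  have h1 := ge_of_tendsto' ((h.tendsto_integral_quadSum hb hδ hbδ he1 hC).2 u hu)
    fun H => h.pow_eight_le (by linarith) hu l H
  have h2 : 0 < ψ l u ^ 8 := by positivity
  have := Real.pi_pos
  by_contra hcon
  have : 8 * π ^ 3 * LongMemory.slice ψ u ≤ 0 :=
    mul_nonpos_of_nonneg_of_nonpos (by positivity) (not_lt.1 hcon)
  linarith

/-- The same lower bound integrated over u: ψ_l⁸ is continuous, nonnegative and nonzero somewhere.
-/
lemma CoeffDecay.intF4_pos (h : CoeffDecay ψ e C) {b δ : ℝ} (hb : 3 / 4 < b)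
    (hδ : 0 < δ) (hbδ : b + δ = 2 * e - 1) (he1 : e < 1) (hC : 0 ≤ C) {l : ℕ} {u : ℝ}
    (hu : u ∈ Icc (0 : ℝ) 1) (hne : ψ l u ≠ 0) : 0 < intF4 ψ := by
  have hcont : ContinuousOn (fun v => ψ l v ^ 8) (Icc 0 1) := (h.cont l).pow 8
  have h0 : 0 < ∫ v in (0 : ℝ)..1, ψ l v ^ 8 :=
    intervalIntegral.integral_pos zero_lt_one hcont (fun v _ => by positivity)
      ⟨u, hu, by positivity⟩
  have h1 := ge_of_tendsto' (h.tendsto_integral_quadSum hb hδ hbδ he1 hC).1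
    (b := ∫ v in (0 : ℝ)..1, ψ l v ^ 8) fun H => by
      refine intervalIntegral.integral_mono_on zero_le_one ?_ ?_ fun v hv =>
        h.pow_eight_le (by linarith) hv l H
      · exact ContinuousOn.intervalIntegrable (by rwa [uIcc_of_le zero_le_one])
      · refine ContinuousOn.intervalIntegrable ?_
        rw [uIcc_of_le zero_le_one]
        exact h.continuousOn_quadSum (by linarith) he1 hC H
  have := Real.pi_pos
  by_contra hcon
  have : 8 * π ^ 3 * intF4 ψ ≤ 0 :=
    mul_nonpos_of_nonneg_of_nonpos (by positivity) (not_lt.1 hcon)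
  linarith

end

/-! ### Limits of the variances of the statistics. -/

/-- Midpoint Riemann sums. -/
lemma tendsto_midpoint_sum {F : ℝ → ℝ} (hF : ContinuousOn F (Icc 0 1)) {M : ℕ → ℕ}
    (hM0 : ∀ n, 0 < M n) (hM : Tendsto M atTop atTop) :
    Tendsto (fun n => (1 / M n : ℝ) * ∑ j ∈ Finset.range (M n), F (((j : ℝ) + 1 / 2) / M n)) atTop
      (𝓝 (∫ u in (0 : ℝ)..1, F u)) := by
  have huc := isCompact_Icc.uniformContinuousOn_of_continuous hF
  rw [Metric.uniformContinuousOn_iff] at huc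
  rw [Metric.tendsto_atTop]
  intro ε hε
  obtain ⟨η, hη, H⟩ := huc (ε / 2) (by linarith)
  have hMr : Tendsto (fun n => 1 / (M n : ℝ)) atTop (𝓝 0) :=
    tendsto_one_div_atTop_nhds_zero_nat.comp hM
  obtain ⟨n₀, hn₀⟩ := eventually_atTop.1 (hMr.eventually (gt_mem_nhds hη))
  refine ⟨n₀, fun n hn => ?_⟩
  have hm : (0 : ℝ) < M n := by exact_mod_cast hM0 n
  set m := M n with hmdef
  have hstep := hn₀ n hn
  rw [← hmdef] at hstep
  have hpt : ∀ j < m, Icc ((j : ℝ) / m) ((j + 1 : ℕ) / m) ⊆ Icc 0 1 := fun j hj x hx => by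
    refine ⟨le_trans (by positivity) hx.1, hx.2.trans ?_⟩
    rw [div_le_one hm]; exact_mod_cast hj
  have hle : ∀ j : ℕ, (j : ℝ) / m ≤ ((j + 1 : ℕ) : ℝ) / m := fun j => by
    gcongr; exact_mod_cast Nat.le_succ j
  have hsplit := intervalIntegral.sum_integral_adjacent_intervals (f := F) (μ := volume)
    (a := fun j : ℕ => (j : ℝ) / m) (n := m) (fun j hj => by
      refine ContinuousOn.intervalIntegrable ?_
      rw [uIcc_of_le (hle j)]
      exact hF.mono (hpt j hj))
  simp only [Nat.cast_zero, zero_div, div_self hm.ne'] at hsplit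
  have hlen : ∀ j : ℕ, ((j + 1 : ℕ) : ℝ) / m - (j : ℝ) / m = 1 / m := fun j => by
    push_cast; field_simp; ring
  have hterm : ∀ j ∈ Finset.range m, |1 / (m : ℝ) * F (((j : ℝ) + 1 / 2) / m) -
      ∫ x in ((j : ℝ) / m)..((j + 1 : ℕ) / m), F x| ≤ ε / 2 * (1 / m) := fun j hj => by
    rw [Finset.mem_range] at hj
    have hmid : ((j : ℝ) + 1 / 2) / m ∈ Icc ((j : ℝ) / m) ((j + 1 : ℕ) / m) := by
      constructor
      · gcongr; linarith
      · gcongr; push_cast; linarith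
    have e1 : 1 / (m : ℝ) * F (((j : ℝ) + 1 / 2) / m) =
        ∫ x in ((j : ℝ) / m)..((j + 1 : ℕ) / m), F (((j : ℝ) + 1 / 2) / m) := by
      rw [intervalIntegral.integral_const, hlen, smul_eq_mul]
    rw [e1, ← intervalIntegral.integral_sub (by simp) (by
      refine ContinuousOn.intervalIntegrable ?_
      rw [uIcc_of_le (hle j)]
      exact hF.mono (hpt j hj))]
    have := intervalIntegral.norm_integral_le_of_norm_le_const (a := (j : ℝ) / m)
      (b := (j + 1 : ℕ) / m) (f := fun x => F (((j : ℝ) + 1 / 2) / m) - F x) (C := ε / 2)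
      (fun x hx => by
        rw [uIoc_of_le (hle j)] at hx
        have hx' : x ∈ Icc ((j : ℝ) / m) ((j + 1 : ℕ) / m) := ⟨hx.1.le, hx.2⟩
        rw [← dist_eq_norm]
        refine (H _ (hpt j hj hmid) _ (hpt j hj hx') ?_).le
        rw [Real.dist_eq, abs_lt]
        have := hlen j
        constructor <;> linarith [hmid.1, hmid.2, hx'.1, hx'.2])
    rw [hlen, abs_of_nonneg (by positivity : (0 : ℝ) ≤ 1 / m)] at this
    exact this
  rw [Real.dist_eq, ← hsplit, Finset.mul_sum, ← Finset.sum_sub_distrib]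
  calc _ ≤ ∑ j ∈ Finset.range m, ε / 2 * (1 / (m : ℝ)) :=
        (Finset.abs_sum_le_sum_abs _ _).trans (Finset.sum_le_sum hterm)
    _ = ε / 2 := by
        rw [Finset.sum_const, Finset.card_range, nsmul_eq_mul]; field_simp
    _ < ε := by linarith

section

variable {Ω : Type*} [MeasurableSpace Ω] {P : Measure Ω} [IsProbabilityMeasure P]

/-- The variance of A + tB is a nonnegative quadratic in t, so its discriminant is nonpositive. -/
lemma sq_covariance_le {A B : Ω → ℝ} (hA : MemLp A 2 P) (hB : MemLp B 2 P) :
    cov[A, B; P] ^ 2 ≤ Var[A; P] * Var[B; P] := by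
  have h := discrim_le_zero (a := Var[B; P]) (b := 2 * cov[A, B; P]) (c := Var[A; P]) fun t => by
    have h1 := variance_fun_add hA (hB.const_mul t)
    rw [covariance_const_mul_right, variance_const_mul] at h1
    have := variance_nonneg (fun ω => A ω + t * B ω) P
    nlinarith
  unfold discrim at h
  nlinarith

/-- By Cauchy–Schwarz the cross term is at most the square root of a product of which one factor
tends to 0. -/
lemma tendsto_variance_add {A B : ℕ → Ω → ℝ} (hA : ∀ n, MemLp (A n) 2 P) (hB : ∀ n, MemLp (B n) 2 P)
    {r : ℕ → ℝ} {L : ℝ}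
    (lA : Tendsto (fun n => r n * Var[A n; P]) atTop (𝓝 L))
    (lB : Tendsto (fun n => r n * Var[B n; P]) atTop (𝓝 0)) :
    Tendsto (fun n => r n * Var[fun ω => A n ω + B n ω; P]) atTop (𝓝 L) := by
  have hc : Tendsto (fun n => r n * cov[A n, B n; P]) atTop (𝓝 0) := by
    have hs : Tendsto (fun n => √((r n * Var[A n; P]) * (r n * Var[B n; P]))) atTop (𝓝 0) := by
      have := (lA.mul lB).sqrt
      rwa [mul_zero, Real.sqrt_zero] at this
    refine squeeze_zero_norm (fun n => ?_) hs
    rw [Real.norm_eq_abs]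
    refine Real.abs_le_sqrt ?_
    have := mul_le_mul_of_nonneg_left (sq_covariance_le (hA n) (hB n)) (sq_nonneg (r n))
    nlinarith
  have : ∀ n, r n * Var[fun ω => A n ω + B n ω; P] =
      r n * Var[A n; P] + 2 * (r n * cov[A n, B n; P]) + r n * Var[B n; P] := fun n => by
    rw [variance_fun_add (hA n) (hB n)]; ring
  simp only [this]
  simpa using (lA.add (hc.const_mul 2)).add lB

variable {X : ℕ → ℤ → Ω → ℝ} {Z : ℤ → Ω → ℝ} {ψT : ℕ → ℤ → ℕ → ℝ} {ψ : ℕ → ℝ → ℝ} {d a : ℝ → ℝ}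

lemma exists_psiT_bound (hX : IsLocallyStationary P X Z ψT ψ d a) {e C : ℝ}
    (hdec : CoeffDecay ψ e C) (he0 : 0 < e) (he : e < 1 - dSup d) :
    ∃ A : ℝ, C ≤ A ∧ ∀ T : ℕ, ∀ t : ℤ, 1 ≤ t → t ≤ T → ∀ l, |ψT T t l| ≤ A * kf e l := by
  obtain ⟨C1, h1, H1⟩ := exists_psiT_approx hX he0 he
  refine ⟨C + C1, by linarith, fun T t ht htT l => ?_⟩
  have ht' : (1 : ℝ) ≤ t := by exact_mod_cast ht
  have htT' : (t : ℝ) ≤ T := by exact_mod_cast htT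
  have hT : (1 : ℝ) ≤ T := by linarith
  have hu : (t : ℝ) / T ∈ Icc (0 : ℝ) 1 := ⟨by positivity, by rwa [div_le_one (by linarith)]⟩
  have h2 := H1 T t ht htT _ hu l
  rw [sub_self, abs_zero, add_zero] at h2
  have h3 := hdec.bound l _ hu
  have h4 : 1 / (T : ℝ) ≤ 1 := by rw [div_le_one (by linarith)]; exact hT
  have hk := kf_nonneg e l
  calc |ψT T t l| ≤ |ψT T t l - ψ l ((t : ℝ) / T)| + |ψ l ((t : ℝ) / T)| := by
        have := abs_add_le (ψT T t l - ψ l ((t : ℝ) / T)) (ψ l ((t : ℝ) / T))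
        rwa [sub_add_cancel] at this
    _ ≤ C1 * 1 * kf e l + C * kf e l := by
        refine add_le_add (h2.trans ?_) h3
        gcongr
    _ = _ := by ring

/-- Limit of the normalised covariance sums of the sample. -/
lemma tendsto_blockSums (hX : IsLocallyStationary P X Z ψT ψ d a) {e b δ C w L : ℝ}
    (hb : 3 / 4 < b) (hδ : 0 < δ) (hbδ : b + δ = 2 * e - 1) (he1 : e < 1) (he : e < 1 - dSup d)
    (hC : 0 ≤ C) (hdec : CoeffDecay ψ e C) {N M T : ℕ → ℕ} {χ : ℕ → ℤ → ℝ}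
    (hT : ∀ n, T n = N n * M n) (hN : Tendsto N atTop atTop) (hM : ∀ n, 0 < M n)
    {u : ℕ → ℕ → ℝ} (hu : ∀ n j, u n j ∈ Icc (0 : ℝ) 1)
    {θ : ℕ → ℝ} (hθ : Tendsto θ atTop (𝓝 0)) (hθ0 : ∀ n, 0 ≤ θ n)
    (happ : ∀ n, ∀ j < M n, ∀ x ∈ blk (j * N n) (N n), ∀ l,
      |ψT (T n) (x + 1) l - ψ l (u n j)| ≤ θ n * kf e l)
    (hχ : ∀ n, IsSel (N n) (χ n)) {w' l : ℕ → ℝ}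
    (hw' : ∀ n (j : ℕ), ∑ s ∈ box (j * N n) (N n), χ n (alt s) = w' n * (N n : ℝ) ^ 3)
    (hw : Tendsto w' atTop (𝓝 w))
    (hl : ∀ H : ℕ, Tendsto (fun n => (1 / M n : ℝ) * ∑ j ∈ Finset.range (M n),
      quadSum (acov fun k => ψ k (u n j)) H) atTop (𝓝 (l H)))
    (hL : Tendsto l atTop (𝓝 L)) :
    Tendsto (fun n => (1 / (M n * (N n : ℝ) ^ 3)) * Var[fun ω => ∑ j ∈ Finset.range (M n),
      blockStat (χ n) (j * N n) (N n) fun t => sample X (T n) t ω; P]) atTop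
      (𝓝 ((8 * w + 32) * L)) := by
  have he78 : 7 / 8 < e := by linarith
  obtain ⟨A, hCA, hA⟩ := exists_psiT_bound hX hdec (by linarith) he
  have hA0 : 0 ≤ A := hC.trans hCA
  have hψA : ∀ v ∈ Icc (0 : ℝ) 1, ∀ l, |ψ l v| ≤ A * kf e l := fun v hv l =>
    (hdec.bound l v hv).trans (mul_le_mul_of_nonneg_right hCA (kf_nonneg _ _))
  obtain ⟨C1, h1, H1⟩ := exists_covK_bound (e := e) (by linarith) he1
  obtain ⟨C2, h2, H2⟩ := exists_acov_bound (e := e) (by linarith) he1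
  set K := C1 * A ^ 2 + C2 * A ^ 2 + C1 * (A + A) with hK
  have hK1 : C1 * A ^ 2 ≤ K := by
    have : 0 ≤ C2 * A ^ 2 := by positivity
    have : 0 ≤ C1 * (A + A) := by positivity
    linarith
  have hK2 : C2 * A ^ 2 ≤ K := by
    have : 0 ≤ C1 * A ^ 2 := by positivity
    have : 0 ≤ C1 * (A + A) := by positivity
    linarith
  have hK3 : C1 * (A + A) ≤ K := by
    have : 0 ≤ C1 * A ^ 2 := by positivity
    have : 0 ≤ C2 * A ^ 2 := by positivity
    linarith
  have main := tendsto_total (K := K) (w := w) (L := L) hb hδ (by linarith) (by positivity)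
    (c := fun n => covK P (sample X (T n)))
    (g := fun n j => acov fun k => ψ k (u n j)) hN hM hχ hθ hθ0 (fun n x y => covK_comm _ _ _)
    (fun n x y => ?_) (fun n j h => ?_) (fun n j hj x hx y hy => ?_) hw' hw hl hL
  · refine main.congr fun n => ?_
    rw [variance_sum_blockStat (isGaussianProcess_sample hX (T n)) (integral_sample hX (T n))]
  · rw [hbδ]
    exact ((H1 hX (T n) A (hA (T n)) x y).1).trans
      (mul_le_mul_of_nonneg_right hK1 (kf_nonneg _ _))
  · rw [hbδ]
    exact ((H2 _ _ A 0 h (hψA _ (hu n j)) (hψA _ (hu n j))).1).trans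
      (mul_le_mul_of_nonneg_right hK2 (kf_nonneg _ _))
  · have hrange : ∀ z ∈ blk (j * N n) (N n), 1 ≤ z + 1 ∧ z + 1 ≤ (T n : ℤ) := fun z hz => by
      rw [mem_blk] at hz
      have h3 : ((j : ℤ) + 1) * N n ≤ T n := by
        rw [hT n, mul_comm (N n)]
        exact_mod_cast Nat.mul_le_mul_right (N n) hj
      have h4 : (0 : ℤ) ≤ j * N n := by positivity
      constructor <;> linarith [hz.1, hz.2]
    refine ((H1 hX (T n) A (hA (T n)) x y).2 (fun k => ψ k (u n j)) A (θ n) (hψA _ (hu n j)) hA0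
      (hrange x hx) (hrange y hy) (happ n j hj x hx) (happ n j hj y hy)).trans ?_
    refine mul_le_mul_of_nonneg_left ?_ (hθ0 n)
    have h5 : kf (2 * e - 1) (y - x) ≤ kf b (y - x) := kf_exp_anti (by linarith) _
    have h6 := kf_nonneg (2 * e - 1) (y - x)
    exact mul_le_mul hK3 h5 h6 (by positivity)

/-- The crude bound applies with the full exponent b = 2e - 1, as no truncation is needed here. -/
lemma tendsto_blockSums_rhoW (hX : IsLocallyStationary P X Z ψT ψ d a) {e C : ℝ}
    (he78 : 7 / 8 < e) (he1 : e < 1) (he : e < 1 - dSup d)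
    (hdec : CoeffDecay ψ e C) {N M T : ℕ → ℕ}
    (hN : Tendsto N atTop atTop) (hN0 : ∀ n, 0 < N n) (hM : ∀ n, 0 < M n) :
    Tendsto (fun n => (1 / (M n * (N n : ℝ) ^ 5)) * Var[fun ω => ∑ j ∈ Finset.range (M n),
      blockStat rhoW (j * N n) (N n) fun t => sample X (T n) t ω; P]) atTop (𝓝 0) := by
  obtain ⟨A, hCA, hA⟩ := exists_psiT_bound hX hdec (by linarith) he
  obtain ⟨C1, h1, H1⟩ := exists_covK_bound (e := e) (by linarith) he1
  have main := tendsto_total_full (b := 2 * e - 1) (K := C1 * A ^ 2) (R := 2) (by linarith)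
    (by linarith) (χ := fun _ => rhoW) (c := fun n => covK P (sample X (T n))) hN hN0 hM
    (fun n => rhoW_neg) (fun n => abs_rhoW_le) (fun n x y => covK_comm _ _ _)
    (fun n x y => (H1 hX (T n) A (hA (T n)) x y).1)
  refine main.congr fun n => ?_
  rw [variance_sum_blockStat (isGaussianProcess_sample hX (T n)) (integral_sample hX (T n))]

lemma memLp_blockSum (hX : IsLocallyStationary P X Z ψT ψ d a) (χ : ℤ → ℝ) (T N M : ℕ) (r : ℝ) :
    MemLp (fun ω => r * ∑ j ∈ Finset.range M,
      blockStat χ (j * N) N fun t => sample X T t ω) 2 P :=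
  ((AllMoments.sum fun _ _ =>
    allMoments_blockStat (isGaussianProcess_sample hX T) _ _ _).const_mul r).memLp_two

/-- The weight of `selZero`, normalised. -/
lemma sum_selZero_eq {N : ℕ} (hN : 0 < N) (m : ℤ) :
    ∑ s ∈ box m N, selZero (alt s) = (2 / 3 + 1 / 3 * (N : ℝ) ^ (-2 : ℝ)) * (N : ℝ) ^ 3 := by
  have : (N : ℝ) ≠ 0 := by exact_mod_cast hN.ne'
  rw [sum_selZero, Real.rpow_neg (by positivity), Real.rpow_two]
  field_simp

lemma tendsto_selZero_weight {N : ℕ → ℕ} (hN : Tendsto N atTop atTop) :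
    Tendsto (fun n => 2 / 3 + 1 / 3 * (N n : ℝ) ^ (-2 : ℝ)) atTop (𝓝 (2 / 3)) := by
  have := ((tendsto_natCast_rpow_neg two_pos hN).const_mul (1 / 3 : ℝ)).const_add (2 / 3 : ℝ)
  rwa [mul_zero, add_zero] at this

section LocallyStationary

variable (hX : IsLocallyStationary P X Z ψT ψ d a) {e b δ C : ℝ}
    (hb : 3 / 4 < b) (hδ : 0 < δ) (hbδ : b + δ = 2 * e - 1) (he1 : e < 1) (he : e < 1 - dSup d)
    (hC : 0 ≤ C) (hdec : CoeffDecay ψ e C) {N M T : ℕ → ℕ}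
    (hT : ∀ n, T n = N n * M n) (hN : Tendsto N atTop atTop) (hN0 : ∀ n, 0 < N n)
    (hM : ∀ n, 0 < M n) (hNT : Tendsto (fun n => (N n : ℝ) / T n) atTop (𝓝 0))

include hX hb hδ hbδ he1 he hC hdec hT hN hN0 hM hNT

lemma tendsto_blockSums_midpoint {χ : ℕ → ℤ → ℝ} (hχ : ∀ n, IsSel (N n) (χ n)) {w' : ℕ → ℝ} {w : ℝ}
    (hw' : ∀ n (j : ℕ), ∑ s ∈ box (j * N n) (N n), χ n (alt s) = w' n * (N n : ℝ) ^ 3)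
    (hw : Tendsto w' atTop (𝓝 w)) :
    Tendsto (fun n => (T n : ℝ) * Var[fun ω => 1 / (8 * π ^ 2 * M n * (N n : ℝ) ^ 2) *
      ∑ j ∈ Finset.range (M n), blockStat (χ n) (j * N n) (N n) fun t => sample X (T n) t ω; P])
      atTop (𝓝 ((8 * w + 32) / (8 * π) * intF4 ψ)) := by
  obtain ⟨C1, h1, H1⟩ := exists_psiT_approx hX (by linarith) he
  have hMr : ∀ n, (0 : ℝ) < M n := fun n => by exact_mod_cast hM n
  have hNr : ∀ n, (0 : ℝ) < N n := fun n => by exact_mod_cast hN0 n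
  have hTr : ∀ n, (T n : ℝ) = N n * M n := fun n => by rw [hT n]; push_cast; ring
  have hMinv : ∀ n, (N n : ℝ) / T n = 1 / M n := fun n => by
    have := (hMr n).ne'; have := (hNr n).ne'
    rw [hTr n]; field_simp
  -- N/T = 1/M, so N/T → 0 forces the number of blocks to infinity.
  have hMlim : Tendsto M atTop atTop := by
    rw [← tendsto_natCast_atTop_iff (R := ℝ)]
    have h2 : Tendsto (fun n => (M n : ℝ)⁻¹) atTop (𝓝[>] 0) := by
      refine tendsto_nhdsWithin_of_tendsto_nhds_of_eventually_within _ ?_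
        (Eventually.of_forall fun n => inv_pos.2 (hMr n))
      refine hNT.congr fun n => ?_
      rw [hMinv n, one_div]
    exact h2.inv_tendsto_nhdsGT_zero.congr fun n => by simp
  -- Midpoints of the blocks; the value 0 for j ≥ M only keeps u in [0,1] for all j.
  set u : ℕ → ℕ → ℝ := fun n j => if j < M n then ((j : ℝ) + 1 / 2) / M n else 0 with hu
  have hu01 : ∀ n j, u n j ∈ Icc (0 : ℝ) 1 := fun n j => by
    simp only [hu]
    split_ifs with h
    · refine ⟨by positivity, ?_⟩
      rw [div_le_one (hMr n)]
      have : (j : ℝ) + 1 ≤ M n := by exact_mod_cast h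
      linarith
    · simp
  -- Within a block both 1/T and the distance of t/T to the midpoint are at most N/T, whence θ.
  have main := tendsto_blockSums hX (T := T) (u := u) (θ := fun n => C1 * (2 * ((N n : ℝ) / T n)))
    (l := fun H => ∫ v in (0 : ℝ)..1, quadSum (acov fun l => ψ l v) H) (L := 8 * π ^ 3 * intF4 ψ)
    hb hδ hbδ he1 he hC hdec hT hN hM hu01
    (by simpa using (hNT.const_mul 2).const_mul C1) (fun n => by positivity)
    (fun n j hj x hx l => ?_) hχ hw' hw (fun H => ?_)
    (hdec.tendsto_integral_quadSum hb hδ hbδ he1 hC).1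
  -- T (8π²MN²)⁻² = (64π⁴)⁻¹ (MN³)⁻¹ for T = NM; multiplied by 8π³ this leaves 1/(8π).
  · refine (main.const_mul (1 / (64 * π ^ 4))).congr' (Eventually.of_forall fun n => ?_) |>.trans
      (le_of_eq ?_)
    · rw [variance_const_mul, hTr n]
      have := (hMr n).ne'; have := (hNr n).ne'; have := Real.pi_ne_zero
      field_simp
      ring
    · congr 1
      have := Real.pi_ne_zero
      field_simp; ring
  · have hx' := mem_blk.1 hx
    have h3 : ((j : ℤ) + 1) * N n ≤ T n := by
      rw [hT n, mul_comm (N n)]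
      exact_mod_cast Nat.mul_le_mul_right (N n) hj
    have h4 : (0 : ℤ) ≤ j * N n := by positivity
    refine (H1 (T n) (x + 1) (by linarith) (by linarith) _ (hu01 n j) l).trans ?_
    have hT0 : (0 : ℝ) < T n := by rw [hTr n]; exact mul_pos (hNr n) (hMr n)
    have hk := kf_nonneg e l
    gcongr
    rw [two_mul]
    refine add_le_add ?_ ?_
    · gcongr; exact_mod_cast hN0 n
    · simp only [hu, if_pos hj]
      have e1 : ((j : ℝ) + 1 / 2) / M n = ((j : ℝ) * N n + N n / 2) / T n := by
        have := (hMr n).ne'; have := (hNr n).ne'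
        rw [hTr n]; field_simp
      rw [e1, ← sub_div, abs_div, abs_of_pos hT0]
      gcongr
      have r1 : (j : ℝ) * N n ≤ x := by exact_mod_cast hx'.1
      have r2 : (x : ℝ) + 1 ≤ j * N n + N n := by exact_mod_cast hx'.2
      have := hNr n
      push_cast
      rw [abs_le]
      constructor <;> linarith
  · refine (tendsto_midpoint_sum (hdec.continuousOn_quadSum (by linarith) he1 hC H) hM hMlim).congr
      fun n => ?_
    congr 1
    refine Finset.sum_congr rfl fun j hj => ?_
    simp only [hu, if_pos (Finset.mem_range.1 hj)]

lemma tendsto_variance_FTilde (hE : ∀ n, Even (N n)) :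
    Tendsto (fun n => (T n : ℝ) * Var[FTilde X (T n) (N n) (M n); P]) atTop
      (𝓝 (14 / (3 * π) * intF4 ψ)) := by
  have h := tendsto_blockSums_midpoint hX hb hδ hbδ he1 he hC hdec hT hN hN0 hM hNT
    (χ := fun _ => selZero) (fun n => isSel_selZero _) (fun n j => sum_selZero_eq (hN0 n) _)
    (tendsto_selZero_weight hN)
  have e1 : (8 * (2 / 3) + 32) / (8 * π) * intF4 ψ = 14 / (3 * π) * intF4 ψ := by
    have := Real.pi_ne_zero
    field_simp; ring
  rw [e1] at h
  refine h.congr fun n => ?_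
  rw [FTilde_eq X (hN0 n) (hE n) (hM n) (hT n)]

lemma tendsto_variance_FHat (hE : ∀ n, Even (N n)) :
    Tendsto (fun n => (T n : ℝ) * Var[FHat X (T n) (N n) (M n); P]) atTop
      (𝓝 (5 / π * intF4 ψ)) := by
  have h := tendsto_blockSums_midpoint hX hb hδ hbδ he1 he hC hdec hT hN hN0 hM hNT
    (χ := fun n => selDvd (N n)) (fun n => isSel_selDvd _) (w' := fun _ => 1)
    (fun n j => by rw [sum_selDvd (hN0 n), one_mul]) tendsto_const_nhds
  have e1 : (8 * 1 + 32) / (8 * π) * intF4 ψ = 5 / π * intF4 ψ := by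
    have := Real.pi_ne_zero
    field_simp; ring
  rw [e1] at h
  have h2 := tendsto_blockSums_rhoW (T := T) hX (by linarith) he1 he hdec hN hN0 hM
  have h3 : Tendsto (fun n => (T n : ℝ) * Var[fun ω => 1 / (8 * π ^ 2 * M n * (N n : ℝ) ^ 3) *
      ∑ j ∈ Finset.range (M n), blockStat rhoW (j * N n) (N n) fun t => sample X (T n) t ω; P])
      atTop (𝓝 0) := by
    have h4 := h2.const_mul (1 / (64 * π ^ 4))
    rw [mul_zero] at h4
    refine h4.congr fun n => ?_
    have : (M n : ℝ) ≠ 0 := by exact_mod_cast (hM n).ne'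
    have : (N n : ℝ) ≠ 0 := by exact_mod_cast (hN0 n).ne'
    have := Real.pi_ne_zero
    rw [variance_const_mul, hT n]
    push_cast
    field_simp
    ring
  refine (tendsto_variance_add (fun n => memLp_blockSum hX _ _ _ _ _)
    (fun n => memLp_blockSum hX _ _ _ _ _) h h3).congr fun n => ?_
  rw [FHat_eq X (hN0 n) (hE n) (hM n) (hT n)]

end LocallyStationary

section Stationary

variable (hX : IsLocallyStationary P X Z ψT ψ d a) {e b δ C : ℝ}
    (hb : 3 / 4 < b) (hδ : 0 < δ) (hbδ : b + δ = 2 * e - 1) (he1 : e < 1) (he : e < 1 - dSup d)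
    (hC : 0 ≤ C) (hdec : CoeffDecay ψ e C)
    (hst : ∀ T : ℕ, ∀ t : ℤ, 1 ≤ t → t ≤ T → ∀ l : ℕ, ∀ u ∈ Icc (0 : ℝ) 1, ψT T t l = ψ l u)

include hX hb hδ hbδ he1 he hC hdec hst

/-- One block of length T: the approximation is exact (θ = 0), and any u serves because the
coefficients do not depend on it. The prefactor is T (2πT²)⁻² = (4π²)⁻¹ T⁻³. -/
lemma tendsto_blockSums_stationary {u : ℝ} (hu : u ∈ Icc (0 : ℝ) 1) {χ : ℕ → ℤ → ℝ}
    (hχ : ∀ n, IsSel (n + 1) (χ n)) {w' : ℕ → ℝ} {w : ℝ}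
    (hw' : ∀ n (j : ℕ), ∑ s ∈ box (j * (n + 1 : ℕ)) (n + 1), χ n (alt s) =
      w' n * ((n + 1 : ℕ) : ℝ) ^ 3)
    (hw : Tendsto w' atTop (𝓝 w)) :
    Tendsto (fun n => ((n + 1 : ℕ) : ℝ) * Var[fun ω => 1 / (2 * π * ((n + 1 : ℕ) : ℝ) ^ 2) *
      ∑ j ∈ Finset.range 1, blockStat (χ n) (j * (n + 1 : ℕ)) (n + 1)
        fun t => sample X (n + 1) t ω; P])
      atTop (𝓝 ((8 * w + 32) * (2 * π * LongMemory.slice ψ u))) := by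
  have hpi := Real.pi_ne_zero
  have main := tendsto_blockSums hX (N := fun n => n + 1) (M := fun _ => 1) (T := fun n => n + 1)
    (u := fun _ _ => u) (θ := fun _ => 0)
    (l := fun H => quadSum (acov fun l => ψ l u) H) (L := 8 * π ^ 3 * LongMemory.slice ψ u)
    hb hδ hbδ he1 he hC hdec (fun n => by simp) (tendsto_add_atTop_nat 1) (fun _ => one_pos)
    (fun _ _ => hu) tendsto_const_nhds (fun _ => le_rfl) (fun n j hj x hx l => ?_) hχ hw' hw
    (fun H => by simp) ((hdec.tendsto_integral_quadSum hb hδ hbδ he1 hC).2 u hu)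
  · have h1 := main.const_mul (1 / (4 * π ^ 2))
    have e1 : 1 / (4 * π ^ 2) * ((8 * w + 32) * (8 * π ^ 3 * LongMemory.slice ψ u)) =
        (8 * w + 32) * (2 * π * LongMemory.slice ψ u) := by field_simp; ring
    rw [e1] at h1
    refine h1.congr fun n => ?_
    have : ((n + 1 : ℕ) : ℝ) ≠ 0 := by exact_mod_cast Nat.succ_ne_zero n
    rw [variance_const_mul]
    generalize ((n + 1 : ℕ) : ℝ) = y at *
    rw [Nat.cast_one]
    field_simp
    ring
  · have hx' := mem_blk.1 hx
    have hj0 : j = 0 := by omega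
    subst hj0
    rw [hst (n + 1) (x + 1) (by have := hx'.1; push_cast at this; linarith)
      (by have := hx'.2; push_cast at this ⊢; linarith) l u hu]
    simp

lemma tendsto_variance_GInt {u : ℝ} (hu : u ∈ Icc (0 : ℝ) 1) :
    Tendsto (fun T : ℕ => (T : ℝ) * Var[GInt X T; P]) atTop
      (𝓝 ((8 * (2 / 3) + 32) * (2 * π * LongMemory.slice ψ u))) := by
  -- The shift to T = n + 1 avoids the empty sample T = 0.
  refine (tendsto_add_atTop_iff_nat 1).1 ?_
  refine (tendsto_blockSums_stationary hX hb hδ hbδ he1 he hC hdec hst hu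
    (χ := fun _ => selZero) (fun n => isSel_selZero _)
    (fun n j => sum_selZero_eq (Nat.succ_pos n) _)
    (tendsto_selZero_weight (tendsto_add_atTop_nat 1))).congr fun n => ?_
  rw [GInt_eq]

lemma tendsto_variance_GSum {u : ℝ} (hu : u ∈ Icc (0 : ℝ) 1) :
    Tendsto (fun T : ℕ => (T : ℝ) * Var[GSum X T; P]) atTop
      (𝓝 ((8 * 1 + 32) * (2 * π * LongMemory.slice ψ u))) := by
  refine (tendsto_add_atTop_iff_nat 1).1 ?_
  refine (tendsto_blockSums_stationary hX hb hδ hbδ he1 he hC hdec hst hu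
    (χ := fun n => selDvd (n + 1)) (fun n => isSel_selDvd _) (w' := fun _ => 1)
    (fun n j => by rw [sum_selDvd (Nat.succ_pos n), one_mul]) tendsto_const_nhds).congr fun n => ?_
  rw [GSum_eq X (Nat.succ_pos n)]

end Stationary

end

end LongMemory

end

/-! ### The main theorem. -/

theorem mainTheorem8 {Ω : Type*} [MeasurableSpace Ω] (P : Measure Ω) [IsProbabilityMeasure P]
    (X : ℕ → ℤ → Ω → ℝ) (Z : ℤ → Ω → ℝ) (ψT : ℕ → ℤ → ℕ → ℝ) (ψ : ℕ → ℝ → ℝ) (d a : ℝ → ℝ)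
    (hX : LongMemory.IsLocallyStationary P X Z ψT ψ d a) (hd : LongMemory.dSup d < 1 / 8) :
    -- the limiting variances below are finite
    IntegrableOn (fun p : ℝ × ℝ => LongMemory.specDensity ψ p.1 p.2 ^ 4)
      (Icc 0 1 ×ˢ Icc (-π) π) ∧
    -- limiting variances of the integrated statistic and of the Riemann sum statistic
    (∀ N M T : ℕ → ℕ, (∀ n, 0 < N n) → (∀ n, Even (N n)) → (∀ n, 0 < M n) →
      (∀ n, T n = N n * M n) →
      Tendsto N atTop atTop →
      Tendsto (fun n => (N n : ℝ) / T n) atTop (𝓝 0) →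
      Tendsto (fun n => √(T n : ℝ) / (N n : ℝ) ^ (1 - 4 * LongMemory.dSup d)) atTop (𝓝 0) →
      (∀ n, MemLp (LongMemory.FTilde X (T n) (N n) (M n)) 2 P) ∧
      (∀ n, MemLp (LongMemory.FHat X (T n) (N n) (M n)) 2 P) ∧
      Tendsto (fun n => (T n : ℝ) * variance (LongMemory.FTilde X (T n) (N n) (M n)) P) atTop
        (𝓝 (14 / (3 * π) * LongMemory.intF4 ψ)) ∧
      Tendsto (fun n => (T n : ℝ) * variance (LongMemory.FHat X (T n) (N n) (M n)) P) atTop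
        (𝓝 (5 / π * LongMemory.intF4 ψ))) ∧
    -- the two limits are different, unless the limiting process is identically zero
    ((∃ l : ℕ, ∃ u ∈ Icc (0 : ℝ) 1, ψ l u ≠ 0) →
      14 / (3 * π) * LongMemory.intF4 ψ ≠ 5 / π * LongMemory.intF4 ψ) ∧
    -- the same effect for the usual periodogram in the stationary case
    ((∀ T : ℕ, ∀ t : ℤ, 1 ≤ t → t ≤ T → ∀ l : ℕ, ∀ u ∈ Icc (0 : ℝ) 1, ψT T t l = ψ l u) →
      (∃ l : ℕ, ∃ u ∈ Icc (0 : ℝ) 1, ψ l u ≠ 0) →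
      (∀ T : ℕ, MemLp (LongMemory.GInt X T) 2 P) ∧
      (∀ T : ℕ, MemLp (LongMemory.GSum X T) 2 P) ∧
      ∃ v₁ v₂ : ℝ,
        Tendsto (fun T : ℕ => (T : ℝ) * variance (LongMemory.GInt X T) P) atTop (𝓝 v₁) ∧
        Tendsto (fun T : ℕ => (T : ℝ) * variance (LongMemory.GSum X T) P) atTop (𝓝 v₂) ∧
        v₁ ≠ v₂) := by
  obtain ⟨e, b, δ, C, hb, hδ, hbδ, he1, he, hC, hdec⟩ := LongMemory.exists_coeffDecay hX hd
  have hpi := Real.pi_pos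
  refine ⟨hdec.integrableOn (by linarith) he1, ?_, ?_, ?_⟩
  · intro N M T hN0 hE hM hT hN hNT _
    refine ⟨fun n => ?_, fun n => ?_,
      LongMemory.tendsto_variance_FTilde hX hb hδ hbδ he1 he hC hdec hT hN hN0 hM hNT hE,
      LongMemory.tendsto_variance_FHat hX hb hδ hbδ he1 he hC hdec hT hN hN0 hM hNT hE⟩
    · rw [LongMemory.FTilde_eq X (hN0 n) (hE n) (hM n) (hT n)]
      exact LongMemory.memLp_blockSum hX _ _ _ _ _
    · rw [LongMemory.FHat_eq X (hN0 n) (hE n) (hM n) (hT n)]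
      exact (LongMemory.memLp_blockSum hX _ _ _ _ _).add (LongMemory.memLp_blockSum hX _ _ _ _ _)
  · rintro ⟨l, u, hu, hne⟩ h
    have hpos := hdec.intF4_pos hb hδ hbδ he1 hC hu hne
    have h2 := mul_right_cancel₀ hpos.ne' h
    -- Equality of the two constants would mean 14 = 15.
    rw [div_eq_div_iff (by positivity) (by positivity)] at h2
    nlinarith
  · rintro hst ⟨l, u, hu, hne⟩
    have hpos := hdec.slice_pos hb hδ hbδ he1 hC hu hne
    refine ⟨fun T => ?_, fun T => ?_, _, _,
      LongMemory.tendsto_variance_GInt hX hb hδ hbδ he1 he hC hdec hst hu,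
      LongMemory.tendsto_variance_GSum hX hb hδ hbδ he1 he hC hdec hst hu, fun h => ?_⟩
    · rw [LongMemory.GInt_eq]
      exact LongMemory.memLp_blockSum hX _ _ _ _ _
    · rcases Nat.eq_zero_or_pos T with rfl | hT
      -- For T = 0 the sum over k is empty.
      · have : LongMemory.GSum X 0 = fun _ => 0 := by
          ext ω; simp [LongMemory.GSum]
        rw [this]
        exact memLp_const 0
      · rw [LongMemory.GSum_eq X hT]
        exact LongMemory.memLp_blockSum hX _ _ _ _ _
    · have h2 := mul_right_cancel₀ (by positivity) h
      -- The remaining equation is 8 · (2/3) + 32 = 8 + 32.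
      norm_num at h2
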